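/- **Proposition 2.1.** Write $\square=\partial_t^2-\Delta$ on $\mathbb{R}_+\times\mathbb{R}^3$, $\mathbb{R}_+=[0,\infty)$, $r=|x|$ and $v'=(\partial_t v,\nabla_x v)$. There is a constant $C>0$ such that the following holds for all real-valued $v,G$ and all $t\ge 0$. Suppose that $v$ solves $\square v=G$ in $\mathbb{R}_+\times\mathbb{R}^3$, in the following sense: $v$, $G$ and the distributional gradient $v'$ are locally integrable functions on $(0,\infty)\times\mathbb{R}^3$, the equation $\square v=G$ holds there in the sense of distributions, and $v'\in C([0,\infty);L^2_{\mathrm{loc}}(\mathbb{R}^3))$ (this includes classical $C^2$ solutions as well as finite energy solutions, and gives $v'(0,\cdot)$ its meaning). Then $$(\ln(2+t))^{-1/2}\,\big\|(1+r)^{-1/2}v'\big\|_{L^2([0,t]\times\mathbb{R}^3)}\le C\,\|v'(0,\cdot)\|_{L^2(\mathbb{R}^3)}+C\int_0^t\|G(s,\cdot)\|_{L^2(\mathbb{R}^3)}\,ds ,$$ where both sides are understood in $[0,\infty]$; in particular, the left side is finite whenever the right side is. -/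

import Mathlib

open MeasureTheory Set Filter Topology
open scoped ContDiff ENNReal

namespace WaveKSS

/-- Space `ℝ³` with its Euclidean norm. -/
abbrev Space : Type := EuclideanSpace ℝ (Fin 3)

/-- Space-time points `(t, x)`, with Lebesgue measure `dt dx`. -/
abbrev SpaceTime : Type := ℝ × Space

/-- Values of the space-time gradient `v' = (∂ₜv, ∂₁v, ∂₂v, ∂₃v)`, with the Euclidean norm
`|v'|² = |∂ₜv|² + |∂₁v|² + |∂₂v|² + |∂₃v|²`. -/
abbrev Grad : Type := EuclideanSpace ℝ (Fin 4)

/-- The coordinate directions of space-time: `0` is time, `1, 2, 3` are the space directions. -/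
noncomputable def dir : Fin 4 → SpaceTime :=
  Fin.cons ((1 : ℝ), (0 : Space)) fun i : Fin 3 => ((0 : ℝ), EuclideanSpace.single i (1 : ℝ))

/-- The classical partial derivative in the direction `dir k` (used for test functions). -/
noncomputable def pderiv (k : Fin 4) (φ : SpaceTime → ℝ) (z : SpaceTime) : ℝ :=
  fderiv ℝ φ z (dir k)

/-- The d'Alembertian `□ = ∂ₜ² - Δ` (used for test functions). -/
noncomputable def box (φ : SpaceTime → ℝ) (z : SpaceTime) : ℝ :=
  pderiv 0 (pderiv 0 φ) z - ∑ i : Fin 3, pderiv i.succ (pderiv i.succ φ) z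

/-- The open half space-time `(0, ∞) × ℝ³`. -/
def upper : Set SpaceTime := Ioi (0 : ℝ) ×ˢ (univ : Set Space)

/-- Test functions: smooth, with compact support in `(0, ∞) × ℝ³`. -/
structure IsTest (φ : SpaceTime → ℝ) : Prop where
  smooth : ContDiff ℝ ∞ φ
  compact : HasCompactSupport φ
  support : tsupport φ ⊆ upper

/-- `w` is the gradient `v'` of `v` on `(0, ∞) × ℝ³` in the sense of distributions. -/
structure IsWeakGrad (v : SpaceTime → ℝ) (w : SpaceTime → Grad) : Prop where
  locInt : LocallyIntegrableOn v upper
  locInt_grad : LocallyIntegrableOn w upper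
  eq : ∀ (k : Fin 4) (φ : SpaceTime → ℝ), IsTest φ →
    ∫ z, v z * pderiv k φ z = -∫ z, w z k * φ z

/-- `□ v = G` on `(0, ∞) × ℝ³` in the sense of distributions. -/
structure IsWeakWave (v G : SpaceTime → ℝ) : Prop where
  locInt : LocallyIntegrableOn v upper
  locInt_source : LocallyIntegrableOn G upper
  eq : ∀ φ : SpaceTime → ℝ, IsTest φ → ∫ z, v z * box φ z = ∫ z, G z * φ z

/-- `t ↦ w(t, ·)` is a continuous map from `[0, ∞)` to `L²_loc(ℝ³)`. -/
structure IsContL2Loc (w : SpaceTime → Grad) : Prop where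
  memLp : ∀ t : ℝ, 0 ≤ t → ∀ K : Set Space, IsCompact K →
    MemLp (fun x => w (t, x)) 2 (volume.restrict K)
  cont : ∀ t : ℝ, 0 ≤ t → ∀ K : Set Space, IsCompact K →
    Tendsto (fun s => eLpNorm (fun x => w (s, x) - w (t, x)) 2 (volume.restrict K))
      (𝓝[Ici 0] t) (𝓝 0)

/-- `v`, with gradient `v' = w`, solves the wave equation `□ v = G` in `ℝ₊ × ℝ³`: the equation and
the gradient are understood in the sense of distributions, and `v'` is continuous in time, up to
`t = 0`, with values in `L²_loc(ℝ³)`, which gives the initial value `v'(0, ·) = w(0, ·)` its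
meaning. Classical solutions and finite energy solutions are both of this kind; nothing is
assumed on the behaviour at spatial infinity. -/
structure IsWaveSolution (v : SpaceTime → ℝ) (w : SpaceTime → Grad) (G : SpaceTime → ℝ) :
    Prop where
  grad : IsWeakGrad v w
  wave : IsWeakWave v G
  cont : IsContL2Loc w

end WaveKSS

/-! The estimate comes from summing one Morawetz inequality over dyadic scales in `r`. For smooth
`v`, let `A` be the `L²` size of the initial gradient plus the time integral of the `L²` size of
`□v`. The energy method (`energy_estimate`) bounds `‖v'(s)‖` by `2A`.

Multiply the equation by `h (x·∇u + u)` with `h = (R² + |x|²)^(-1/2)`. The divergence identity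
leaves the positive bulk term `½ R² h³ |u'|²`, of size `|u'|²/R` where `|x| ≲ R`. By `hardy` the
multiplier is bounded in `L²` by the energy, uniformly in `R`, so the bulk term integrates to at
most a constant times `A²` (`morawetz_estimate`). On a time interval of length `T`, the weight
`1/(1+r)` is at most a constant times the sum of these densities over `R = 2^k ≲ T`, plus `1/(1+T)`.
There are about `log(2+T)` scales, each costing `A²`, and the remainder costs `A²` by the energy
bound. This is `exists_classical_estimate`, and it explains the factor `(ln(2+t))^(-1/2)`.

Nothing is assumed at spatial infinity, so everything is done on balls. The energy is weighted by a
function decreasing along light cones, and the Morawetz identity is applied to `χ (v - c)`, where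
`χ` is a cutoff at scale `N ≥ 2 + T` and `c` comes from `poincare_ball`. The commutators are
`O(1/N)` in the right norms and are integrated over a time of length at most `N`, which keeps the
constant independent of `N` (`exists_localised_morawetz`).

For weak solutions, the smooth estimate is applied to mollifications on `[a, b]` with `a > 0`. The
right side survives by Minkowski's inequality, and the left side passes to the limit by Lebesgue
differentiation and Fatou (`exists_weak_estimate`). Then `a → 0` by continuity in `L²_loc`
(`exists_estimate_ball`), and finally `N → ∞`. -/

namespace WaveKSS

/-! ### Calculus of partial derivatives on space-time. -/

section Partial

variable {f g : SpaceTime → ℝ} {k l : Fin 4} {z : SpaceTime}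

lemma contDiff_pderiv (hf : ContDiff ℝ ∞ f) (k : Fin 4) : ContDiff ℝ ∞ (pderiv k f) :=
  (hf.fderiv_right (m := ∞) (by simp)).clm_apply contDiff_const

lemma contDiff_box (hf : ContDiff ℝ ∞ f) : ContDiff ℝ ∞ (box f) := by
  have h : ∀ k, ContDiff ℝ ∞ (pderiv k (pderiv k f)) := fun k =>
    contDiff_pderiv (contDiff_pderiv hf k) k
  exact (h 0).sub (ContDiff.sum fun i _ => h i.succ)

lemma smooth_differentiable (hf : ContDiff ℝ ∞ f) : Differentiable ℝ f :=
  hf.differentiable (by simp)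

lemma pderiv_add (hf : Differentiable ℝ f) (hg : Differentiable ℝ g) :
    pderiv k (fun y => f y + g y) z = pderiv k f z + pderiv k g z := by
  simp [pderiv, fderiv_fun_add (hf z) (hg z)]

lemma pderiv_sub (hf : Differentiable ℝ f) (hg : Differentiable ℝ g) :
    pderiv k (fun y => f y - g y) z = pderiv k f z - pderiv k g z := by
  simp [pderiv, fderiv_fun_sub (hf z) (hg z)]

lemma pderiv_neg : pderiv k (fun y => - f y) z = - pderiv k f z := by
  simp [pderiv, fderiv_fun_neg]

lemma pderiv_sum {ι : Type*} [Fintype ι] {F : ι → SpaceTime → ℝ}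
    (hF : ∀ i, Differentiable ℝ (F i)) :
    pderiv k (fun y => ∑ i, F i y) z = ∑ i, pderiv k (F i) z := by
  simp [pderiv, fderiv_fun_sum fun i _ => hF i z]

lemma pderiv_const (c : ℝ) : pderiv k (fun _ => c) z = 0 := by
  simp [pderiv]

lemma pderiv_mul (hf : Differentiable ℝ f) (hg : Differentiable ℝ g) :
    pderiv k (fun y => f y * g y) z = pderiv k f z * g z + f z * pderiv k g z := by
  simp [pderiv, fderiv_fun_mul (hf z) (hg z)]; ring

lemma pderiv_const_mul (hf : Differentiable ℝ f) (c : ℝ) :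
    pderiv k (fun y => c * f y) z = c * pderiv k f z := by
  rw [pderiv_mul (differentiable_const c) hf, pderiv_const]; ring

lemma pderiv_comp {θ : ℝ → ℝ} {d : ℝ} (hθ : HasDerivAt θ d (f z)) (hf : Differentiable ℝ f) :
    pderiv k (fun y => θ (f y)) z = d * pderiv k f z := by
  have := hθ.comp_hasFDerivAt z (hf z).hasFDerivAt
  simp only [pderiv]
  rw [show (fun y => θ (f y)) = θ ∘ f from rfl, this.fderiv]; simp

lemma pderiv_sq (hf : Differentiable ℝ f) :
    pderiv k (fun y => f y ^ 2) z = 2 * f z * pderiv k f z := by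
  simp only [pow_two]
  rw [pderiv_mul hf hf]; ring

lemma pderiv_comm (hf : ContDiff ℝ ∞ f) :
    pderiv k (pderiv l f) z = pderiv l (pderiv k f) z := by
  have hs : IsSymmSndFDerivAt ℝ f z := (contDiff_infty.1 hf 2).contDiffAt.isSymmSndFDerivAt (by simp)
  have hd : DifferentiableAt ℝ (fderiv ℝ f) z :=
    (hf.fderiv_right (m := ∞) (by simp)).differentiable (by simp) z
  have : ∀ m n : Fin 4, pderiv m (pderiv n f) z = fderiv ℝ (fderiv ℝ f) z (dir m) (dir n) := by
    intro m n
    have h1 : HasFDerivAt (pderiv n f)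
        ((ContinuousLinearMap.apply ℝ ℝ (dir n)).comp (fderiv ℝ (fderiv ℝ f) z)) z :=
      (ContinuousLinearMap.apply ℝ ℝ (dir n)).hasFDerivAt.comp z hd.hasFDerivAt
    rw [pderiv, h1.fderiv]; simp
  rw [this, this, hs.eq]

lemma differentiable_time : Differentiable ℝ (fun z : SpaceTime => z.1) := differentiable_fst

lemma contDiff_coord (i : Fin 3) : ContDiff ℝ ∞ (fun z : SpaceTime => z.2 i) := by
  fun_prop

lemma differentiable_coord (i : Fin 3) : Differentiable ℝ (fun z : SpaceTime => z.2 i) :=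
  smooth_differentiable (contDiff_coord i)

lemma pderiv_time : pderiv k (fun z : SpaceTime => z.1) z = if k = 0 then 1 else 0 := by
  have : HasFDerivAt (fun z : SpaceTime => z.1) (ContinuousLinearMap.fst ℝ ℝ Space) z :=
    hasFDerivAt_fst
  rw [pderiv, this.fderiv]
  refine Fin.cases ?_ (fun i => ?_) k <;> simp [dir]

lemma pderiv_coord (i : Fin 3) :
    pderiv k (fun z : SpaceTime => z.2 i) z = if k = i.succ then 1 else 0 := by
  have : HasFDerivAt (fun z : SpaceTime => z.2 i)
      ((EuclideanSpace.proj i : Space →L[ℝ] ℝ).comp (ContinuousLinearMap.snd ℝ ℝ Space)) z :=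
    ((EuclideanSpace.proj i : Space →L[ℝ] ℝ).comp (ContinuousLinearMap.snd ℝ ℝ Space)).hasFDerivAt
  rw [pderiv, this.fderiv]
  refine Fin.cases ?_ (fun j => ?_) k
  · simp [dir, Fin.succ_ne_zero, eq_comm]
  · simp [dir, PiLp.single_apply, eq_comm]

lemma pderiv_eq_zero_of_eventually (h : f =ᶠ[𝓝 z] fun _ => 0) : pderiv k f z = 0 := by
  simp [pderiv, h.fderiv_eq]

lemma pderiv_congr (h : f =ᶠ[𝓝 z] g) : pderiv k f z = pderiv k g z := by
  simp [pderiv, h.fderiv_eq]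

lemma hasDerivAt_time (hf : Differentiable ℝ f) (s : ℝ) (x : Space) :
    HasDerivAt (fun τ => f (τ, x)) (pderiv 0 f (s, x)) s := by
  have h2 : HasDerivAt (fun τ : ℝ => ((τ, x) : SpaceTime)) ((1 : ℝ), (0 : Space)) s :=
    (hasDerivAt_id s).prodMk (hasDerivAt_const s x)
  exact (hf (s, x)).hasFDerivAt.comp_hasDerivAt s h2

lemma hasFDerivAt_space (hf : Differentiable ℝ f) (s : ℝ) (x : Space) :
    HasFDerivAt (fun y => f (s, y))
      ((fderiv ℝ f (s, x)).comp (ContinuousLinearMap.inr ℝ ℝ Space)) x := by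
  have h2 : HasFDerivAt (fun y : Space => ((s, y) : SpaceTime))
      (ContinuousLinearMap.inr ℝ ℝ Space) x := by
    simpa using (hasFDerivAt_prodMk_right s x)
  exact (hf (s, x)).hasFDerivAt.comp x h2

lemma fderiv_space_single (hf : Differentiable ℝ f) (s : ℝ) (x : Space) (i : Fin 3) :
    fderiv ℝ (fun y => f (s, y)) x (EuclideanSpace.single i 1) = pderiv i.succ f (s, x) := by
  rw [(hasFDerivAt_space hf s x).fderiv]
  simp [pderiv, dir]

end Partial

/-! ### The divergence theorem on slabs. -/

section Slab

lemma continuous_slice {f : SpaceTime → ℝ} (hf : Continuous f) (s : ℝ) :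
    Continuous fun x : Space => f (s, x) := by fun_prop

lemma integrableOn_slice {f : SpaceTime → ℝ} (hf : Continuous f) (s ρ : ℝ) :
    IntegrableOn (fun x : Space => f (s, x)) (Metric.closedBall 0 ρ) :=
  (continuous_slice hf s).continuousOn.integrableOn_compact (isCompact_closedBall 0 ρ)

lemma continuous_ball_integral {f : SpaceTime → ℝ} (hf : Continuous f) (ρ : ℝ) :
    Continuous fun s => ∫ x in Metric.closedBall (0 : Space) ρ, f (s, x) :=
  continuous_parametric_integral_of_continuous (f := fun s x => f (s, x)) hf
    (isCompact_closedBall 0 ρ)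

/-- Integration by parts against the constant `1`; the compact support removes the boundary term. -/
lemma integral_space_pderiv {P : SpaceTime → ℝ} (hP : ContDiff ℝ ∞ P) {s ρ : ℝ}
    (h0 : ∀ x : Space, ρ < ‖x‖ → P (s, x) = 0) (i : Fin 3) :
    ∫ x in Metric.closedBall (0 : Space) ρ, pderiv i.succ P (s, x) = 0 := by
  have hd := smooth_differentiable hP
  set f : Space → ℝ := fun x => P (s, x)
  have hf : ContDiff ℝ ∞ f := hP.comp (contDiff_const.prodMk contDiff_id)
  have hfs : HasCompactSupport f := by
    refine HasCompactSupport.intro (isCompact_closedBall (0 : Space) ρ) fun x hx => h0 x ?_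
    simpa using hx
  have hd1 : Continuous fun x => fderiv ℝ f x (EuclideanSpace.single i 1) :=
    ((hf.fderiv_right (m := ∞) (by simp)).clm_apply contDiff_const).continuous
  have hsupp : HasCompactSupport fun x => fderiv ℝ f x (EuclideanSpace.single i 1) :=
    hfs.fderiv_apply (𝕜 := ℝ) _
  have h1 : ∫ x, fderiv ℝ f x (EuclideanSpace.single i 1) = 0 := by
    have := integral_mul_fderiv_eq_neg_fderiv_mul_of_integrable (𝕜 := ℝ) (μ := (volume : Measure Space))
      (f := fun _ => (1 : ℝ)) (g := f) (v := EuclideanSpace.single i 1) (by simp)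
      (by simpa using hd1.integrable_of_hasCompactSupport hsupp)
      (by simpa using hf.continuous.integrable_of_hasCompactSupport hfs)
      (by fun_prop) (fun x _ => hf.differentiable (by simp) x)
    simpa using this
  rw [setIntegral_eq_integral_of_forall_compl_eq_zero]
  · simpa only [f, fderiv_space_single hd] using h1
  · intro x hx
    have : f =ᶠ[𝓝 x] fun _ => 0 := by
      filter_upwards [Metric.isClosed_closedBall.isOpen_compl.mem_nhds hx] with y hy
      exact h0 y (by simpa using hy)
    rw [← fderiv_space_single hd, this.fderiv_eq]; simp

lemma integral_time_pderiv {P : SpaceTime → ℝ} (hP : ContDiff ℝ ∞ P) {a b : ℝ} (hab : a ≤ b)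
    (ρ : ℝ) :
    ∫ s in a..b, ∫ x in Metric.closedBall (0 : Space) ρ, pderiv 0 P (s, x) =
      (∫ x in Metric.closedBall (0 : Space) ρ, P (b, x)) -
        ∫ x in Metric.closedBall (0 : Space) ρ, P (a, x) := by
  have hc : Continuous (pderiv 0 P) := (contDiff_pderiv hP 0).continuous
  rw [intervalIntegral.integral_of_le hab, integral_integral_swap]
  · rw [← integral_sub (integrableOn_slice hP.continuous b ρ)
      (integrableOn_slice hP.continuous a ρ)]
    congr 1
    ext x
    rw [← intervalIntegral.integral_of_le hab]
    exact intervalIntegral.integral_eq_sub_of_hasDerivAt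
      (fun s _ => hasDerivAt_time (smooth_differentiable hP) s x)
      ((hc.comp (by fun_prop : Continuous fun s : ℝ => (s, x))).intervalIntegrable a b)
  · rw [Measure.prod_restrict]
    have : IntegrableOn (pderiv 0 P) (Icc a b ×ˢ Metric.closedBall (0 : Space) ρ) :=
      hc.continuousOn.integrableOn_compact (isCompact_Icc.prod (isCompact_closedBall 0 ρ))
    exact this.mono_set (prod_mono Ioc_subset_Icc_self subset_rfl)

/-- The divergence theorem on a slab, for a current that vanishes outside a ball. -/
lemma integral_divergence {P : Fin 4 → SpaceTime → ℝ} (hP : ∀ k, ContDiff ℝ ∞ (P k))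
    {a b ρ : ℝ} (hab : a ≤ b)
    (h0 : ∀ i : Fin 3, ∀ s ∈ Icc a b, ∀ x : Space, ρ < ‖x‖ → P i.succ (s, x) = 0) :
    ∫ s in a..b, ∫ x in Metric.closedBall (0 : Space) ρ, ∑ k, pderiv k (P k) (s, x) =
      (∫ x in Metric.closedBall (0 : Space) ρ, P 0 (b, x)) -
        ∫ x in Metric.closedBall (0 : Space) ρ, P 0 (a, x) := by
  rw [← integral_time_pderiv (hP 0) hab]
  refine intervalIntegral.integral_congr fun s hs => ?_
  rw [uIcc_of_le hab] at hs
  have hc : ∀ k, Continuous (pderiv k (P k)) := fun k => (contDiff_pderiv (hP k) k).continuous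
  rw [integral_finsetSum _ fun k _ => integrableOn_slice (hc k) s ρ, Fin.sum_univ_succ]
  simp [integral_space_pderiv (hP _) (h0 _ s hs)]

end Slab

/-! ### Local energy estimate. -/

section Energy

/-- The squared length of the classical space-time gradient. -/
noncomputable def gradSq (f : SpaceTime → ℝ) (z : SpaceTime) : ℝ := ∑ k, pderiv k f z ^ 2

lemma gradSq_nonneg (f : SpaceTime → ℝ) (z : SpaceTime) : 0 ≤ gradSq f z :=
  Finset.sum_nonneg fun _ _ => sq_nonneg _

lemma gradSq_eq (f : SpaceTime → ℝ) (z : SpaceTime) :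
    gradSq f z = pderiv 0 f z ^ 2 + ∑ i : Fin 3, pderiv i.succ f z ^ 2 := Fin.sum_univ_succ _

lemma contDiff_gradSq {f : SpaceTime → ℝ} (hf : ContDiff ℝ ∞ f) : ContDiff ℝ ∞ (gradSq f) :=
  ContDiff.sum fun k _ => (contDiff_pderiv hf k).pow 2

lemma cauchySchwarz_ball {f g : Space → ℝ} (hf : Continuous f) (hg : Continuous g) (ρ : ℝ) :
    ∫ x in Metric.closedBall (0 : Space) ρ, |f x| * |g x| ≤
      √(∫ x in Metric.closedBall (0 : Space) ρ, f x ^ 2) *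
        √(∫ x in Metric.closedBall (0 : Space) ρ, g x ^ 2) := by
  have hi : ∀ {f : Space → ℝ}, Continuous f →
      MemLp f (ENNReal.ofReal 2) (volume.restrict (Metric.closedBall (0 : Space) ρ)) := by
    intro f hf
    obtain ⟨C, hC⟩ := (isCompact_closedBall (0 : Space) ρ).exists_bound_of_continuousOn
      hf.continuousOn
    have : IsFiniteMeasure (volume.restrict (Metric.closedBall (0 : Space) ρ)) :=
      ⟨by simpa using (isCompact_closedBall (0 : Space) ρ).measure_lt_top (μ := volume)⟩
    refine MemLp.of_bound hf.aestronglyMeasurable C ?_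
    exact (ae_restrict_iff' measurableSet_closedBall).2 (Eventually.of_forall hC)
  have := integral_mul_norm_le_Lp_mul_Lq (μ := volume.restrict (Metric.closedBall (0 : Space) ρ))
    Real.HolderConjugate.two_two (hi hf) (hi hg)
  simpa [Real.sqrt_eq_rpow, Real.norm_eq_abs] using this

lemma setIntegral_ball_mono {f g : Space → ℝ} (hf : Continuous f) (hg : Continuous g) {ρ : ℝ}
    (h : ∀ x, ‖x‖ ≤ ρ → f x ≤ g x) :
    ∫ x in Metric.closedBall (0 : Space) ρ, f x ≤ ∫ x in Metric.closedBall (0 : Space) ρ, g x :=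
  setIntegral_mono_on (hf.continuousOn.integrableOn_compact (isCompact_closedBall 0 ρ))
    (hg.continuousOn.integrableOn_compact (isCompact_closedBall 0 ρ)) measurableSet_closedBall
    fun x hx => h x (by simpa using hx)

lemma setIntegral_ball_mono_radius {f : Space → ℝ} (hf : Continuous f) (h0 : ∀ x, 0 ≤ f x)
    {ρ σ : ℝ} (h : ρ ≤ σ) :
    ∫ x in Metric.closedBall (0 : Space) ρ, f x ≤ ∫ x in Metric.closedBall (0 : Space) σ, f x :=
  setIntegral_mono_set (hf.continuousOn.integrableOn_compact (isCompact_closedBall 0 σ))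
    (Eventually.of_forall h0) (Metric.closedBall_subset_closedBall h).eventuallyLE

/-- A regularised modulus: `√(R² + |x|²)`. -/
noncomputable def jap (R : ℝ) (z : SpaceTime) : ℝ := √(R ^ 2 + ∑ i : Fin 3, z.2 i ^ 2)

lemma norm_sq_space (x : Space) : ‖x‖ ^ 2 = ∑ i : Fin 3, x i ^ 2 := by
  rw [EuclideanSpace.norm_sq_eq]; simp

lemma jap_eq (R : ℝ) (z : SpaceTime) : jap R z = √(R ^ 2 + ‖z.2‖ ^ 2) := by
  rw [jap, norm_sq_space]

variable {R : ℝ}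

lemma jap_arg_pos (hR : 0 < R) (z : SpaceTime) : 0 < R ^ 2 + ∑ i : Fin 3, z.2 i ^ 2 := by
  have : 0 ≤ ∑ i : Fin 3, z.2 i ^ 2 := Finset.sum_nonneg fun _ _ => sq_nonneg _
  positivity

lemma jap_pos (hR : 0 < R) (z : SpaceTime) : 0 < jap R z := Real.sqrt_pos.2 (jap_arg_pos hR z)

lemma jap_sq (hR : 0 < R) (z : SpaceTime) : jap R z ^ 2 = R ^ 2 + ∑ i : Fin 3, z.2 i ^ 2 :=
  Real.sq_sqrt (jap_arg_pos hR z).le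

lemma contDiff_jap_arg (R : ℝ) :
    ContDiff ℝ ∞ fun z : SpaceTime => R ^ 2 + ∑ i : Fin 3, z.2 i ^ 2 :=
  contDiff_const.add (ContDiff.sum fun i _ => (contDiff_coord i).pow 2)

lemma contDiff_jap (hR : 0 < R) : ContDiff ℝ ∞ (jap R) :=
  (contDiff_jap_arg R).sqrt fun z => (jap_arg_pos hR z).ne'

lemma norm_le_jap (R : ℝ) (z : SpaceTime) : ‖z.2‖ ≤ jap R z := by
  rw [jap_eq]; exact Real.le_sqrt_of_sq_le (by nlinarith [sq_nonneg R])

lemma jap_le (hR : 0 < R) (z : SpaceTime) : jap R z ≤ R + ‖z.2‖ := by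
  rw [jap_eq]
  refine Real.sqrt_le_iff.2 ⟨by positivity, ?_⟩
  nlinarith [mul_nonneg hR.le (norm_nonneg z.2)]

lemma pderiv_jap_arg (R : ℝ) (k : Fin 4) (z : SpaceTime) :
    pderiv k (fun z : SpaceTime => R ^ 2 + ∑ i : Fin 3, z.2 i ^ 2) z =
      2 * (Fin.cons 0 z.2 : Fin 4 → ℝ) k := by
  have hq : ∀ i : Fin 3, Differentiable ℝ fun z : SpaceTime => z.2 i ^ 2 := fun i =>
    (differentiable_coord i).pow 2
  rw [pderiv_add (differentiable_const _) (Differentiable.fun_sum fun i _ => hq i), pderiv_sum hq,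
    pderiv_const]
  simp only [pderiv_sq (differentiable_coord _), pderiv_coord, Fin.sum_univ_three]
  refine Fin.cases (by simp [eq_comm]) (fun i => ?_) k
  rw [Fin.cons_succ]
  fin_cases i <;> simp

lemma pderiv_jap (hR : 0 < R) (k : Fin 4) (z : SpaceTime) :
    pderiv k (jap R) z = (jap R z)⁻¹ * (Fin.cons 0 z.2 : Fin 4 → ℝ) k := by
  have h := pderiv_comp (k := k) (Real.hasDerivAt_sqrt (jap_arg_pos hR z).ne')
    (smooth_differentiable (contDiff_jap_arg R))
  rw [show jap R = fun y => √((fun z : SpaceTime => R ^ 2 + ∑ i : Fin 3, z.2 i ^ 2) y) from rfl, h,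
    pderiv_jap_arg]
  field_simp

lemma deriv_smoothTransition_nonneg (y : ℝ) : 0 ≤ deriv Real.smoothTransition y :=
  Real.smoothTransition.monotone.deriv_nonneg

lemma hasDerivAt_smoothTransition (y : ℝ) :
    HasDerivAt Real.smoothTransition (deriv Real.smoothTransition y) y :=
  ((Real.smoothTransition.contDiff (n := 1)).differentiable (by simp) y).hasDerivAt

/-- The energy current, weighted by `ψ`. -/
noncomputable def energyCurrent (v ψ : SpaceTime → ℝ) : Fin 4 → SpaceTime → ℝ :=
  Fin.cons (fun y => ψ y * gradSq v y)
    (fun i : Fin 3 => fun y => -2 * (ψ y * (pderiv 0 v y * pderiv i.succ v y)))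


lemma sum_pderiv_energy_current {v ψ : SpaceTime → ℝ} (hv : ContDiff ℝ ∞ v)
    (hψ : ContDiff ℝ ∞ ψ) (z : SpaceTime) :
    ∑ k, pderiv k (energyCurrent v ψ k) z =
      pderiv 0 ψ z * gradSq v z
        - 2 * (∑ i : Fin 3, pderiv i.succ ψ z * pderiv i.succ v z) * pderiv 0 v z
        + 2 * ψ z * pderiv 0 v z * box v z := by
  have d1 : ∀ k, Differentiable ℝ (pderiv k v) := fun k =>
    smooth_differentiable (contDiff_pderiv hv k)
  have dψ := smooth_differentiable hψ
  rw [Fin.sum_univ_succ]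
  simp only [energyCurrent, Fin.cons_zero, Fin.cons_succ]
  have e0 : pderiv 0 (gradSq v) z = ∑ k, 2 * pderiv k v z * pderiv 0 (pderiv k v) z := by
    unfold gradSq
    rw [pderiv_sum fun k => (d1 k).fun_pow 2]
    simp only [pderiv_sq (d1 _)]
  rw [pderiv_mul dψ (smooth_differentiable (contDiff_gradSq hv)), e0]
  have ei : ∀ i : Fin 3, pderiv i.succ
      (fun y => -2 * (ψ y * (pderiv 0 v y * pderiv i.succ v y))) z =
      -2 * (pderiv i.succ ψ z * (pderiv 0 v z * pderiv i.succ v z) +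
        ψ z * (pderiv i.succ (pderiv 0 v) z * pderiv i.succ v z +
          pderiv 0 v z * pderiv i.succ (pderiv i.succ v) z)) := by
    intro i
    rw [pderiv_const_mul (dψ.fun_mul ((d1 _).fun_mul (d1 _))), pderiv_mul dψ ((d1 _).fun_mul (d1 _)),
      pderiv_mul (d1 _) (d1 _)]
  simp only [ei]
  -- With the mixed derivatives in a common order, those from the time component cancel those from
  -- the space components.
  simp only [pderiv_comm hv (l := 0)]
  rw [box, gradSq]
  simp only [Fin.sum_univ_succ, Fin.sum_univ_zero]
  ring

/-- The weight of the energy estimate, which decreases along backward light cones. -/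
noncomputable def coneWeight (a M : ℝ) (z : SpaceTime) : ℝ :=
  Real.smoothTransition (M + a - jap 1 z - z.1)

lemma contDiff_coneWeight (a M : ℝ) : ContDiff ℝ ∞ (coneWeight a M) :=
  Real.smoothTransition.contDiff.comp
    (((contDiff_const (c := M + a)).sub (contDiff_jap one_pos)).sub contDiff_fst)

lemma pderiv_coneWeight (a M : ℝ) (k : Fin 4) (z : SpaceTime) :
    pderiv k (coneWeight a M) z =
      - deriv Real.smoothTransition (M + a - jap 1 z - z.1) *
        (Fin.cons 1 (fun i => (jap 1 z)⁻¹ * z.2 i) : Fin 4 → ℝ) k := by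
  have dj := smooth_differentiable (contDiff_jap (one_pos))
  have d2 : Differentiable ℝ fun z : SpaceTime => M + a - jap 1 z := dj.const_sub _
  have h := pderiv_comp (k := k) (z := z)
    (f := fun z : SpaceTime => M + a - jap 1 z - z.1) (hasDerivAt_smoothTransition _)
    (d2.sub differentiable_time)
  rw [show coneWeight a M = fun y => Real.smoothTransition
    ((fun z : SpaceTime => M + a - jap 1 z - z.1) y) from rfl, h,
    pderiv_sub d2 differentiable_time, pderiv_sub (differentiable_const _) dj, pderiv_const,
    pderiv_jap one_pos, pderiv_time]
  refine Fin.cases ?_ (fun i => ?_) k <;> simp [Fin.succ_ne_zero]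

/-- The gradient of the weight is `-d (1, x/⟨x⟩)` with `d ≥ 0` and `|x/⟨x⟩| ≤ 1`, hence causal. The
sign is then the dominant energy condition `2 |w ∂ₜv| ≤ |v'|²`. -/
lemma coneWeight_flux_nonpos {v : SpaceTime → ℝ} (a M : ℝ) (z : SpaceTime) :
    pderiv 0 (coneWeight a M) z * gradSq v z
        - 2 * (∑ i : Fin 3, pderiv i.succ (coneWeight a M) z * pderiv i.succ v z) * pderiv 0 v z
      ≤ 0 := by
  simp only [pderiv_coneWeight, Fin.cons_zero, Fin.cons_succ]
  set d := deriv Real.smoothTransition (M + a - jap 1 z - z.1)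
  have hd : 0 ≤ d := deriv_smoothTransition_nonneg _
  have hs : ∑ i : Fin 3, -d * ((jap 1 z)⁻¹ * z.2 i) * pderiv i.succ v z =
      -d * ∑ i : Fin 3, ((jap 1 z)⁻¹ * z.2 i) * pderiv i.succ v z := by
    rw [Finset.mul_sum]; exact Finset.sum_congr rfl fun i _ => by ring
  rw [hs]
  set w := ∑ i : Fin 3, ((jap 1 z)⁻¹ * z.2 i) * pderiv i.succ v z
  set S := ∑ i : Fin 3, pderiv i.succ v z ^ 2 with hS
  have hS0 : 0 ≤ S := Finset.sum_nonneg fun _ _ => sq_nonneg _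
  have hw : w ^ 2 ≤ S := by
    have h1 := Finset.sum_mul_sq_le_sq_mul_sq Finset.univ (fun i : Fin 3 => (jap 1 z)⁻¹ * z.2 i)
      (fun i => pderiv i.succ v z)
    have h2 : ∑ i : Fin 3, ((jap 1 z)⁻¹ * z.2 i) ^ 2 ≤ 1 := by
      have := jap_sq one_pos z
      have hp := jap_pos one_pos z
      simp only [mul_pow]
      rw [← Finset.mul_sum, inv_pow, inv_mul_le_iff₀ (by positivity), this]; linarith
    exact h1.trans (mul_le_of_le_one_left hS0 h2)
  rw [gradSq_eq]
  have : 2 * w * pderiv 0 v z ≤ pderiv 0 v z ^ 2 + S := by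
    nlinarith [sq_nonneg (w - pderiv 0 v z)]
  nlinarith

/-- The energy estimate on truncated backward light cones. -/
theorem energy_estimate {v : SpaceTime → ℝ} (hv : ContDiff ℝ ∞ v) {a b ρ M : ℝ} (hab : a ≤ b)
    (hM : ρ + (b - a) + 2 ≤ M) {s : ℝ} (hs : s ∈ Icc a b) :
    √(∫ x in Metric.closedBall (0 : Space) ρ, gradSq v (s, x)) ≤
      √(∫ x in Metric.closedBall (0 : Space) M, gradSq v (a, x)) +
        2 * ∫ τ in a..b, √(∫ x in Metric.closedBall (0 : Space) M, box v (τ, x) ^ 2) := by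
  set ψ := coneWeight a M with hψd
  have hψ : ContDiff ℝ ∞ ψ := contDiff_coneWeight a M
  have hψ0 : ∀ z, 0 ≤ ψ z := fun z => Real.smoothTransition.nonneg _
  have hψ1 : ∀ z, ψ z ≤ 1 := fun z => Real.smoothTransition.le_one _
  have hg := contDiff_gradSq hv
  have hbx := (contDiff_box hv).continuous
  have h0v := (contDiff_pderiv hv 0).continuous
  set E : ℝ → ℝ := fun s => ∫ x in Metric.closedBall (0 : Space) M, ψ (s, x) * gradSq v (s, x)
  have hE : Continuous E := continuous_ball_integral (hψ.continuous.mul hg.continuous) M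
  have hE0 : ∀ s, 0 ≤ E s := fun s => integral_nonneg fun x =>
    mul_nonneg (hψ0 _) (gradSq_nonneg _ _)
  set g : ℝ → ℝ := fun τ => √(∫ x in Metric.closedBall (0 : Space) M, box v (τ, x) ^ 2)
  have hgc : Continuous g := (continuous_ball_integral (hbx.pow 2) M).sqrt
  have hg0 : ∀ τ, 0 ≤ g τ := fun τ => Real.sqrt_nonneg _
  have step : ∀ t ∈ Icc a b, E t ≤ E a + 2 * ∫ τ in a..t, √(E τ) * g τ := by
    intro t ht
    have hP : ∀ k, ContDiff ℝ ∞ (energyCurrent v ψ k) := by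
      refine Fin.cases (hψ.mul hg) fun i => ?_
      exact contDiff_const.mul (hψ.mul ((contDiff_pderiv hv 0).mul (contDiff_pderiv hv i.succ)))
    have key := integral_divergence hP ht.1 (ρ := M) (by
      intro i s hs x hx
      -- For `s ≥ a` and `|x| > M` the argument of the transition is negative because `jap 1`
      -- dominates `|x|`.
      have : ψ (s, x) = 0 := Real.smoothTransition.zero_of_nonpos (by
        have := norm_le_jap 1 (s, x)
        have := hs.1
        simp only at *; linarith)
      simp [energyCurrent, this])
    simp only [sum_pderiv_energy_current hv hψ] at key
    simp only [energyCurrent, Fin.cons_zero] at key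
    have hle : ∀ τ, ∫ x in Metric.closedBall (0 : Space) M,
        (pderiv 0 ψ (τ, x) * gradSq v (τ, x)
        - 2 * (∑ i : Fin 3, pderiv i.succ ψ (τ, x) * pderiv i.succ v (τ, x)) * pderiv 0 v (τ, x)
        + 2 * ψ (τ, x) * pderiv 0 v (τ, x) * box v (τ, x)) ≤ 2 * (√(E τ) * g τ) := by
      intro τ
      have c1 : Continuous fun x : Space => √(ψ (τ, x)) * pderiv 0 v (τ, x) :=
        (continuous_slice hψ.continuous τ).sqrt.mul (continuous_slice h0v τ)
      have c2 : Continuous fun x : Space => box v (τ, x) := continuous_slice hbx τ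
      have cψ : ∀ k, Continuous (pderiv k ψ) := fun k => (contDiff_pderiv hψ k).continuous
      have cv : ∀ k, Continuous (pderiv k v) := fun k => (contDiff_pderiv hv k).continuous
      have cg := hg.continuous
      have cψ0 := hψ.continuous
      calc _ ≤ ∫ x in Metric.closedBall (0 : Space) M,
            2 * (|√(ψ (τ, x)) * pderiv 0 v (τ, x)| * |box v (τ, x)|) := by
            refine setIntegral_ball_mono (by fun_prop) (by fun_prop) fun x _ => ?_
            have h1 := coneWeight_flux_nonpos (v := v) a M (τ, x)
            rw [← hψd] at h1
            -- Since `0 ≤ ψ ≤ 1`, `ψ ≤ √ψ`. Keeping `√ψ` on `∂ₜv` makes Cauchy–Schwarz return the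
            -- weighted energy `E`.
            have h2 : ψ (τ, x) * pderiv 0 v (τ, x) * box v (τ, x) ≤
                |√(ψ (τ, x)) * pderiv 0 v (τ, x)| * |box v (τ, x)| := by
              calc _ ≤ |ψ (τ, x) * pderiv 0 v (τ, x) * box v (τ, x)| := le_abs_self _
                _ = ψ (τ, x) * |pderiv 0 v (τ, x)| * |box v (τ, x)| := by
                  rw [abs_mul, abs_mul, abs_of_nonneg (hψ0 _)]
                _ ≤ _ := by
                  rw [abs_mul, abs_of_nonneg (Real.sqrt_nonneg _)]
                  gcongr
                  exact Real.le_sqrt_of_sq_le (by nlinarith [hψ0 (τ, x), hψ1 (τ, x)])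
            linarith
        _ = 2 * ∫ x in Metric.closedBall (0 : Space) M,
            |√(ψ (τ, x)) * pderiv 0 v (τ, x)| * |box v (τ, x)| := integral_const_mul _ _
        _ ≤ 2 * (√(∫ x in Metric.closedBall (0 : Space) M,
            (√(ψ (τ, x)) * pderiv 0 v (τ, x)) ^ 2) * g τ) := by
            gcongr; exact cauchySchwarz_ball c1 c2 M
        _ ≤ _ := by
            gcongr
            refine setIntegral_ball_mono (c1.pow 2) (by fun_prop) fun x _ => ?_
            rw [Pi.pow_apply, mul_pow, Real.sq_sqrt (hψ0 _)]
            refine mul_le_mul_of_nonneg_left ?_ (hψ0 _)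
            rw [gradSq_eq]
            have : 0 ≤ ∑ i : Fin 3, pderiv i.succ v (τ, x) ^ 2 :=
              Finset.sum_nonneg fun _ _ => sq_nonneg _
            linarith
    have hint : ∫ τ in a..t, ∫ x in Metric.closedBall (0 : Space) M,
        (pderiv 0 ψ (τ, x) * gradSq v (τ, x)
        - 2 * (∑ i : Fin 3, pderiv i.succ ψ (τ, x) * pderiv i.succ v (τ, x)) * pderiv 0 v (τ, x)
        + 2 * ψ (τ, x) * pderiv 0 v (τ, x) * box v (τ, x)) ≤
          ∫ τ in a..t, 2 * (√(E τ) * g τ) := by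
      refine intervalIntegral.integral_mono_on ht.1 ?_ ?_ fun τ _ => hle τ
      · refine (continuous_ball_integral
          (f := fun z => pderiv 0 ψ z * gradSq v z
          - 2 * (∑ i : Fin 3, pderiv i.succ ψ z * pderiv i.succ v z) * pderiv 0 v z
          + 2 * ψ z * pderiv 0 v z * box v z) ?_ M).intervalIntegrable _ _
        have cψ : ∀ k, Continuous (pderiv k ψ) := fun k => (contDiff_pderiv hψ k).continuous
        have cv : ∀ k, Continuous (pderiv k v) := fun k => (contDiff_pderiv hv k).continuous
        have cg := hg.continuous
        have cψ0 := hψ.continuous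
        fun_prop
      · exact ((hE.sqrt.mul hgc).const_mul 2).intervalIntegrable _ _
    rw [key, intervalIntegral.integral_const_mul] at hint
    simp only [E] at *
    linarith
  -- Evaluating at a maximum of `E` replaces Gronwall: `√E` comes out of the integral and a
  -- quadratic inequality for `√(E m)` remains.
  obtain ⟨m, hm, hmax⟩ := isCompact_Icc.exists_isMaxOn (nonempty_Icc.2 hab) hE.continuousOn
  set I := ∫ τ in a..b, g τ with hI
  have hI0 : 0 ≤ I := intervalIntegral.integral_nonneg hab fun τ _ => hg0 τ
  have hEm : E m ≤ E a + 2 * (√(E m) * I) := by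
    refine (step m hm).trans ?_
    gcongr
    calc ∫ τ in a..m, √(E τ) * g τ ≤ ∫ τ in a..m, √(E m) * g τ := by
          refine intervalIntegral.integral_mono_on hm.1 ((hE.sqrt.mul hgc).intervalIntegrable _ _)
            ((hgc.const_mul _).intervalIntegrable _ _) fun τ hτ => ?_
          gcongr
          · exact hmax ⟨hτ.1, hτ.2.trans hm.2⟩
      _ = √(E m) * ∫ τ in a..m, g τ := intervalIntegral.integral_const_mul _ _
      _ ≤ _ := by
          refine mul_le_mul_of_nonneg_left ?_ (Real.sqrt_nonneg _)
          exact intervalIntegral.integral_mono_interval le_rfl hm.1 hm.2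
            (Eventually.of_forall hg0) (hgc.intervalIntegrable _ _)
  have hsqrt : √(E m) ≤ √(E a) + 2 * I := by
    have h1 := Real.sq_sqrt (hE0 m)
    have h2 := Real.sq_sqrt (hE0 a)
    by_contra! hcon
    nlinarith [Real.sqrt_nonneg (E m), Real.sqrt_nonneg (E a)]
  have hsE : ∫ x in Metric.closedBall (0 : Space) ρ, gradSq v (s, x) ≤ E s := by
    have cg := hg.continuous
    have cψ0 := hψ.continuous
    calc _ ≤ ∫ x in Metric.closedBall (0 : Space) ρ, ψ (s, x) * gradSq v (s, x) := by
          refine setIntegral_ball_mono (by fun_prop) (by fun_prop) fun x hx => ?_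
          -- The margin `2` in `hM` is used here: one unit because the transition reaches `1` only
          -- at `1`, one because `jap 1 ≤ 1 + |x|`. The summand `b - a` pays for the shrinking of
          -- the cone.
          have : ψ (s, x) = 1 := Real.smoothTransition.one_of_one_le (by
            have := jap_le one_pos (s, x)
            have := hs.2
            simp only at *; linarith)
          rw [this, one_mul]
      _ ≤ _ := setIntegral_ball_mono_radius (by fun_prop)
          (fun x => mul_nonneg (hψ0 _) (gradSq_nonneg _ _)) (by linarith [hs.1, hs.2])
  have hEa : E a ≤ ∫ x in Metric.closedBall (0 : Space) M, gradSq v (a, x) := by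
    have cg := hg.continuous
    have cψ0 := hψ.continuous
    refine setIntegral_ball_mono (by fun_prop) (by fun_prop) fun x _ => ?_
    exact mul_le_of_le_one_left (gradSq_nonneg _ _) (hψ1 _)
  calc _ ≤ √(E m) := Real.sqrt_le_sqrt (hsE.trans (hmax hs))
    _ ≤ √(E a) + 2 * I := hsqrt
    _ ≤ _ := by gcongr

end Energy

/-! ### Morawetz identity, Hardy inequality and Morawetz estimate at a fixed scale. -/

section Morawetz

variable {R : ℝ}

/-- The regularised Newton potential `(R² + |x|²)^(-1/2)`. -/
noncomputable def pot (R : ℝ) (z : SpaceTime) : ℝ := (jap R z)⁻¹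

lemma pot_pos (hR : 0 < R) (z : SpaceTime) : 0 < pot R z := inv_pos.2 (jap_pos hR z)

lemma contDiff_pot (hR : 0 < R) : ContDiff ℝ ∞ (pot R) :=
  (contDiff_jap hR).inv fun z => (jap_pos hR z).ne'

lemma pot_sq_mul (hR : 0 < R) (z : SpaceTime) :
    pot R z ^ 2 * (R ^ 2 + ∑ i : Fin 3, z.2 i ^ 2) = 1 := by
  have := jap_pos hR z
  rw [← jap_sq hR, pot]
  field_simp

lemma pderiv_pot (hR : 0 < R) (k : Fin 4) (z : SpaceTime) :
    pderiv k (pot R) z = - (Fin.cons 0 z.2 : Fin 4 → ℝ) k * pot R z ^ 3 := by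
  have hp := jap_pos hR z
  have h := pderiv_comp (k := k) (hasDerivAt_inv hp.ne') (smooth_differentiable (contDiff_jap hR))
  rw [show pot R = fun y => (jap R y)⁻¹ from rfl, h, pderiv_jap hR]
  field_simp

/-- `x · ∇ₓu + u`. -/
noncomputable def dil (u : SpaceTime → ℝ) (z : SpaceTime) : ℝ :=
  ∑ i : Fin 3, z.2 i * pderiv i.succ u z + u z

lemma contDiff_dil {u : SpaceTime → ℝ} (hu : ContDiff ℝ ∞ u) : ContDiff ℝ ∞ (dil u) :=
  (ContDiff.sum fun i _ => (contDiff_coord i).mul (contDiff_pderiv hu i.succ)).add hu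

lemma pderiv_dil {u : SpaceTime → ℝ} (hu : ContDiff ℝ ∞ u) (k : Fin 4) (z : SpaceTime) :
    pderiv k (dil u) z = ∑ i : Fin 3, ((if k = i.succ then 1 else 0) * pderiv i.succ u z +
      z.2 i * pderiv k (pderiv i.succ u) z) + pderiv k u z := by
  have d1 : ∀ k, Differentiable ℝ (pderiv k u) := fun k =>
    smooth_differentiable (contDiff_pderiv hu k)
  have d2 : ∀ i : Fin 3, Differentiable ℝ fun z : SpaceTime => z.2 i * pderiv i.succ u z :=
    fun i => (differentiable_coord i).fun_mul (d1 _)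
  unfold dil
  rw [pderiv_add (Differentiable.fun_sum fun i _ => d2 i) (smooth_differentiable hu),
    pderiv_sum d2]
  simp only [pderiv_mul (differentiable_coord _) (d1 _), pderiv_coord]

lemma pderiv_gradSq {u : SpaceTime → ℝ} (hu : ContDiff ℝ ∞ u) (k : Fin 4) (z : SpaceTime) :
    pderiv k (gradSq u) z = ∑ l, 2 * pderiv l u z * pderiv k (pderiv l u) z := by
  have d1 : ∀ k, Differentiable ℝ (pderiv k u) := fun k =>
    smooth_differentiable (contDiff_pderiv hu k)
  unfold gradSq
  rw [pderiv_sum fun k => (d1 k).fun_pow 2]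
  simp only [pderiv_sq (d1 _)]

/-- The Morawetz current for the multiplier `(x · ∇u + u) / √(R² + |x|²)`. -/
noncomputable def morawetzCurrent (R : ℝ) (u : SpaceTime → ℝ) : Fin 4 → SpaceTime → ℝ :=
  Fin.cons (fun y => pderiv 0 u y * (pot R y * dil u y))
    (fun i : Fin 3 => fun y => (1 / 2) * (y.2 i * (pot R y * (gradSq u y - 2 * pderiv 0 u y ^ 2)))
      - (1 / 2) * (y.2 i * (pot R y ^ 3 * u y ^ 2)) - pderiv i.succ u y * (pot R y * dil u y))

lemma contDiff_morawetzCurrent (hR : 0 < R) {u : SpaceTime → ℝ} (hu : ContDiff ℝ ∞ u) (k : Fin 4) :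
    ContDiff ℝ ∞ (morawetzCurrent R u k) := by
  have h1 := contDiff_pot hR
  have h2 := contDiff_dil hu
  have h3 := contDiff_pderiv hu
  have h4 := contDiff_gradSq hu
  refine Fin.cases ?_ (fun i => ?_) k
  · exact (h3 0).mul (h1.mul h2)
  · have h5 := contDiff_coord i
    exact ((contDiff_const.mul (h5.mul (h1.mul (h4.sub (contDiff_const.mul ((h3 0).pow 2)))))).sub
      (contDiff_const.mul (h5.mul ((h1.pow 3).mul (hu.pow 2))))).sub ((h3 i.succ).mul (h1.mul h2))

/-- Because `∂ᵢh = -xᵢ h³`, the term `-½ xᵢ h³ u²` of the current cancels the cross term `u ∇h·∇u`.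
What it leaves is `-½ u² div(x h³)`, which equals `-(3/2) R² h⁵ u²` and has a good sign. -/
lemma sum_pderiv_morawetzCurrent (hR : 0 < R) {u : SpaceTime → ℝ} (hu : ContDiff ℝ ∞ u)
    (z : SpaceTime) :
    ∑ k, pderiv k (morawetzCurrent R u k) z =
      box u z * (pot R z * dil u z)
        - (1 / 2 * R ^ 2 * pot R z ^ 3 *
            (pderiv 0 u z ^ 2 - ∑ i : Fin 3, pderiv i.succ u z ^ 2)
          + pot R z * ∑ i : Fin 3, pderiv i.succ u z ^ 2
          - pot R z ^ 3 * (∑ i : Fin 3, z.2 i * pderiv i.succ u z) ^ 2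
          + 3 / 2 * R ^ 2 * pot R z ^ 5 * u z ^ 2) := by
  have d0 := smooth_differentiable hu
  have d1 : ∀ k, Differentiable ℝ (pderiv k u) := fun k =>
    smooth_differentiable (contDiff_pderiv hu k)
  have dh := smooth_differentiable (contDiff_pot hR)
  have dD := smooth_differentiable (contDiff_dil hu)
  have dg := smooth_differentiable (contDiff_gradSq hu)
  have dx := differentiable_coord
  have dt : Differentiable ℝ fun y => 2 * pderiv 0 u y ^ 2 := ((d1 0).fun_pow 2).const_mul 2
  have dL : Differentiable ℝ fun y => gradSq u y - 2 * pderiv 0 u y ^ 2 := dg.fun_sub dt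
  have dhD : Differentiable ℝ fun y => pot R y * dil u y := dh.fun_mul dD
  have dhL := dh.fun_mul dL
  have dh3 : Differentiable ℝ fun y => pot R y ^ 3 := dh.fun_pow 3
  have du2 : Differentiable ℝ fun y => u y ^ 2 := d0.fun_pow 2
  have dhu := dh3.fun_mul du2
  have e3 : ∀ k, pderiv k (fun y => pot R y ^ 3) z = 3 * pot R z ^ 2 * pderiv k (pot R) z := by
    intro k
    have := pderiv_comp (k := k) (hasDerivAt_pow 3 (pot R z)) dh
    simpa using this
  have ehD : ∀ k, pderiv k (fun y => pot R y * dil u y) z =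
      pderiv k (pot R) z * dil u z + pot R z * pderiv k (dil u) z := fun k => pderiv_mul dh dD
  have ei : ∀ i : Fin 3, pderiv i.succ (morawetzCurrent R u i.succ) z =
      (1 / 2) * ((pot R z * (gradSq u z - 2 * pderiv 0 u z ^ 2)) + z.2 i *
        (pderiv i.succ (pot R) z * (gradSq u z - 2 * pderiv 0 u z ^ 2) +
          pot R z * (pderiv i.succ (gradSq u) z
            - 2 * (2 * pderiv 0 u z * pderiv i.succ (pderiv 0 u) z))))
      - (1 / 2) * (pot R z ^ 3 * u z ^ 2 + z.2 i *
        (3 * pot R z ^ 2 * pderiv i.succ (pot R) z * u z ^ 2 +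
          pot R z ^ 3 * (2 * u z * pderiv i.succ u z)))
      - (pderiv i.succ (pderiv i.succ u) z * (pot R z * dil u z) + pderiv i.succ u z *
        (pderiv i.succ (pot R) z * dil u z + pot R z * pderiv i.succ (dil u) z)) := by
    intro i
    simp only [morawetzCurrent, Fin.cons_succ]
    rw [pderiv_sub ((((dx i).fun_mul dhL).const_mul _).fun_sub (((dx i).fun_mul dhu).const_mul _))
      ((d1 _).fun_mul dhD), pderiv_sub (((dx i).fun_mul dhL).const_mul _)
        (((dx i).fun_mul dhu).const_mul _),
      pderiv_const_mul ((dx i).fun_mul dhL), pderiv_const_mul ((dx i).fun_mul dhu),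
      pderiv_mul (dx i) dhL, pderiv_mul (dx i) dhu, pderiv_mul (d1 _) dhD, ehD, pderiv_coord,
      pderiv_mul dh dL, pderiv_mul dh3 du2, pderiv_sub dg dt, pderiv_const_mul ((d1 0).fun_pow 2),
      pderiv_sq (d1 0), pderiv_sq d0, e3]
    simp
  have e0 : pderiv 0 (morawetzCurrent R u 0) z =
      pderiv 0 (pderiv 0 u) z * (pot R z * dil u z) +
        pderiv 0 u z * (pderiv 0 (pot R) z * dil u z + pot R z * pderiv 0 (dil u) z) := by
    simp only [morawetzCurrent, Fin.cons_zero]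
    rw [pderiv_mul (d1 0) dhD, ehD]
  rw [Fin.sum_univ_succ, e0]
  simp only [ei, pderiv_pot hR, pderiv_dil hu, pderiv_gradSq hu, Fin.cons_zero, Fin.cons_succ]
  have hrel := pot_sq_mul hR z
  rw [box, gradSq, dil]
  have c1 : ∀ i : Fin 3, pderiv 0 (pderiv i.succ u) z = pderiv i.succ (pderiv 0 u) z :=
    fun i => pderiv_comm hu
  have c2 : pderiv (Fin.succ 1) (pderiv (Fin.succ 0) u) z =
    pderiv (Fin.succ 0) (pderiv (Fin.succ (1 : Fin 3)) u) z := pderiv_comm hu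
  have c3 : pderiv (Fin.succ 2) (pderiv (Fin.succ 0) u) z =
    pderiv (Fin.succ 0) (pderiv (Fin.succ (2 : Fin 3)) u) z := pderiv_comm hu
  have c4 : pderiv (Fin.succ 2) (pderiv (Fin.succ 1) u) z =
    pderiv (Fin.succ 1) (pderiv (Fin.succ (2 : Fin 3)) u) z := pderiv_comm hu
  have i0 : ∀ i : Fin 3, (0 : Fin 4) ≠ i.succ := fun i => (Fin.succ_ne_zero i).symm
  simp only [Fin.sum_univ_succ (n := 3), Fin.sum_univ_three, c1, c2, c3, c4, i0, Fin.succ_inj,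
    if_false, if_true] at hrel ⊢
  simp only [show ((0 : Fin 3) = 1) = False by decide, show ((0 : Fin 3) = 2) = False by decide,
    show ((1 : Fin 3) = 0) = False by decide, show ((1 : Fin 3) = 2) = False by decide,
    show ((2 : Fin 3) = 0) = False by decide, show ((2 : Fin 3) = 1) = False by decide, if_false]
  -- With the derivatives and `h` as free variables, the claim is a polynomial identity modulo `h²
  -- (R² + |x|²) = 1`.
  generalize pderiv (Fin.succ (0 : Fin 3)) u z = u1 at *
  generalize pderiv (Fin.succ (1 : Fin 3)) u z = u2 at *
  generalize pderiv (Fin.succ (2 : Fin 3)) u z = u3 at *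
  generalize pderiv 0 u z = u0 at *
  generalize pot R z = h at *
  linear_combination (-(1 / 2) * h * (u1 ^ 2 + u2 ^ 2 + u3 ^ 2 - u0 ^ 2) + 3 / 2 * h ^ 3 * u z ^ 2)
    * hrel

lemma sq_sum_mul_coord_le (u : SpaceTime → ℝ) (z : SpaceTime) :
    (∑ i : Fin 3, z.2 i * pderiv i.succ u z) ^ 2 ≤
      (∑ i : Fin 3, z.2 i ^ 2) * ∑ i : Fin 3, pderiv i.succ u z ^ 2 :=
  Finset.sum_mul_sq_le_sq_mul_sq _ _ _

/-- Cauchy–Schwarz and `1 - h²|x|² = R² h²` give `h|∇u|² - h³ (x·∇u)² ≥ R² h³ |∇u|²`. This outweighs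
`-½ R² h³ |∇u|²`, leaving half of `R² h³ |u'|²`. -/
lemma sum_pderiv_morawetzCurrent_le (hR : 0 < R) {u : SpaceTime → ℝ} (hu : ContDiff ℝ ∞ u)
    (z : SpaceTime) :
    ∑ k, pderiv k (morawetzCurrent R u k) z ≤
      |box u z| * |pot R z * dil u z| - 1 / 2 * (R ^ 2 * pot R z ^ 3 * gradSq u z) := by
  rw [sum_pderiv_morawetzCurrent hR hu, gradSq_eq, ← abs_mul]
  have h1 := sq_sum_mul_coord_le u z
  have h2 := pot_sq_mul hR z
  have h3 := le_abs_self (box u z * (pot R z * dil u z))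
  have hp := pot_pos hR z
  set S := ∑ i : Fin 3, pderiv i.succ u z ^ 2
  set w := ∑ i : Fin 3, z.2 i * pderiv i.succ u z
  set X := ∑ i : Fin 3, z.2 i ^ 2
  set h := pot R z
  have h4 : h ^ 3 * w ^ 2 ≤ h * S - R ^ 2 * h ^ 3 * S := by
    have : h * S - R ^ 2 * h ^ 3 * S = h ^ 3 * (X * S) := by linear_combination (-h * S) * h2
    rw [this]; gcongr
  have h5 : 0 ≤ 3 / 2 * R ^ 2 * h ^ 5 * u z ^ 2 := by positivity
  linarith

/-- Hardy's inequality with a regularised weight. -/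
lemma hardy (hR : 0 < R) {u : SpaceTime → ℝ} (hu : ContDiff ℝ ∞ u) {ρ : ℝ}
    (h0 : ∀ z : SpaceTime, ρ < ‖z.2‖ → u z = 0) (s : ℝ) :
    ∫ x in Metric.closedBall (0 : Space) ρ, (pot R (s, x) * u (s, x)) ^ 2 ≤
      4 * ∫ x in Metric.closedBall (0 : Space) ρ, ∑ i : Fin 3, pderiv i.succ u (s, x) ^ 2 := by
  have d0 := smooth_differentiable hu
  have hh := contDiff_pot hR
  have dh := smooth_differentiable hh
  have hQ : ∀ i : Fin 3, ContDiff ℝ ∞ fun z : SpaceTime => z.2 i * (pot R z * u z) ^ 2 :=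
    fun i => (contDiff_coord i).mul ((hh.mul hu).pow 2)
  have dq : Differentiable ℝ fun z : SpaceTime => pot R z * u z := dh.fun_mul d0
  have key : ∀ i : Fin 3, ∫ x in Metric.closedBall (0 : Space) ρ,
      pderiv i.succ (fun z : SpaceTime => z.2 i * (pot R z * u z) ^ 2) (s, x) = 0 := fun i =>
    integral_space_pderiv (hQ i) (fun x hx => by simp [h0 (s, x) hx]) i
  have hsum : ∫ x in Metric.closedBall (0 : Space) ρ, ∑ i : Fin 3,
      pderiv i.succ (fun z : SpaceTime => z.2 i * (pot R z * u z) ^ 2) (s, x) = 0 := by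
    rw [integral_finsetSum _ fun i _ =>
      integrableOn_slice (contDiff_pderiv (hQ i) i.succ).continuous s ρ]
    simp [key]
  -- The divergence of `x (hu)²` is at least `(hu)² + 2 (hu)(h x·∇u)`, since `h²|x|² ≤ 1`.
  -- Completing the square in `hu + 2 h x·∇u` gives the bound, and its integral vanishes.
  have hpt : ∀ z : SpaceTime, 1 / 2 * (pot R z * u z) ^ 2 -
      2 * ∑ i : Fin 3, pderiv i.succ u z ^ 2 ≤
        ∑ i : Fin 3, pderiv i.succ (fun z : SpaceTime => z.2 i * (pot R z * u z) ^ 2) z := by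
    intro z
    have e : ∀ i : Fin 3, pderiv i.succ (fun z : SpaceTime => z.2 i * (pot R z * u z) ^ 2) z =
        (pot R z * u z) ^ 2 + z.2 i * (2 * (pot R z * u z) *
          (-z.2 i * pot R z ^ 3 * u z + pot R z * pderiv i.succ u z)) := by
      intro i
      rw [pderiv_mul (differentiable_coord i) (dq.fun_pow 2), pderiv_sq dq, pderiv_mul dh d0,
        pderiv_coord, pderiv_pot hR]
      simp
    simp only [e]
    have h1 := sq_sum_mul_coord_le u z
    have h2 := pot_sq_mul hR z
    have hp := pot_pos hR z
    have e2 : ∑ i : Fin 3, ((pot R z * u z) ^ 2 + z.2 i * (2 * (pot R z * u z) *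
          (-z.2 i * pot R z ^ 3 * u z + pot R z * pderiv i.succ u z))) =
        3 * (pot R z * u z) ^ 2 - 2 * (pot R z * u z) ^ 2 * (pot R z ^ 2 * ∑ i : Fin 3, z.2 i ^ 2)
          + 2 * (pot R z * u z) * (pot R z * ∑ i : Fin 3, z.2 i * pderiv i.succ u z) := by
      simp only [Fin.sum_univ_three]; ring
    rw [e2]
    set S := ∑ i : Fin 3, pderiv i.succ u z ^ 2
    set w := ∑ i : Fin 3, z.2 i * pderiv i.succ u z
    set X := ∑ i : Fin 3, z.2 i ^ 2 with hX
    set h := pot R z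
    have hX1 : h ^ 2 * X ≤ 1 := by nlinarith [mul_nonneg (sq_nonneg h) (sq_nonneg R)]
    have hS : 0 ≤ S := Finset.sum_nonneg fun _ _ => sq_nonneg _
    have hw : (h * w) ^ 2 ≤ S := by
      calc (h * w) ^ 2 = h ^ 2 * w ^ 2 := by ring
        _ ≤ h ^ 2 * (X * S) := by gcongr
        _ = (h ^ 2 * X) * S := by ring
        _ ≤ S := mul_le_of_le_one_left hS hX1
    nlinarith [sq_nonneg (h * u z + 2 * (h * w)), mul_nonneg (sq_nonneg (h * u z)) (sub_nonneg.2 hX1)]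
  have cu := hu.continuous
  have ch := hh.continuous
  have cv : ∀ k, Continuous (pderiv k u) := fun k => (contDiff_pderiv hu k).continuous
  have cQ : ∀ i : Fin 3, Continuous
      (pderiv i.succ (fun z : SpaceTime => z.2 i * (pot R z * u z) ^ 2)) := fun i =>
    (contDiff_pderiv (hQ i) i.succ).continuous
  have := setIntegral_ball_mono (ρ := ρ)
    (f := fun x => 1 / 2 * (pot R (s, x) * u (s, x)) ^ 2 -
      2 * ∑ i : Fin 3, pderiv i.succ u (s, x) ^ 2)
    (g := fun x => ∑ i : Fin 3,
      pderiv i.succ (fun z : SpaceTime => z.2 i * (pot R z * u z) ^ 2) (s, x))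
    (by fun_prop) (by fun_prop) fun x _ => hpt (s, x)
  rw [hsum, integral_sub, integral_const_mul, integral_const_mul] at this
  · linarith
  · exact (integrableOn_slice (f := fun z => (pot R z * u z) ^ 2) (by fun_prop) s ρ).const_mul _
  · exact (integrableOn_slice (f := fun z => ∑ i : Fin 3, pderiv i.succ u z ^ 2)
      (by fun_prop) s ρ).const_mul _

/-- The square of the sum costs `2|∇u|² + 2(hu)²`, and Hardy bounds the second part by `8|∇u|²`,
hence `10` for every `R`. -/
lemma integral_multiplier_sq_le (hR : 0 < R) {u : SpaceTime → ℝ} (hu : ContDiff ℝ ∞ u) {ρ : ℝ}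
    (h0 : ∀ z : SpaceTime, ρ < ‖z.2‖ → u z = 0) (s : ℝ) :
    ∫ x in Metric.closedBall (0 : Space) ρ, (pot R (s, x) * dil u (s, x)) ^ 2 ≤
      10 * ∫ x in Metric.closedBall (0 : Space) ρ, gradSq u (s, x) := by
  have hh := contDiff_pot hR
  have cu := hu.continuous
  have ch := hh.continuous
  have cv : ∀ k, Continuous (pderiv k u) := fun k => (contDiff_pderiv hu k).continuous
  have cd := (contDiff_dil hu).continuous
  have cg := (contDiff_gradSq hu).continuous
  have hS : ∫ x in Metric.closedBall (0 : Space) ρ, ∑ i : Fin 3, pderiv i.succ u (s, x) ^ 2 ≤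
      ∫ x in Metric.closedBall (0 : Space) ρ, gradSq u (s, x) := by
    refine setIntegral_ball_mono (by fun_prop) (by fun_prop) fun x _ => ?_
    rw [gradSq_eq]; linarith [sq_nonneg (pderiv 0 u (s, x))]
  calc _ ≤ ∫ x in Metric.closedBall (0 : Space) ρ,
        (2 * (∑ i : Fin 3, pderiv i.succ u (s, x) ^ 2) + 2 * (pot R (s, x) * u (s, x)) ^ 2) := by
        refine setIntegral_ball_mono (by fun_prop) (by fun_prop) fun x _ => ?_
        have h1 := sq_sum_mul_coord_le u (s, x)
        have h2 := pot_sq_mul hR (s, x)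
        rw [dil]
        set S := ∑ i : Fin 3, pderiv i.succ u (s, x) ^ 2
        set w := ∑ i : Fin 3, (s, x).2 i * pderiv i.succ u (s, x)
        set X := ∑ i : Fin 3, (s, x).2 i ^ 2 with hX
        set h := pot R (s, x)
        have hX1 : h ^ 2 * X ≤ 1 := by nlinarith [mul_nonneg (sq_nonneg h) (sq_nonneg R)]
        have hS : 0 ≤ S := Finset.sum_nonneg fun _ _ => sq_nonneg _
        have hw : (h * w) ^ 2 ≤ S := by
          calc (h * w) ^ 2 = h ^ 2 * w ^ 2 := by ring
            _ ≤ h ^ 2 * (X * S) := by gcongr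
            _ = (h ^ 2 * X) * S := by ring
            _ ≤ S := mul_le_of_le_one_left hS hX1
        nlinarith [sq_nonneg (h * w - h * u (s, x))]
    _ = 2 * (∫ x in Metric.closedBall (0 : Space) ρ, ∑ i : Fin 3, pderiv i.succ u (s, x) ^ 2) +
        2 * ∫ x in Metric.closedBall (0 : Space) ρ, (pot R (s, x) * u (s, x)) ^ 2 := by
        rw [integral_add, integral_const_mul, integral_const_mul]
        · exact (integrableOn_slice (f := fun z => ∑ i : Fin 3, pderiv i.succ u z ^ 2)
            (by fun_prop) s ρ).const_mul _
        · exact (integrableOn_slice (f := fun z => (pot R z * u z) ^ 2)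
            (by fun_prop) s ρ).const_mul _
    _ ≤ _ := by linarith [hardy hR hu h0 s]

/-- The Morawetz estimate at scale `R` for waves supported in a fixed ball. -/
theorem morawetz_estimate (hR : 0 < R) {u : SpaceTime → ℝ} (hu : ContDiff ℝ ∞ u) {ρ a b Q : ℝ}
    (hab : a ≤ b) (h0 : ∀ z : SpaceTime, ρ < ‖z.2‖ → u z = 0)
    (hQ : ∀ s ∈ Icc a b, ∫ x in Metric.closedBall (0 : Space) ρ, gradSq u (s, x) ≤ Q) :
    ∫ s in a..b, ∫ x in Metric.closedBall (0 : Space) ρ,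
        R ^ 2 * pot R (s, x) ^ 3 * gradSq u (s, x) ≤
      22 * Q + 2 * ∫ s in a..b, ∫ x in Metric.closedBall (0 : Space) ρ,
        |box u (s, x)| * |pot R (s, x) * dil u (s, x)| := by
  have hh := contDiff_pot hR
  have cu := hu.continuous
  have ch := hh.continuous
  have cv : ∀ k, Continuous (pderiv k u) := fun k => (contDiff_pderiv hu k).continuous
  have cd := (contDiff_dil hu).continuous
  have cg := (contDiff_gradSq hu).continuous
  have cb := (contDiff_box hu).continuous
  have hP := contDiff_morawetzCurrent hR hu
  have cP : ∀ k, Continuous (pderiv k (morawetzCurrent R u k)) := fun k =>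
    (contDiff_pderiv (hP k) k).continuous
  have key := integral_divergence hP hab (ρ := ρ) (by
    intro i s hs x hx
    have hu0 : u (s, x) = 0 := h0 _ hx
    have hev : u =ᶠ[𝓝 (s, x)] fun _ => 0 := by
      have : IsOpen {z : SpaceTime | ρ < ‖z.2‖} := isOpen_lt continuous_const (by fun_prop)
      filter_upwards [this.mem_nhds hx] with y hy using h0 y hy
    have hd : ∀ k, pderiv k u (s, x) = 0 := fun k => pderiv_eq_zero_of_eventually hev
    simp [morawetzCurrent, gradSq, hd, hu0])
  -- Each boundary term costs `½ Q + ½ · 10 Q`. There are two of them, and dividing by the factor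
  -- `½` of the bulk term gives `22 Q`.
  have hbd : ∀ s ∈ Icc a b,
      |∫ x in Metric.closedBall (0 : Space) ρ, morawetzCurrent R u 0 (s, x)| ≤ 11 / 2 * Q := by
    intro s hs
    have cm : Continuous (morawetzCurrent R u 0) := (hP 0).continuous
    calc _ ≤ ∫ x in Metric.closedBall (0 : Space) ρ, |morawetzCurrent R u 0 (s, x)| :=
          abs_integral_le_integral_abs
      _ ≤ ∫ x in Metric.closedBall (0 : Space) ρ,
          (1 / 2 * gradSq u (s, x) + 1 / 2 * (pot R (s, x) * dil u (s, x)) ^ 2) := by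
          refine setIntegral_ball_mono (by fun_prop) (by fun_prop) fun x _ => ?_
          simp only [morawetzCurrent, Fin.cons_zero]
          rw [gradSq_eq]
          have : 0 ≤ ∑ i : Fin 3, pderiv i.succ u (s, x) ^ 2 :=
            Finset.sum_nonneg fun _ _ => sq_nonneg _
          rw [abs_le]
          constructor <;> nlinarith [sq_nonneg (pderiv 0 u (s, x) - pot R (s, x) * dil u (s, x)),
            sq_nonneg (pderiv 0 u (s, x) + pot R (s, x) * dil u (s, x))]
      _ = 1 / 2 * (∫ x in Metric.closedBall (0 : Space) ρ, gradSq u (s, x)) +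
          1 / 2 * ∫ x in Metric.closedBall (0 : Space) ρ, (pot R (s, x) * dil u (s, x)) ^ 2 := by
          rw [integral_add, integral_const_mul, integral_const_mul]
          · exact (integrableOn_slice cg s ρ).const_mul _
          · exact (integrableOn_slice (f := fun z => (pot R z * dil u z) ^ 2)
              (by fun_prop) s ρ).const_mul _
      _ ≤ _ := by linarith [integral_multiplier_sq_le hR hu h0 s, hQ s hs]
  have hle : ∫ s in a..b, ∫ x in Metric.closedBall (0 : Space) ρ,
      ∑ k, pderiv k (morawetzCurrent R u k) (s, x) ≤
      ∫ s in a..b, ((∫ x in Metric.closedBall (0 : Space) ρ,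
        |box u (s, x)| * |pot R (s, x) * dil u (s, x)|) - 1 / 2 *
        ∫ x in Metric.closedBall (0 : Space) ρ, R ^ 2 * pot R (s, x) ^ 3 * gradSq u (s, x)) := by
    have i1 : Continuous fun s => ∫ x in Metric.closedBall (0 : Space) ρ,
        ∑ k, pderiv k (morawetzCurrent R u k) (s, x) :=
      continuous_ball_integral (f := fun z => ∑ k, pderiv k (morawetzCurrent R u k) z)
        (by fun_prop) ρ
    have i2 : Continuous fun s => ∫ x in Metric.closedBall (0 : Space) ρ,
        |box u (s, x)| * |pot R (s, x) * dil u (s, x)| :=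
      continuous_ball_integral (f := fun z => |box u z| * |pot R z * dil u z|) (by fun_prop) ρ
    have i3 : Continuous fun s => ∫ x in Metric.closedBall (0 : Space) ρ,
        R ^ 2 * pot R (s, x) ^ 3 * gradSq u (s, x) :=
      continuous_ball_integral (f := fun z => R ^ 2 * pot R z ^ 3 * gradSq u z) (by fun_prop) ρ
    refine intervalIntegral.integral_mono_on hab (i1.intervalIntegrable _ _)
      ((i2.sub (i3.const_mul _)).intervalIntegrable _ _) fun s _ => ?_
    rw [← integral_const_mul, ← integral_sub]
    · exact setIntegral_ball_mono (by fun_prop) (by fun_prop) fun x _ =>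
        sum_pderiv_morawetzCurrent_le hR hu (s, x)
    · exact integrableOn_slice (f := fun z => |box u z| * |pot R z * dil u z|) (by fun_prop) s ρ
    · exact (integrableOn_slice (f := fun z => R ^ 2 * pot R z ^ 3 * gradSq u z)
        (by fun_prop) s ρ).const_mul _
  have hsplit : ∫ s in a..b, ((∫ x in Metric.closedBall (0 : Space) ρ,
        |box u (s, x)| * |pot R (s, x) * dil u (s, x)|) - 1 / 2 *
        ∫ x in Metric.closedBall (0 : Space) ρ, R ^ 2 * pot R (s, x) ^ 3 * gradSq u (s, x)) =
      (∫ s in a..b, ∫ x in Metric.closedBall (0 : Space) ρ,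
        |box u (s, x)| * |pot R (s, x) * dil u (s, x)|) - 1 / 2 *
        ∫ s in a..b, ∫ x in Metric.closedBall (0 : Space) ρ,
          R ^ 2 * pot R (s, x) ^ 3 * gradSq u (s, x) := by
    rw [intervalIntegral.integral_sub, intervalIntegral.integral_const_mul]
    · exact (continuous_ball_integral (f := fun z => |box u z| * |pot R z * dil u z|)
        (by fun_prop) ρ).intervalIntegrable _ _
    · exact ((continuous_ball_integral (f := fun z => R ^ 2 * pot R z ^ 3 * gradSq u z)
        (by fun_prop) ρ).const_mul _).intervalIntegrable _ _
  rw [key, hsplit] at hle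
  have h1 := (abs_le.1 (hbd a (left_mem_Icc.2 hab))).2
  have h2 := (abs_le.1 (hbd b (right_mem_Icc.2 hab))).1
  linarith

end Morawetz

/-! ### Poincaré inequality on balls. -/

section Poincare

/-- Cauchy–Schwarz, obtained by expanding `∫ ((b - a) φ - I)² ≥ 0`. -/
lemma sq_intervalIntegral_le {φ : ℝ → ℝ} (hφ : Continuous φ) {a b : ℝ} (hab : a ≤ b) :
    (∫ s in a..b, φ s) ^ 2 ≤ (b - a) * ∫ s in a..b, φ s ^ 2 := by
  rcases hab.eq_or_lt with rfl | hlt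
  · simp
  set I := ∫ s in a..b, φ s with hI
  have h0 : 0 ≤ ∫ s in a..b, ((b - a) * φ s - I) ^ 2 :=
    intervalIntegral.integral_nonneg hab fun _ _ => sq_nonneg _
  have h1 : ∫ s in a..b, ((b - a) * φ s - I) ^ 2 =
      (b - a) ^ 2 * (∫ s in a..b, φ s ^ 2) - 2 * (b - a) * I * I + (b - a) * I ^ 2 := by
    have e : ∀ s, ((b - a) * φ s - I) ^ 2 =
        (b - a) ^ 2 * φ s ^ 2 - 2 * (b - a) * I * φ s + I ^ 2 := fun s => by ring
    simp only [e]
    rw [intervalIntegral.integral_add, intervalIntegral.integral_sub,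
      intervalIntegral.integral_const_mul, intervalIntegral.integral_const_mul, ← hI]
    · simp
    all_goals exact Continuous.intervalIntegrable (by fun_prop) _ _
  rw [h1] at h0
  have h2 : 0 < b - a := sub_pos.2 hlt
  have h3 : 0 ≤ (b - a) * ((b - a) * (∫ s in a..b, φ s ^ 2) - I ^ 2) := by nlinarith
  have := nonneg_of_mul_nonneg_right h3 h2
  linarith

lemma sq_sub_le_segment {v : SpaceTime → ℝ} (hv : ContDiff ℝ ∞ v) (a : ℝ) (x z : Space) :
    (v (a, x + z) - v (a, x)) ^ 2 ≤ ‖z‖ ^ 2 * ∫ τ in (0 : ℝ)..1, gradSq v (a, x + τ • z) := by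
  have hd := smooth_differentiable hv
  set φ : ℝ → ℝ := fun τ => ∑ i : Fin 3, z i * pderiv i.succ v (a, x + τ • z)
  have cv : ∀ k, Continuous (pderiv k v) := fun k => (contDiff_pderiv hv k).continuous
  have cg := (contDiff_gradSq hv).continuous
  have hφ : Continuous φ := by fun_prop
  have hder : ∀ τ : ℝ, HasDerivAt (fun τ : ℝ => v (a, x + τ • z)) (φ τ) τ := by
    intro τ
    have h1 : HasDerivAt (fun τ : ℝ => x + τ • z) z τ := by
      simpa using ((hasDerivAt_id τ).smul_const z).const_add x
    have h2 := (hasFDerivAt_space hd a (x + τ • z)).comp_hasDerivAt τ h1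
    have hz : z = ∑ i : Fin 3, z i • EuclideanSpace.single i (1 : ℝ) := by
      simpa using ((EuclideanSpace.basisFun (Fin 3) ℝ).sum_repr z).symm
    have hL : ∀ A : Space →L[ℝ] ℝ, A z = ∑ i : Fin 3, z i * A (EuclideanSpace.single i 1) := by
      intro A
      conv_lhs => rw [hz]
      simp
    have heq : φ τ = (fderiv ℝ v (a, x + τ • z)).comp (ContinuousLinearMap.inr ℝ ℝ Space) z := by
      rw [hL]
      refine Finset.sum_congr rfl fun i _ => ?_
      rw [← (hasFDerivAt_space hd a (x + τ • z)).fderiv, fderiv_space_single hd]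
    rw [heq]
    exact h2
  have hftc : v (a, x + z) - v (a, x) = ∫ τ in (0 : ℝ)..1, φ τ := by
    rw [intervalIntegral.integral_eq_sub_of_hasDerivAt (fun τ _ => hder τ)
      (hφ.intervalIntegrable _ _)]
    simp
  rw [hftc]
  refine (sq_intervalIntegral_le hφ zero_le_one).trans ?_
  rw [sub_zero, one_mul, ← intervalIntegral.integral_const_mul]
  refine intervalIntegral.integral_mono_on zero_le_one ((hφ.pow 2).intervalIntegrable _ _)
    (Continuous.intervalIntegrable (by fun_prop) _ _) fun τ _ => ?_
  rw [norm_sq_space, gradSq_eq]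
  refine (Finset.sum_mul_sq_le_sq_mul_sq _ _ _).trans ?_
  gcongr
  linarith [sq_nonneg (pderiv 0 v (a, x + τ • z))]

lemma lintegral_ofReal_ball {f : Space → ℝ} (hf : Continuous f) (h0 : ∀ x, 0 ≤ f x) (ρ : ℝ) :
    ∫⁻ x in Metric.closedBall (0 : Space) ρ, ENNReal.ofReal (f x) =
      ENNReal.ofReal (∫ x in Metric.closedBall (0 : Space) ρ, f x) :=
  (ofReal_integral_eq_lintegral_ofReal
    (hf.continuousOn.integrableOn_compact (isCompact_closedBall 0 ρ))
    (Eventually.of_forall h0)).symm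

/-- Put `x = y + z` with `|z| ≤ 2ρ` and integrate along the segment, which stays in the ball by
convexity. With the gradient extended by zero to `γ`, the `y`-integral may run over all of space,
where translation invariance removes the shift `τ z`. -/
lemma lintegral_lintegral_sq_sub_le {v : SpaceTime → ℝ} (hv : ContDiff ℝ ∞ v) (a : ℝ) {ρ : ℝ}
    (hρ : 0 < ρ) :
    ∫⁻ y in Metric.closedBall (0 : Space) ρ, ∫⁻ x in Metric.closedBall (0 : Space) ρ,
        ENNReal.ofReal ((v (a, x) - v (a, y)) ^ 2) ≤
      volume (Metric.closedBall (0 : Space) (2 * ρ)) * (ENNReal.ofReal (4 * ρ ^ 2) *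
        ∫⁻ x in Metric.closedBall (0 : Space) ρ, ENNReal.ofReal (gradSq v (a, x))) := by
  have cg := (contDiff_gradSq hv).continuous
  have cv := hv.continuous
  set B := Metric.closedBall (0 : Space) ρ with hB
  have mB : MeasurableSet B := Metric.isClosed_closedBall.measurableSet
  set γ : Space → ℝ≥0∞ := B.indicator fun x => ENNReal.ofReal (gradSq v (a, x)) with hγ
  have mγ : Measurable γ := (ENNReal.continuous_ofReal.comp (by fun_prop)).measurable.indicator mB
  have hpt : ∀ y ∈ B, ∀ z : Space, B.indicator
      (fun x => ENNReal.ofReal ((v (a, x) - v (a, y)) ^ 2)) (y + z) ≤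
      (Metric.closedBall (0 : Space) (2 * ρ)).indicator (fun z =>
        ENNReal.ofReal (4 * ρ ^ 2) * ∫⁻ τ in Icc (0 : ℝ) 1, γ (y + τ • z)) z := by
    intro y hy z
    by_cases hyz : y + z ∈ B
    swap
    · simp [hyz]
    have hz : z ∈ Metric.closedBall (0 : Space) (2 * ρ) := by
      rw [mem_closedBall_zero_iff]
      calc ‖z‖ = ‖(y + z) - y‖ := by simp
        _ ≤ ‖y + z‖ + ‖y‖ := norm_sub_le _ _
        _ ≤ _ := by
          have h1 := mem_closedBall_zero_iff.1 hyz
          have h2 := mem_closedBall_zero_iff.1 hy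
          linarith
    rw [indicator_of_mem hyz, indicator_of_mem hz]
    have hseg : ∀ τ ∈ Icc (0 : ℝ) 1, y + τ • z ∈ B := by
      intro τ hτ
      exact (convex_closedBall (0 : Space) ρ).add_smul_mem hy hyz hτ
    have e1 : ∫⁻ τ in Icc (0 : ℝ) 1, γ (y + τ • z) =
        ENNReal.ofReal (∫ τ in (0 : ℝ)..1, gradSq v (a, y + τ • z)) := by
      rw [intervalIntegral.integral_of_le zero_le_one, ← integral_Icc_eq_integral_Ioc,
        ofReal_integral_eq_lintegral_ofReal]
      · refine setLIntegral_congr_fun measurableSet_Icc fun τ hτ => ?_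
        simp only [hγ]
        rw [indicator_of_mem (hseg τ hτ)]
      · exact (Continuous.continuousOn (by fun_prop)).integrableOn_compact isCompact_Icc
      · exact Eventually.of_forall fun τ => gradSq_nonneg _ _
    rw [e1, ← ENNReal.ofReal_mul (by positivity)]
    refine ENNReal.ofReal_le_ofReal ((sq_sub_le_segment hv a y z).trans ?_)
    refine mul_le_mul_of_nonneg_right ?_
      (intervalIntegral.integral_nonneg zero_le_one fun τ _ => gradSq_nonneg _ _)
    have := mem_closedBall_zero_iff.1 hz
    nlinarith [norm_nonneg z]
  have mγ3 : Measurable fun p : (Space × Space) × ℝ => γ (p.1.1 + p.2 • p.1.2) :=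
    mγ.comp (Continuous.measurable (by fun_prop))
  have mγ2 : Measurable fun p : Space × Space => ∫⁻ τ in Icc (0 : ℝ) 1, γ (p.1 + τ • p.2) :=
    mγ3.lintegral_prod_right'
  calc _ ≤ ∫⁻ y in B, ∫⁻ z in Metric.closedBall (0 : Space) (2 * ρ),
        ENNReal.ofReal (4 * ρ ^ 2) * ∫⁻ τ in Icc (0 : ℝ) 1, γ (y + τ • z) := by
        refine setLIntegral_mono' mB fun y hy => ?_
        rw [← lintegral_indicator mB, ← lintegral_indicator measurableSet_closedBall,
          ← lintegral_add_left_eq_self _ y]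
        exact lintegral_mono fun z => hpt y hy z
    _ ≤ ∫⁻ y, ∫⁻ z in Metric.closedBall (0 : Space) (2 * ρ),
        ENNReal.ofReal (4 * ρ ^ 2) * ∫⁻ τ in Icc (0 : ℝ) 1, γ (y + τ • z) :=
        setLIntegral_le_lintegral _ _
    _ = ∫⁻ z in Metric.closedBall (0 : Space) (2 * ρ), ∫⁻ y,
        ENNReal.ofReal (4 * ρ ^ 2) * ∫⁻ τ in Icc (0 : ℝ) 1, γ (y + τ • z) :=
        lintegral_lintegral_swap (mγ2.const_mul _).aemeasurable
    _ = ∫⁻ z in Metric.closedBall (0 : Space) (2 * ρ),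
        ENNReal.ofReal (4 * ρ ^ 2) * ∫⁻ x, γ x := by
        refine lintegral_congr fun z => ?_
        have mz : Measurable fun p : Space × ℝ => γ (p.1 + p.2 • z) :=
          mγ.comp (Continuous.measurable (by fun_prop))
        rw [lintegral_const_mul _ mz.lintegral_prod_right', lintegral_lintegral_swap mz.aemeasurable]
        simp [lintegral_add_right_eq_self]
    _ = _ := by
        rw [setLIntegral_const, hγ, lintegral_indicator mB, mul_comm]

/-- The Poincaré inequality on balls. -/
theorem poincare_ball {v : SpaceTime → ℝ} (hv : ContDiff ℝ ∞ v) (a : ℝ) {ρ : ℝ} (hρ : 0 < ρ) :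
    ∃ c : ℝ, ∫ x in Metric.closedBall (0 : Space) ρ, (v (a, x) - c) ^ 2 ≤
      32 * ρ ^ 2 * ∫ x in Metric.closedBall (0 : Space) ρ, gradSq v (a, x) := by
  have cg := (contDiff_gradSq hv).continuous
  have cv := hv.continuous
  have hpos : volume (Metric.closedBall (0 : Space) ρ) ≠ 0 :=
    (Metric.measure_closedBall_pos volume 0 hρ).ne'
  have hfin : volume (Metric.closedBall (0 : Space) ρ) ≠ ⊤ :=
    (isCompact_closedBall (0 : Space) ρ).measure_lt_top.ne
  have hm : Measurable fun y => ∫⁻ x in Metric.closedBall (0 : Space) ρ,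
      ENNReal.ofReal ((v (a, x) - v (a, y)) ^ 2) :=
    Measurable.lintegral_prod_right' (f := fun p : Space × Space =>
      ENNReal.ofReal ((v (a, p.2) - v (a, p.1)) ^ 2))
      (ENNReal.continuous_ofReal.comp (by fun_prop)).measurable
  -- The constant is the value of `v` at a point `y` where the inner integral does not exceed its
  -- average over the ball.
  obtain ⟨y, -, hy⟩ := exists_le_setLAverage hpos hfin hm.aemeasurable
  refine ⟨v (a, y), ?_⟩
  -- Doubling the radius multiplies the volume by `8`, and `8 · 4ρ² = 32ρ²`.
  have hvol : volume (Metric.closedBall (0 : Space) (2 * ρ)) =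
      ENNReal.ofReal 8 * volume (Metric.closedBall (0 : Space) ρ) := by
    rw [Measure.addHaar_closedBall_mul_of_pos volume (0 : Space) two_pos ρ]
    norm_num
  rw [setLAverage_eq, lintegral_ofReal_ball (by fun_prop) (fun _ => sq_nonneg _)] at hy
  have h2 := hy.trans (ENNReal.div_le_div_right (lintegral_lintegral_sq_sub_le hv a hρ) _)
  rw [hvol, lintegral_ofReal_ball (by fun_prop) (fun _ => gradSq_nonneg _ _),
    ← ENNReal.ofReal_mul (by positivity), mul_right_comm, ENNReal.mul_div_cancel_right hpos hfin,
    ← ENNReal.ofReal_mul (by norm_num)] at h2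
  have hJ : 0 ≤ ∫ x in Metric.closedBall (0 : Space) ρ, gradSq v (a, x) :=
    integral_nonneg fun _ => gradSq_nonneg _ _
  have h3 := (ENNReal.ofReal_le_ofReal_iff (by positivity)).1 h2
  linarith

end Poincare

/-! ### Spatial cutoff at scale `N` and its commutator with `□`. -/

section Cutoff

lemma exists_bound_deriv_smoothTransition : ∃ K : ℝ, 0 < K ∧
    (∀ y, |deriv Real.smoothTransition y| ≤ K) ∧
    ∀ y, |deriv (deriv Real.smoothTransition) y| ≤ K := by
  have hs : ContDiff ℝ ∞ Real.smoothTransition := Real.smoothTransition.contDiff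
  have hc : HasCompactSupport (deriv Real.smoothTransition) := by
    refine HasCompactSupport.intro (isCompact_Icc (a := (0 : ℝ)) (b := 1)) fun y hy => ?_
    rw [mem_Icc, not_and_or, not_le, not_le] at hy
    rcases hy with hy | hy
    · have : Real.smoothTransition =ᶠ[𝓝 y] fun _ => 0 := by
        filter_upwards [Iio_mem_nhds hy] with w hw
        exact Real.smoothTransition.zero_of_nonpos hw.le
      simp [this.deriv_eq]
    · have : Real.smoothTransition =ᶠ[𝓝 y] fun _ => 1 := by
        filter_upwards [Ioi_mem_nhds hy] with w hw
        exact Real.smoothTransition.one_of_one_le hw.le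
      simp [this.deriv_eq]
  have h1 : ContDiff ℝ ∞ (deriv Real.smoothTransition) := (contDiff_infty_iff_deriv.1 hs).2
  obtain ⟨K1, hK1⟩ := hc.exists_bound_of_continuous h1.continuous
  obtain ⟨K2, hK2⟩ := (hc.deriv (𝕜 := ℝ)).exists_bound_of_continuous
    (contDiff_infty_iff_deriv.1 h1).2.continuous
  refine ⟨max (max K1 K2) 1, by positivity, fun y => ?_, fun y => ?_⟩
  · exact (hK1 y).trans ((le_max_left _ _).trans (le_max_left _ _))
  · exact (hK2 y).trans ((le_max_right _ _).trans (le_max_left _ _))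

/-- A cutoff in space at scale `N`. -/
noncomputable def cutoff (N : ℝ) (z : SpaceTime) : ℝ :=
  Real.smoothTransition (3 - N⁻¹ ^ 2 * ∑ i : Fin 3, z.2 i ^ 2)

variable {N : ℝ}

lemma contDiff_sum_sq : ContDiff ℝ ∞ fun z : SpaceTime => ∑ i : Fin 3, z.2 i ^ 2 :=
  ContDiff.sum fun i _ => (contDiff_coord i).pow 2

lemma contDiff_cutoff_arg (N : ℝ) :
    ContDiff ℝ ∞ fun z : SpaceTime => 3 - N⁻¹ ^ 2 * ∑ i : Fin 3, z.2 i ^ 2 :=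
  contDiff_const.sub (contDiff_const.mul contDiff_sum_sq)

lemma contDiff_cutoff (N : ℝ) : ContDiff ℝ ∞ (cutoff N) :=
  Real.smoothTransition.contDiff.comp (contDiff_cutoff_arg N)

lemma cutoff_nonneg (N : ℝ) (z : SpaceTime) : 0 ≤ cutoff N z := Real.smoothTransition.nonneg _

lemma cutoff_le_one (N : ℝ) (z : SpaceTime) : cutoff N z ≤ 1 := Real.smoothTransition.le_one _

/-- The cutoff depends on `|x|²/N²`, which keeps it smooth at the origin. It is `1` up to `|x|² =
2N²` and `0` from `|x|² = 3N²` on, so the radii `N` and `2N` leave room on both sides. -/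
lemma cutoff_eq_zero (hN : 0 < N) {z : SpaceTime} (hz : 2 * N < ‖z.2‖) : cutoff N z = 0 := by
  refine Real.smoothTransition.zero_of_nonpos ?_
  rw [← norm_sq_space, ← mul_pow, sub_nonpos]
  have : 2 < N⁻¹ * ‖z.2‖ := by rw [inv_mul_eq_div, lt_div_iff₀ hN]; exact hz
  nlinarith

lemma cutoff_eventuallyEq_one (hN : 0 < N) {z : SpaceTime} (hz : ‖z.2‖ ≤ N) :
    cutoff N =ᶠ[𝓝 z] fun _ => 1 := by
  have hlt : 1 < 3 - N⁻¹ ^ 2 * ∑ i : Fin 3, z.2 i ^ 2 := by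
    rw [← norm_sq_space, ← mul_pow]
    have : N⁻¹ * ‖z.2‖ ≤ 1 := by rw [inv_mul_eq_div, div_le_one₀ hN]; exact hz
    have h0 : 0 ≤ N⁻¹ * ‖z.2‖ := by positivity
    nlinarith
  filter_upwards [(contDiff_cutoff_arg N).continuous.continuousAt.eventually (lt_mem_nhds hlt)]
    with y hy
  exact Real.smoothTransition.one_of_one_le hy.le

lemma pderiv_cutoff_arg (N : ℝ) (k : Fin 4) (z : SpaceTime) :
    pderiv k (fun z : SpaceTime => 3 - N⁻¹ ^ 2 * ∑ i : Fin 3, z.2 i ^ 2) z =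
      - (2 * N⁻¹ ^ 2 * (Fin.cons 0 z.2 : Fin 4 → ℝ) k) := by
  have h := pderiv_jap_arg 0 k z
  have d := smooth_differentiable contDiff_sum_sq
  rw [pderiv_add (differentiable_const _) d, pderiv_const, zero_add] at h
  rw [pderiv_sub (differentiable_const _) (d.const_mul _), pderiv_const, pderiv_const_mul d, h]
  ring

lemma pderiv_cutoff (N : ℝ) (k : Fin 4) (z : SpaceTime) :
    pderiv k (cutoff N) z =
      deriv Real.smoothTransition (3 - N⁻¹ ^ 2 * ∑ i : Fin 3, z.2 i ^ 2) *
        -(2 * N⁻¹ ^ 2 * (Fin.cons 0 z.2 : Fin 4 → ℝ) k) := by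
  rw [← pderiv_cutoff_arg]
  exact pderiv_comp (f := fun z : SpaceTime => 3 - N⁻¹ ^ 2 * ∑ i : Fin 3, z.2 i ^ 2)
    (hasDerivAt_smoothTransition _) (smooth_differentiable (contDiff_cutoff_arg N))

lemma pderiv_pderiv_cutoff (N : ℝ) (i : Fin 3) (z : SpaceTime) :
    pderiv i.succ (pderiv i.succ (cutoff N)) z =
      deriv (deriv Real.smoothTransition) (3 - N⁻¹ ^ 2 * ∑ i : Fin 3, z.2 i ^ 2) *
        (2 * N⁻¹ ^ 2 * z.2 i) ^ 2 -
      deriv Real.smoothTransition (3 - N⁻¹ ^ 2 * ∑ i : Fin 3, z.2 i ^ 2) * (2 * N⁻¹ ^ 2) := by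
  have hs : ContDiff ℝ ∞ Real.smoothTransition := Real.smoothTransition.contDiff
  have h1 : ContDiff ℝ ∞ (deriv Real.smoothTransition) := (contDiff_infty_iff_deriv.1 hs).2
  have ha := contDiff_cutoff_arg N
  have h2 : pderiv i.succ (cutoff N) = fun z =>
      deriv Real.smoothTransition ((fun z : SpaceTime => 3 - N⁻¹ ^ 2 * ∑ i : Fin 3, z.2 i ^ 2) z) *
        (-(2 * N⁻¹ ^ 2) * z.2 i) := by
    ext z; rw [pderiv_cutoff, Fin.cons_succ]; ring
  have dx := differentiable_coord i
  have hd : Differentiable ℝ fun z => deriv Real.smoothTransition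
      ((fun z : SpaceTime => 3 - N⁻¹ ^ 2 * ∑ i : Fin 3, z.2 i ^ 2) z) :=
    smooth_differentiable (h1.comp ha)
  rw [h2, pderiv_mul hd (dx.const_mul _),
    pderiv_comp (h1.differentiable (by simp) _).hasDerivAt (smooth_differentiable ha),
    pderiv_cutoff_arg, pderiv_const_mul dx, pderiv_coord, Fin.cons_succ]
  simp
  ring

/-- The scale-invariant bounds on the derivatives of the cutoff. -/
lemma exists_bound_cutoff : ∃ K : ℝ, 0 < K ∧ ∀ N : ℝ, 0 < N → ∀ z : SpaceTime, ‖z.2‖ ≤ 2 * N →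
    ∑ i : Fin 3, pderiv i.succ (cutoff N) z ^ 2 ≤ K / N ^ 2 ∧
    |∑ i : Fin 3, pderiv i.succ (pderiv i.succ (cutoff N)) z| ≤ K / N ^ 2 := by
  obtain ⟨K, hK, h1, h2⟩ := exists_bound_deriv_smoothTransition
  refine ⟨16 * K ^ 2 + 22 * K, by positivity, fun N hN z hz => ?_⟩
  have hX : ∑ i : Fin 3, z.2 i ^ 2 ≤ 4 * N ^ 2 := by
    rw [← norm_sq_space]; nlinarith [norm_nonneg z.2]
  have hX0 : 0 ≤ ∑ i : Fin 3, z.2 i ^ 2 := Finset.sum_nonneg fun _ _ => sq_nonneg _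
  set y := 3 - N⁻¹ ^ 2 * ∑ i : Fin 3, z.2 i ^ 2 with hy
  constructor
  · simp only [pderiv_cutoff, Fin.cons_succ, ← hy]
    have e : ∑ i : Fin 3, (deriv Real.smoothTransition y * -(2 * N⁻¹ ^ 2 * z.2 i)) ^ 2 =
        (4 * deriv Real.smoothTransition y ^ 2 * N⁻¹ ^ 4) * ∑ i : Fin 3, z.2 i ^ 2 := by
      rw [Finset.mul_sum]; exact Finset.sum_congr rfl fun i _ => by ring
    rw [e]
    calc _ ≤ (4 * K ^ 2 * N⁻¹ ^ 4) * (4 * N ^ 2) := by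
          have : deriv Real.smoothTransition y ^ 2 ≤ K ^ 2 := sq_le_sq.2 (by
            rw [abs_of_pos hK]; exact h1 y)
          gcongr
      _ = 16 * K ^ 2 / N ^ 2 := by field_simp; norm_num
      _ ≤ _ := by gcongr; linarith
  · simp only [pderiv_pderiv_cutoff, ← hy]
    have e : ∑ i : Fin 3, (deriv (deriv Real.smoothTransition) y * (2 * N⁻¹ ^ 2 * z.2 i) ^ 2 -
        deriv Real.smoothTransition y * (2 * N⁻¹ ^ 2)) =
        deriv (deriv Real.smoothTransition) y * (4 * N⁻¹ ^ 4 * ∑ i : Fin 3, z.2 i ^ 2) -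
          deriv Real.smoothTransition y * (6 * N⁻¹ ^ 2) := by
      simp only [Fin.sum_univ_three]; ring
    rw [e]
    calc _ ≤ |deriv (deriv Real.smoothTransition) y * (4 * N⁻¹ ^ 4 * ∑ i : Fin 3, z.2 i ^ 2)| +
          |deriv Real.smoothTransition y * (6 * N⁻¹ ^ 2)| := abs_sub _ _
      _ = |deriv (deriv Real.smoothTransition) y| * (4 * N⁻¹ ^ 4 * ∑ i : Fin 3, z.2 i ^ 2) +
          |deriv Real.smoothTransition y| * (6 * N⁻¹ ^ 2) := by
          have n1 : 0 ≤ 4 * N⁻¹ ^ 4 * ∑ i : Fin 3, z.2 i ^ 2 := by positivity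
          have n2 : 0 ≤ 6 * N⁻¹ ^ 2 := by positivity
          rw [abs_mul, abs_of_nonneg n1, abs_mul, abs_of_nonneg n2]
      _ ≤ K * (4 * N⁻¹ ^ 4 * (4 * N ^ 2)) + K * (6 * N⁻¹ ^ 2) := by
          gcongr
          · exact h2 y
          · exact h1 y
      _ = 22 * K / N ^ 2 := by field_simp; norm_num
      _ ≤ _ := by gcongr; nlinarith

lemma pderiv_cutoff_mul {v : SpaceTime → ℝ} (hv : ContDiff ℝ ∞ v) (c : ℝ) (k : Fin 4)
    (z : SpaceTime) :
    pderiv k (fun y => cutoff N y * (v y - c)) z =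
      pderiv k (cutoff N) z * (v z - c) + cutoff N z * pderiv k v z := by
  have dv := smooth_differentiable hv
  rw [pderiv_mul (smooth_differentiable (contDiff_cutoff N)) (dv.sub_const c),
    pderiv_sub dv (differentiable_const c), pderiv_const, sub_zero]

/-- Subtracting `c` is free in `□v` and `∇v`; it makes the term with `Δχ` accessible to the Poincaré
inequality. -/
lemma box_cutoff_mul {v : SpaceTime → ℝ} (hv : ContDiff ℝ ∞ v) (c : ℝ) (z : SpaceTime) :
    box (fun y => cutoff N y * (v y - c)) z = cutoff N z * box v z -
      2 * (∑ i : Fin 3, pderiv i.succ (cutoff N) z * pderiv i.succ v z) -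
      (∑ i : Fin 3, pderiv i.succ (pderiv i.succ (cutoff N)) z) * (v z - c) := by
  have dv := smooth_differentiable hv
  have dχ := smooth_differentiable (contDiff_cutoff N)
  have d1 : ∀ k, Differentiable ℝ (pderiv k v) := fun k =>
    smooth_differentiable (contDiff_pderiv hv k)
  have d2 : ∀ k, Differentiable ℝ (pderiv k (cutoff N)) := fun k =>
    smooth_differentiable (contDiff_pderiv (contDiff_cutoff N) k)
  have e1 : ∀ k, pderiv k (fun y => cutoff N y * (v y - c)) = fun z =>
      pderiv k (cutoff N) z * (v z - c) + cutoff N z * pderiv k v z := fun k => by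
    ext z; exact pderiv_cutoff_mul hv c k z
  have e2 : ∀ k, pderiv k (pderiv k (fun y => cutoff N y * (v y - c))) z =
      pderiv k (pderiv k (cutoff N)) z * (v z - c) + 2 * (pderiv k (cutoff N) z * pderiv k v z)
        + cutoff N z * pderiv k (pderiv k v) z := by
    intro k
    rw [e1, pderiv_add ((d2 k).fun_mul (dv.sub_const c)) (dχ.fun_mul (d1 k)),
      pderiv_mul (d2 k) (dv.sub_const c), pderiv_mul dχ (d1 k),
      pderiv_sub dv (differentiable_const c), pderiv_const]
    ring
  have z1 : pderiv 0 (cutoff N) = fun _ => 0 := by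
    ext z; rw [pderiv_cutoff]; simp
  have z2 : pderiv 0 (pderiv 0 (cutoff N)) z = 0 := by rw [z1, pderiv_const]
  rw [box, box]
  simp only [e2, z2, Fin.sum_univ_three]
  simp only [z1]
  ring

end Cutoff

/-! ### The estimate for smooth functions on large balls. -/

section Classical

/-- The size of the data and the source on `[a, b]` in the ball of radius `ρ`. -/
noncomputable def dataSize (v : SpaceTime → ℝ) (a b ρ : ℝ) : ℝ :=
  √(∫ x in Metric.closedBall (0 : Space) ρ, gradSq v (a, x)) +
    ∫ τ in a..b, √(∫ x in Metric.closedBall (0 : Space) ρ, box v (τ, x) ^ 2)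

variable {v : SpaceTime → ℝ} {a b T N : ℝ}

lemma continuous_box_norm (hv : ContDiff ℝ ∞ v) (ρ : ℝ) :
    Continuous fun τ => √(∫ x in Metric.closedBall (0 : Space) ρ, box v (τ, x) ^ 2) :=
  (continuous_ball_integral (((contDiff_box hv).continuous).pow 2) ρ).sqrt

lemma dataSize_nonneg (hab : a ≤ b) (ρ : ℝ) : 0 ≤ dataSize v a b ρ :=
  add_nonneg (Real.sqrt_nonneg _)
    (intervalIntegral.integral_nonneg hab fun _ _ => Real.sqrt_nonneg _)

/-- The energy estimate from radius `4N` to `2N`: the condition `2 + T ≤ N` is exactly what the cone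
needs. The factor `4` is the square of the `2` in front of the source. -/
lemma integral_gradSq_le_dataSize (hv : ContDiff ℝ ∞ v) (hab : a ≤ b) (hT : b - a ≤ T)
    (hN : 2 + T ≤ N) {s : ℝ} (hs : s ∈ Icc a b) :
    ∫ x in Metric.closedBall (0 : Space) (2 * N), gradSq v (s, x) ≤
      4 * dataSize v a b (4 * N) ^ 2 := by
  have h := energy_estimate hv hab (ρ := 2 * N) (M := 4 * N) (by linarith) hs
  have h1 : √(∫ x in Metric.closedBall (0 : Space) (2 * N), gradSq v (s, x)) ≤
      2 * dataSize v a b (4 * N) := by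
    rw [dataSize]
    linarith [Real.sqrt_nonneg (∫ x in Metric.closedBall (0 : Space) (4 * N), gradSq v (a, x))]
  have h2 : 0 ≤ ∫ x in Metric.closedBall (0 : Space) (2 * N), gradSq v (s, x) :=
    integral_nonneg fun _ => gradSq_nonneg _ _
  calc _ = √(∫ x in Metric.closedBall (0 : Space) (2 * N), gradSq v (s, x)) ^ 2 :=
        (Real.sq_sqrt h2).symm
    _ ≤ (2 * dataSize v a b (4 * N)) ^ 2 := by gcongr
    _ = _ := by ring

/-- One constant `c` serves all times: Poincaré at time `a` chooses it, and `v(s) - v(a) = ∫ ∂ₜv`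
with `s - a ≤ N` propagates the bound. The number is `2·32·4·4 + 2·4 = 1032`. -/
lemma exists_const_integral_sq_sub_le (hv : ContDiff ℝ ∞ v) (hab : a ≤ b) (hT : b - a ≤ T)
    (hN : 2 + T ≤ N) :
    ∃ c : ℝ, ∀ s ∈ Icc a b,
      ∫ x in Metric.closedBall (0 : Space) (2 * N), (v (s, x) - c) ^ 2 ≤
        1032 * N ^ 2 * dataSize v a b (4 * N) ^ 2 := by
  have hN0 : 0 < N := by linarith
  obtain ⟨c, hc⟩ := poincare_ball hv a (ρ := 2 * N) (by positivity)
  refine ⟨c, fun s hs => ?_⟩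
  have cv := hv.continuous
  have c0 := (contDiff_pderiv hv 0).continuous
  have cg := (contDiff_gradSq hv).continuous
  set A := dataSize v a b (4 * N)
  have hle : ∀ x : Space, (v (s, x) - c) ^ 2 ≤
      2 * (v (a, x) - c) ^ 2 + 2 * ((s - a) * ∫ τ in a..s, pderiv 0 v (τ, x) ^ 2) := by
    intro x
    have h1 : v (s, x) - v (a, x) = ∫ τ in a..s, pderiv 0 v (τ, x) :=
      (intervalIntegral.integral_eq_sub_of_hasDerivAt
        (fun τ _ => hasDerivAt_time (smooth_differentiable hv) τ x)
        (Continuous.intervalIntegrable (by fun_prop) _ _)).symm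
    have h2 := sq_intervalIntegral_le (φ := fun τ => pderiv 0 v (τ, x)) (by fun_prop) hs.1
    rw [← h1] at h2
    nlinarith [sq_nonneg ((v (a, x) - c) - (v (s, x) - v (a, x)))]
  have hcI : Continuous fun x : Space => ∫ τ in a..s, pderiv 0 v (τ, x) ^ 2 :=
    intervalIntegral.continuous_parametric_intervalIntegral_of_continuous'
      (f := fun x τ => pderiv 0 v (τ, x) ^ 2) (by fun_prop) a s
  have hswap : ∫ x in Metric.closedBall (0 : Space) (2 * N), ∫ τ in a..s, pderiv 0 v (τ, x) ^ 2 =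
      ∫ τ in a..s, ∫ x in Metric.closedBall (0 : Space) (2 * N), pderiv 0 v (τ, x) ^ 2 := by
    simp only [intervalIntegral.integral_of_le hs.1]
    refine integral_integral_swap ?_
    rw [Measure.prod_restrict]
    have : IntegrableOn (fun p : Space × ℝ => pderiv 0 v (p.2, p.1) ^ 2)
        (Metric.closedBall (0 : Space) (2 * N) ×ˢ Icc a s) :=
      (Continuous.continuousOn (by fun_prop)).integrableOn_compact
        ((isCompact_closedBall 0 _).prod isCompact_Icc)
    exact this.mono_set (prod_mono subset_rfl Ioc_subset_Icc_self)
  have hbd : ∫ τ in a..s, ∫ x in Metric.closedBall (0 : Space) (2 * N), pderiv 0 v (τ, x) ^ 2 ≤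
      (s - a) * (4 * A ^ 2) := by
    have : ∫ _ in a..s, 4 * A ^ 2 = (s - a) * (4 * A ^ 2) := by
      rw [intervalIntegral.integral_const, smul_eq_mul]
    rw [← this]
    refine intervalIntegral.integral_mono_on hs.1 ((continuous_ball_integral
      (f := fun z => pderiv 0 v z ^ 2) (by fun_prop) _).intervalIntegrable _ _) (by simp)
      fun τ hτ => ?_
    refine le_trans ?_ (integral_gradSq_le_dataSize hv hab hT hN ⟨hτ.1, hτ.2.trans hs.2⟩)
    refine setIntegral_ball_mono (by fun_prop) (by fun_prop) fun x _ => ?_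
    rw [gradSq_eq]
    have : 0 ≤ ∑ i : Fin 3, pderiv i.succ v (τ, x) ^ 2 := Finset.sum_nonneg fun _ _ => sq_nonneg _
    linarith
  have hsa : 0 ≤ s - a := sub_nonneg.2 hs.1
  have hsN : s - a ≤ N := by linarith [hs.2]
  calc _ ≤ ∫ x in Metric.closedBall (0 : Space) (2 * N),
        (2 * (v (a, x) - c) ^ 2 + 2 * ((s - a) * ∫ τ in a..s, pderiv 0 v (τ, x) ^ 2)) :=
        setIntegral_ball_mono (by fun_prop) (by fun_prop) fun x _ => hle x
    _ = 2 * (∫ x in Metric.closedBall (0 : Space) (2 * N), (v (a, x) - c) ^ 2) +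
        2 * ((s - a) * ∫ τ in a..s, ∫ x in Metric.closedBall (0 : Space) (2 * N),
          pderiv 0 v (τ, x) ^ 2) := by
        rw [integral_add, integral_const_mul, integral_const_mul, integral_const_mul, hswap]
        · exact (integrableOn_slice (f := fun z => (v z - c) ^ 2) (by fun_prop) a _).const_mul _
        · exact ((hcI.continuousOn.integrableOn_compact
            (isCompact_closedBall 0 _)).const_mul _).const_mul _
    _ ≤ 2 * (32 * (2 * N) ^ 2 * (4 * A ^ 2)) + 2 * ((s - a) * ((s - a) * (4 * A ^ 2))) := by
        gcongr
        refine hc.trans ?_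
        gcongr
        exact integral_gradSq_le_dataSize hv hab hT hN (left_mem_Icc.2 hab)
    _ ≤ 2 * (32 * (2 * N) ^ 2 * (4 * A ^ 2)) + 2 * (N * (N * (4 * A ^ 2))) := by gcongr
    _ = _ := by ring

lemma gradSq_cutoff_mul_le (hv : ContDiff ℝ ∞ v) (c : ℝ) {K : ℝ} {z : SpaceTime}
    (hK : ∑ i : Fin 3, pderiv i.succ (cutoff N) z ^ 2 ≤ K / N ^ 2) :
    gradSq (fun y => cutoff N y * (v y - c)) z ≤
      2 * gradSq v z + 2 * (K / N ^ 2) * (v z - c) ^ 2 := by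
  have h0 : pderiv 0 (cutoff N) z = 0 := by rw [pderiv_cutoff]; simp
  have hK' : ∑ k, pderiv k (cutoff N) z ^ 2 ≤ K / N ^ 2 := by
    rw [Fin.sum_univ_succ, h0]; simpa using hK
  calc _ ≤ ∑ k, (2 * pderiv k v z ^ 2 + 2 * pderiv k (cutoff N) z ^ 2 * (v z - c) ^ 2) := by
        refine Finset.sum_le_sum fun k _ => ?_
        rw [pderiv_cutoff_mul hv]
        have h1 := cutoff_nonneg N z
        have h2 : cutoff N z ^ 2 ≤ 1 := by nlinarith [cutoff_le_one N z]
        nlinarith [sq_nonneg (pderiv k (cutoff N) z * (v z - c) - cutoff N z * pderiv k v z),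
          mul_le_mul_of_nonneg_right h2 (sq_nonneg (pderiv k v z))]
    _ = 2 * gradSq v z + 2 * (∑ k, pderiv k (cutoff N) z ^ 2) * (v z - c) ^ 2 := by
        rw [gradSq, Finset.sum_add_distrib, Finset.mul_sum, Finset.mul_sum, Finset.sum_mul]
    _ ≤ _ := by gcongr

/-- For the multiplier `m`. Young's inequality is balanced so that every commutator term carries
`N⁻¹` times a quantity of size `A²`; integrating over a time of length at most `N` then loses
nothing. -/
lemma abs_box_cutoff_mul_le (hv : ContDiff ℝ ∞ v) (c : ℝ) {K m : ℝ} (hN : 0 < N)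
    {z : SpaceTime}
    (hK1 : ∑ i : Fin 3, pderiv i.succ (cutoff N) z ^ 2 ≤ K / N ^ 2)
    (hK2 : |∑ i : Fin 3, pderiv i.succ (pderiv i.succ (cutoff N)) z| ≤ K / N ^ 2) :
    |box (fun y => cutoff N y * (v y - c)) z| * |m| ≤ |box v z| * |m| +
      N⁻¹ * (K * gradSq v z + (1 + K) * m ^ 2 + K * (N⁻¹ ^ 2 * (v z - c) ^ 2)) := by
  rw [box_cutoff_mul hv]
  set p := ∑ i : Fin 3, pderiv i.succ (cutoff N) z * pderiv i.succ v z
  set q := ∑ i : Fin 3, pderiv i.succ (pderiv i.succ (cutoff N)) z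
  have hp : p ^ 2 ≤ K / N ^ 2 * gradSq v z := by
    refine (Finset.sum_mul_sq_le_sq_mul_sq _ _ _).trans ?_
    have : ∑ i : Fin 3, pderiv i.succ v z ^ 2 ≤ gradSq v z := by
      rw [gradSq_eq]; linarith [sq_nonneg (pderiv 0 v z)]
    have h0 : 0 ≤ ∑ i : Fin 3, pderiv i.succ (cutoff N) z ^ 2 :=
      Finset.sum_nonneg fun _ _ => sq_nonneg _
    have h1 : 0 ≤ ∑ i : Fin 3, pderiv i.succ v z ^ 2 := Finset.sum_nonneg fun _ _ => sq_nonneg _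
    exact mul_le_mul hK1 this h1 (h0.trans hK1)
  have h1 : |cutoff N z * box v z| ≤ |box v z| := by
    rw [abs_mul, abs_of_nonneg (cutoff_nonneg N z)]
    exact mul_le_of_le_one_left (abs_nonneg _) (cutoff_le_one N z)
  have h2 : 2 * |p| * |m| ≤ N⁻¹ * (K * gradSq v z + m ^ 2) := by
    have e : 2 * |p| * |m| ≤ N * p ^ 2 + N⁻¹ * m ^ 2 := by
      rw [← sq_abs p, ← sq_abs m]
      have : 0 ≤ N⁻¹ * (N * |p| - |m|) ^ 2 := by positivity
      have e2 : N⁻¹ * (N * |p| - |m|) ^ 2 = N * |p| ^ 2 - 2 * |p| * |m| + N⁻¹ * |m| ^ 2 := by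
        field_simp; ring
      linarith
    have : N * p ^ 2 ≤ N * (K / N ^ 2 * gradSq v z) := by gcongr
    have e3 : N * (K / N ^ 2 * gradSq v z) = N⁻¹ * (K * gradSq v z) := by field_simp
    linarith
  have hK0 : 0 ≤ K / N ^ 2 := (abs_nonneg _).trans hK2
  have h3 : |q * (v z - c)| * |m| ≤ N⁻¹ * (K * m ^ 2 + K * (N⁻¹ ^ 2 * (v z - c) ^ 2)) := by
    rw [abs_mul]
    have e : |v z - c| * |m| ≤ N * m ^ 2 + N⁻¹ * (v z - c) ^ 2 := by
      rw [← sq_abs (v z - c), ← sq_abs m]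
      have : 0 ≤ N⁻¹ * ((N * |m| - |v z - c|) ^ 2 + (N * |m|) ^ 2 + |v z - c| ^ 2) := by positivity
      have e2 : N⁻¹ * ((N * |m| - |v z - c|) ^ 2 + (N * |m|) ^ 2 + |v z - c| ^ 2) =
        2 * (N * |m| ^ 2 - |v z - c| * |m| + N⁻¹ * |v z - c| ^ 2) := by
        field_simp; ring
      linarith
    calc |q| * |v z - c| * |m| = |q| * (|v z - c| * |m|) := by ring
      _ ≤ K / N ^ 2 * (N * m ^ 2 + N⁻¹ * (v z - c) ^ 2) := by gcongr
      _ = _ := by field_simp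
  have h4 : |cutoff N z * box v z - 2 * p - q * (v z - c)| ≤
      |box v z| + 2 * |p| + |q * (v z - c)| := by
    calc _ ≤ |cutoff N z * box v z| + |2 * p| + |q * (v z - c)| :=
          (abs_sub _ _).trans (by gcongr; exact abs_sub _ _)
      _ ≤ _ := by rw [abs_mul 2 p, abs_two]; gcongr
  calc _ ≤ (|box v z| + 2 * |p| + |q * (v z - c)|) * |m| := by gcongr
    _ = |box v z| * |m| + 2 * |p| * |m| + |q * (v z - c)| * |m| := by ring
    _ ≤ _ := by linarith

/-- The Morawetz estimate at scale `R`, localised to a large ball. -/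
theorem exists_localised_morawetz : ∃ C : ℝ, 0 < C ∧ ∀ {v : SpaceTime → ℝ} {a b T N R : ℝ},
    ContDiff ℝ ∞ v → a ≤ b → b - a ≤ T → 2 + T ≤ N → 0 < R →
    ∫ s in a..b, ∫ x in Metric.closedBall (0 : Space) N, R ^ 2 * pot R (s, x) ^ 3 * gradSq v (s, x)
      ≤ C * dataSize v a b (4 * N) ^ 2 := by
  obtain ⟨K, hK, hbd⟩ := exists_bound_cutoff
  -- The energy of `χ (v - c)` is at most `q A²`: `2 · 4` from the gradient of `v` and `2K · 1032`
  -- from the gradient of the cutoff.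
  set q : ℝ := 8 + 2064 * K with hq
  refine ⟨22 * q + 2 * ((10 * q + 1) + (4 * K + (1 + K) * (10 * q) + K * 1032)),
    by positivity, ?_⟩
  intro v a b T N R hv hab hT hN hR
  have hT0 : 0 ≤ T := by linarith
  have hN0 : 0 < N := by linarith
  obtain ⟨c, hc⟩ := exists_const_integral_sq_sub_le hv hab hT hN
  set A := dataSize v a b (4 * N) with hA
  have hA0 : 0 ≤ A := dataSize_nonneg hab _
  set u : SpaceTime → ℝ := fun y => cutoff N y * (v y - c) with hu_def
  have hu : ContDiff ℝ ∞ u := (contDiff_cutoff N).mul (hv.sub contDiff_const)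
  have hu0 : ∀ z : SpaceTime, 2 * N < ‖z.2‖ → u z = 0 := fun z hz => by
    simp [hu_def, cutoff_eq_zero hN0 hz]
  have cv := hv.continuous
  have cgv := (contDiff_gradSq hv).continuous
  have cgu := (contDiff_gradSq hu).continuous
  have cp := (contDiff_pot hR).continuous
  have cd := (contDiff_dil hu).continuous
  have cbu := (contDiff_box hu).continuous
  have cbv := (contDiff_box hv).continuous
  have hgv := fun s hs => integral_gradSq_le_dataSize hv hab hT hN (s := s) hs
  rw [← hA] at hgv
  have hQ : ∀ s ∈ Icc a b, ∫ x in Metric.closedBall (0 : Space) (2 * N), gradSq u (s, x) ≤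
      q * A ^ 2 := by
    intro s hs
    calc _ ≤ ∫ x in Metric.closedBall (0 : Space) (2 * N),
          (2 * gradSq v (s, x) + 2 * (K / N ^ 2) * (v (s, x) - c) ^ 2) :=
          setIntegral_ball_mono (by fun_prop) (by fun_prop) fun x hx =>
            gradSq_cutoff_mul_le hv c (hbd N hN0 (s, x) hx).1
      _ = 2 * (∫ x in Metric.closedBall (0 : Space) (2 * N), gradSq v (s, x)) +
          2 * (K / N ^ 2) * ∫ x in Metric.closedBall (0 : Space) (2 * N), (v (s, x) - c) ^ 2 := by
          rw [integral_add, integral_const_mul, integral_const_mul]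
          · exact (integrableOn_slice cgv s _).const_mul _
          · exact (integrableOn_slice (f := fun z => (v z - c) ^ 2) (by fun_prop) s _).const_mul _
      _ ≤ 2 * (4 * A ^ 2) + 2 * (K / N ^ 2) * (1032 * N ^ 2 * A ^ 2) := by
          gcongr
          · exact hgv s hs
          · exact hc s hs
      _ = _ := by rw [hq]; field_simp; ring
  have hm := fun s => integral_multiplier_sq_le hR hu hu0 s
  have hsrc : ∀ s ∈ Icc a b, ∫ x in Metric.closedBall (0 : Space) (2 * N),
      |box u (s, x)| * |pot R (s, x) * dil u (s, x)| ≤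
      √(∫ x in Metric.closedBall (0 : Space) (4 * N), box v (s, x) ^ 2) * ((10 * q + 1) * A) +
        N⁻¹ * ((4 * K + (1 + K) * (10 * q) + K * 1032) * A ^ 2) := by
    intro s hs
    have hms : ∫ x in Metric.closedBall (0 : Space) (2 * N),
        (pot R (s, x) * dil u (s, x)) ^ 2 ≤ 10 * q * A ^ 2 := by
      linarith [hm s, hQ s hs]
    calc _ ≤ ∫ x in Metric.closedBall (0 : Space) (2 * N),
          (|box v (s, x)| * |pot R (s, x) * dil u (s, x)| + N⁻¹ * (K * gradSq v (s, x) +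
            (1 + K) * (pot R (s, x) * dil u (s, x)) ^ 2 +
            K * (N⁻¹ ^ 2 * (v (s, x) - c) ^ 2))) :=
          setIntegral_ball_mono (by fun_prop) (by fun_prop) fun x hx =>
            abs_box_cutoff_mul_le hv c hN0 (hbd N hN0 (s, x) hx).1 (hbd N hN0 (s, x) hx).2
      _ = (∫ x in Metric.closedBall (0 : Space) (2 * N),
            |box v (s, x)| * |pot R (s, x) * dil u (s, x)|) + N⁻¹ *
          (K * (∫ x in Metric.closedBall (0 : Space) (2 * N), gradSq v (s, x)) +
            (1 + K) * (∫ x in Metric.closedBall (0 : Space) (2 * N),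
              (pot R (s, x) * dil u (s, x)) ^ 2) +
            K * (N⁻¹ ^ 2 * ∫ x in Metric.closedBall (0 : Space) (2 * N), (v (s, x) - c) ^ 2)) := by
          have i1 := integrableOn_slice (f := fun z => |box v z| * |pot R z * dil u z|)
            (by fun_prop) s (2 * N)
          have i2 := integrableOn_slice (f := fun z => K * gradSq v z) (by fun_prop) s (2 * N)
          have i3 := integrableOn_slice (f := fun z => (1 + K) * (pot R z * dil u z) ^ 2)
            (by fun_prop) s (2 * N)
          have i4 := integrableOn_slice (f := fun z => K * (N⁻¹ ^ 2 * (v z - c) ^ 2))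
            (by fun_prop) s (2 * N)
          rw [integral_add i1 (((i2.fun_add i3).fun_add i4).const_mul _), integral_const_mul,
            integral_add (i2.fun_add i3) i4, integral_add i2 i3]
          simp only [integral_const_mul]
      _ ≤ √(∫ x in Metric.closedBall (0 : Space) (4 * N), box v (s, x) ^ 2) * ((10 * q + 1) * A) +
          N⁻¹ * (K * (4 * A ^ 2) + (1 + K) * (10 * q * A ^ 2) +
            K * (N⁻¹ ^ 2 * (1032 * N ^ 2 * A ^ 2))) := by
          gcongr
          · refine (cauchySchwarz_ball (by fun_prop) (by fun_prop) _).trans ?_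
            refine mul_le_mul (Real.sqrt_le_sqrt ?_) ?_ (Real.sqrt_nonneg _) (Real.sqrt_nonneg _)
            · exact setIntegral_ball_mono_radius (f := fun x => box v (s, x) ^ 2) (by fun_prop)
                (fun x => sq_nonneg _) (by linarith)
            -- The crude bound `10q ≤ (10q + 1)²` avoids a square root in the constant.
            · rw [Real.sqrt_le_left (by positivity)]
              refine hms.trans ?_
              rw [mul_pow]
              gcongr
              have : 0 ≤ q := by positivity
              nlinarith
          · exact hgv s hs
          · exact hc s hs
      _ = _ := by field_simp
  have hsrcI : ∫ s in a..b, ∫ x in Metric.closedBall (0 : Space) (2 * N),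
      |box u (s, x)| * |pot R (s, x) * dil u (s, x)| ≤
      ((10 * q + 1) + (4 * K + (1 + K) * (10 * q) + K * 1032)) * A ^ 2 := by
    set W := (4 * K + (1 + K) * (10 * q) + K * 1032) with hW
    have hW0 : 0 ≤ W := by positivity
    have hgc := continuous_box_norm hv (4 * N)
    calc _ ≤ ∫ s in a..b, (√(∫ x in Metric.closedBall (0 : Space) (4 * N), box v (s, x) ^ 2) *
          ((10 * q + 1) * A) + N⁻¹ * (W * A ^ 2)) := by
          refine intervalIntegral.integral_mono_on hab ?_ ?_ hsrc
          · exact (continuous_ball_integral (f := fun z => |box u z| * |pot R z * dil u z|)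
              (by fun_prop) _).intervalIntegrable _ _
          · exact ((hgc.mul_const _).add_const _).intervalIntegrable _ _
      _ = (∫ s in a..b, √(∫ x in Metric.closedBall (0 : Space) (4 * N), box v (s, x) ^ 2)) *
          ((10 * q + 1) * A) + (b - a) * (N⁻¹ * (W * A ^ 2)) := by
          rw [intervalIntegral.integral_add ((hgc.mul_const _).intervalIntegrable _ _) (by simp),
            intervalIntegral.integral_mul_const, intervalIntegral.integral_const, smul_eq_mul]
      _ ≤ A * ((10 * q + 1) * A) + N * (N⁻¹ * (W * A ^ 2)) := by
          gcongr
          · rw [hA, dataSize]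
            exact le_add_of_nonneg_left (Real.sqrt_nonneg _)
          · linarith
      _ = _ := by field_simp
  have hmor := morawetz_estimate hR hu hab hu0 hQ
  have hpos : ∀ z, 0 ≤ R ^ 2 * pot R z ^ 3 := fun z => by
    have := pot_pos hR z
    positivity
  have hfin : ∫ s in a..b, ∫ x in Metric.closedBall (0 : Space) N,
        R ^ 2 * pot R (s, x) ^ 3 * gradSq v (s, x) ≤
      ∫ s in a..b, ∫ x in Metric.closedBall (0 : Space) (2 * N),
        R ^ 2 * pot R (s, x) ^ 3 * gradSq u (s, x) := by
    -- On the ball of radius `N` the cutoff is locally `1`, so `u` and `v` have the same gradient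
    -- there; the rest of the larger ball only adds a nonnegative amount.
    refine intervalIntegral.integral_mono_on hab ?_ ?_ fun s _ => ?_
    · exact (continuous_ball_integral (f := fun z => R ^ 2 * pot R z ^ 3 * gradSq v z)
        (by fun_prop) _).intervalIntegrable _ _
    · exact (continuous_ball_integral (f := fun z => R ^ 2 * pot R z ^ 3 * gradSq u z)
        (by fun_prop) _).intervalIntegrable _ _
    · calc _ ≤ ∫ x in Metric.closedBall (0 : Space) N,
            R ^ 2 * pot R (s, x) ^ 3 * gradSq u (s, x) := by
            refine setIntegral_ball_mono (by fun_prop) (by fun_prop) fun x hx => ?_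
            have hd : ∀ k, pderiv k u (s, x) = pderiv k v (s, x) := by
              intro k
              have : u =ᶠ[𝓝 (s, x)] fun y => v y - c := by
                filter_upwards [cutoff_eventuallyEq_one hN0 (z := (s, x)) hx] with y hy
                simp [hu_def, hy]
              rw [pderiv_congr this, pderiv_sub (smooth_differentiable hv)
                (differentiable_const c), pderiv_const, sub_zero]
            simp [gradSq, hd]
        _ ≤ _ := setIntegral_ball_mono_radius (by fun_prop)
            (fun x => mul_nonneg (hpos _) (gradSq_nonneg _ _)) (by linarith)
  linarith

/-- If `r < T`, take the least `k` with `1 + r ≤ 2^k`, so that `2^k ≤ 2(1 + r)`. For `R = 2^k` one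
has `√(R² + r²) ≤ √2 R`, hence `R² h³ ≥ 1/(4R) ≥ 1/(8(1 + r))`, and this single term suffices. If `r
≥ T`, the last summand does. -/
lemma inv_one_add_le_sum (hT : 0 ≤ T) {n : ℕ} (hn : 2 + T ≤ 2 ^ n) (z : SpaceTime) :
    (1 + ‖z.2‖)⁻¹ ≤
      8 * ∑ k ∈ Finset.range (n + 1), ((2 : ℝ) ^ k) ^ 2 * pot (2 ^ k) z ^ 3 + (1 + T)⁻¹ := by
  have hterm : ∀ k : ℕ, 0 ≤ ((2 : ℝ) ^ k) ^ 2 * pot (2 ^ k) z ^ 3 := fun k => by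
    have := pot_pos (R := 2 ^ k) (by positivity) z
    positivity
  have hr := norm_nonneg z.2
  by_cases hz : T ≤ ‖z.2‖
  · have h1 : (1 + ‖z.2‖)⁻¹ ≤ (1 + T)⁻¹ := by gcongr
    have h2 := Finset.sum_nonneg fun k (_ : k ∈ Finset.range (n + 1)) => hterm k
    linarith
  push Not at hz
  have hex : ∃ k : ℕ, 1 + ‖z.2‖ ≤ 2 ^ k := ⟨n, by linarith⟩
  classical
  set k := Nat.find hex with hk
  have hk1 : 1 + ‖z.2‖ ≤ 2 ^ k := Nat.find_spec hex
  have hkn : k ≤ n := Nat.find_min' hex (by linarith)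
  have hk2 : (2 : ℝ) ^ k ≤ 2 * (1 + ‖z.2‖) := by
    rcases Nat.eq_zero_or_pos k with h | h
    · rw [h]; norm_num; linarith
    · have := Nat.find_min hex (m := k - 1) (by omega)
      push Not at this
      have e : (2 : ℝ) ^ k = 2 * 2 ^ (k - 1) := by
        rw [← pow_succ']; congr 1; omega
      rw [e]; linarith
  have hR : (0 : ℝ) < 2 ^ k := by positivity
  have hj : jap (2 ^ k) z ≤ 2 ^ k * √2 := by
    rw [jap_eq, Real.sqrt_le_left (by positivity), mul_pow, Real.sq_sqrt zero_le_two]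
    nlinarith
  have hjp := jap_pos hR z
  have hmain : (1 + ‖z.2‖)⁻¹ ≤ 8 * (((2 : ℝ) ^ k) ^ 2 * pot (2 ^ k) z ^ 3) := by
    have h3 : jap (2 ^ k) z ^ 3 ≤ 4 * (2 ^ k) ^ 3 := by
      calc _ ≤ (2 ^ k * √2) ^ 3 := by gcongr
        _ = (2 ^ k) ^ 3 * (√2 ^ 2 * √2) := by ring
        _ = (2 ^ k) ^ 3 * (2 * √2) := by rw [Real.sq_sqrt zero_le_two]
        _ ≤ (2 ^ k) ^ 3 * (2 * 2) := by
          gcongr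
          rw [Real.sqrt_le_left (by norm_num)]; norm_num
        _ = _ := by ring
    have h4 : (4 * ((2 : ℝ) ^ k) ^ 3)⁻¹ ≤ pot (2 ^ k) z ^ 3 := by
      rw [pot, inv_pow]; gcongr
    calc (1 + ‖z.2‖)⁻¹ = 2 * (2 * (1 + ‖z.2‖))⁻¹ := by field_simp
      _ ≤ 2 * ((2 : ℝ) ^ k)⁻¹ := by gcongr
      _ = 8 * (((2 : ℝ) ^ k) ^ 2 * (4 * ((2 : ℝ) ^ k) ^ 3)⁻¹) := by field_simp; norm_num
      _ ≤ _ := by gcongr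
  have hsingle := Finset.single_le_sum (f := fun k : ℕ => ((2 : ℝ) ^ k) ^ 2 * pot (2 ^ k) z ^ 3)
    (fun k _ => hterm k) (Finset.mem_range.2 (Nat.lt_succ_of_le hkn))
  have : 0 ≤ (1 + T)⁻¹ := by positivity
  linarith

/-- With `L = ⌊log₂⌊2 + T⌋⌋` take `n = L + 1`. As `log 2 ≥ ½`, `L` costs `2 log(2 + T)` and the
remaining `2` costs `4 log(2 + T)`. -/
lemma exists_dyadic_scale (hT : 0 ≤ T) :
    ∃ n : ℕ, 2 + T ≤ 2 ^ n ∧ (n : ℝ) + 1 ≤ 6 * Real.log (2 + T) := by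
  have hlog2 : (1 : ℝ) / 2 ≤ Real.log 2 := by linarith [Real.log_two_gt_d9]
  have hL : Real.log 2 ≤ Real.log (2 + T) := Real.log_le_log two_pos (by linarith)
  have hfl : ⌊2 + T⌋₊ ≠ 0 := by
    rw [Ne, Nat.floor_eq_zero]; linarith
  refine ⟨Nat.log 2 ⌊2 + T⌋₊ + 1, ?_, ?_⟩
  · have h1 := Nat.lt_pow_succ_log_self one_lt_two ⌊2 + T⌋₊
    have h2 := Nat.lt_floor_add_one (2 + T)
    have h3 : ((⌊2 + T⌋₊ : ℝ) + 1) ≤ 2 ^ (Nat.log 2 ⌊2 + T⌋₊ + 1) := by exact_mod_cast h1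
    linarith
  · have h1 : (2 : ℝ) ^ (Nat.log 2 ⌊2 + T⌋₊) ≤ 2 + T := by
      have := Nat.pow_log_le_self 2 hfl
      calc (2 : ℝ) ^ (Nat.log 2 ⌊2 + T⌋₊) ≤ (⌊2 + T⌋₊ : ℝ) := by exact_mod_cast this
        _ ≤ _ := Nat.floor_le (by linarith)
    have h2 := Real.log_le_log (by positivity) h1
    rw [Real.log_pow] at h2
    push_cast
    have : (0 : ℝ) ≤ (Nat.log 2 ⌊2 + T⌋₊ : ℝ) := by positivity
    nlinarith

/-- The weighted space-time estimate for smooth functions, localised to a large ball. -/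
theorem exists_classical_estimate : ∃ C : ℝ, 0 < C ∧ ∀ {v : SpaceTime → ℝ} {a b T N : ℝ},
    ContDiff ℝ ∞ v → a ≤ b → b - a ≤ T → 2 + T ≤ N →
    ∫ s in a..b, ∫ x in Metric.closedBall (0 : Space) N, (1 + ‖x‖)⁻¹ * gradSq v (s, x)
      ≤ C * Real.log (2 + T) * dataSize v a b (4 * N) ^ 2 := by
  obtain ⟨C, hC, hmor⟩ := exists_localised_morawetz
  refine ⟨48 * C + 8, by positivity, ?_⟩
  intro v a b T N hv hab hT hN
  have hT0 : 0 ≤ T := by linarith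
  have hN0 : 0 < N := by linarith
  obtain ⟨n, hn, hlog⟩ := exists_dyadic_scale hT0
  set A := dataSize v a b (4 * N) with hA
  have cg := (contDiff_gradSq hv).continuous
  have cp : ∀ k : ℕ, Continuous (pot (2 ^ k)) := fun k =>
    (contDiff_pot (by positivity)).continuous
  have hcR : ∀ k : ℕ, Continuous fun s => ∫ x in Metric.closedBall (0 : Space) N,
      ((2 : ℝ) ^ k) ^ 2 * pot (2 ^ k) (s, x) ^ 3 * gradSq v (s, x) := fun k =>
    continuous_ball_integral (f := fun z => ((2 : ℝ) ^ k) ^ 2 * pot (2 ^ k) z ^ 3 * gradSq v z)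
      (by have := cp k; fun_prop) N
  have hcg : Continuous fun s => ∫ x in Metric.closedBall (0 : Space) N, gradSq v (s, x) :=
    continuous_ball_integral cg N
  have hw : Continuous fun z : SpaceTime => (1 + ‖z.2‖)⁻¹ :=
    (by fun_prop : Continuous fun z : SpaceTime => 1 + ‖z.2‖).inv₀ fun z => by positivity
  have hpt : ∀ s, ∫ x in Metric.closedBall (0 : Space) N, (1 + ‖x‖)⁻¹ * gradSq v (s, x) ≤
      8 * (∑ k ∈ Finset.range (n + 1), ∫ x in Metric.closedBall (0 : Space) N,
        ((2 : ℝ) ^ k) ^ 2 * pot (2 ^ k) (s, x) ^ 3 * gradSq v (s, x)) +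
      (1 + T)⁻¹ * ∫ x in Metric.closedBall (0 : Space) N, gradSq v (s, x) := by
    intro s
    have i1 : ∀ k : ℕ, IntegrableOn (fun x : Space => ((2 : ℝ) ^ k) ^ 2 * pot (2 ^ k) (s, x) ^ 3 *
        gradSq v (s, x)) (Metric.closedBall 0 N) := fun k =>
      integrableOn_slice (f := fun z => ((2 : ℝ) ^ k) ^ 2 * pot (2 ^ k) z ^ 3 * gradSq v z)
        (by have := cp k; fun_prop) s N
    rw [← integral_finsetSum _ fun k _ => i1 k, ← integral_const_mul, ← integral_const_mul,
      ← integral_add ((integrable_finsetSum _ fun k _ => i1 k).const_mul _)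
        ((integrableOn_slice cg s N).const_mul _)]
    refine setIntegral_ball_mono ?_ (by fun_prop) fun x _ => ?_
    · exact (hw.comp (by fun_prop : Continuous fun x : Space => ((s, x) : SpaceTime))).mul
        (by fun_prop)
    · have := mul_le_mul_of_nonneg_right (inv_one_add_le_sum hT0 hn (s, x))
        (gradSq_nonneg v (s, x))
      refine this.trans (le_of_eq ?_)
      rw [add_mul, mul_assoc, Finset.sum_mul]
  calc _ ≤ ∫ s in a..b, (8 * (∑ k ∈ Finset.range (n + 1), ∫ x in Metric.closedBall (0 : Space) N,
        ((2 : ℝ) ^ k) ^ 2 * pot (2 ^ k) (s, x) ^ 3 * gradSq v (s, x)) +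
      (1 + T)⁻¹ * ∫ x in Metric.closedBall (0 : Space) N, gradSq v (s, x)) := by
        refine intervalIntegral.integral_mono_on hab ?_ ?_ fun s _ => hpt s
        · exact (continuous_ball_integral (f := fun z => (1 + ‖z.2‖)⁻¹ * gradSq v z)
            (hw.mul cg) N).intervalIntegrable _ _
        · exact Continuous.intervalIntegrable (by fun_prop) _ _
    _ = 8 * (∑ k ∈ Finset.range (n + 1), ∫ s in a..b, ∫ x in Metric.closedBall (0 : Space) N,
        ((2 : ℝ) ^ k) ^ 2 * pot (2 ^ k) (s, x) ^ 3 * gradSq v (s, x)) +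
      (1 + T)⁻¹ * ∫ s in a..b, ∫ x in Metric.closedBall (0 : Space) N, gradSq v (s, x) := by
        rw [intervalIntegral.integral_add, intervalIntegral.integral_const_mul,
          intervalIntegral.integral_const_mul, intervalIntegral.integral_finsetSum]
        · exact fun k _ => (hcR k).intervalIntegrable _ _
        all_goals exact Continuous.intervalIntegrable (by fun_prop) _ _
    _ ≤ 8 * (∑ _k ∈ Finset.range (n + 1), C * A ^ 2) + (1 + T)⁻¹ * ((1 + T) * (4 * A ^ 2)) := by
        gcongr with k _
        · exact hmor hv hab hT hN (by positivity)
        -- In the far region the energy is integrated over a time of length at most `T`, which the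
        -- weight `(1 + T)⁻¹` compensates.
        · have h4 : ∫ s in a..b, ∫ x in Metric.closedBall (0 : Space) N, gradSq v (s, x) ≤
              ∫ _ in a..b, 4 * A ^ 2 := by
            refine intervalIntegral.integral_mono_on hab (hcg.intervalIntegrable _ _) (by simp)
              fun s hs => ?_
            refine le_trans ?_ (integral_gradSq_le_dataSize hv hab hT hN hs)
            exact setIntegral_ball_mono_radius (by fun_prop) (fun x => gradSq_nonneg _ _)
              (by linarith)
          refine h4.trans ?_
          simp only [intervalIntegral.integral_const, smul_eq_mul]
          gcongr
          linarith
    _ = (8 * (n + 1) * C + 4) * A ^ 2 := by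
        rw [Finset.sum_const, Finset.card_range, nsmul_eq_mul]
        push_cast
        field_simp
    _ ≤ (48 * C + 8) * Real.log (2 + T) * A ^ 2 := by
        gcongr
        have h1 : (1 : ℝ) / 2 ≤ Real.log (2 + T) :=
          le_trans (by linarith [Real.log_two_gt_d9]) (Real.log_le_log two_pos (by linarith))
        nlinarith

end Classical

/-- Gives the translation and reflection invariance of `dt dx` that the convolutions need. -/
instance : (volume : Measure SpaceTime).IsAddHaarMeasure :=
  inferInstanceAs ((volume : Measure ℝ).prod (volume : Measure Space)).IsAddHaarMeasure

/-! ### Mollification of weak solutions away from the initial time. -/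

section Mollification

/-- The restriction of a function to times `t ≥ δ`, extended by zero. -/
noncomputable def cut {E : Type*} [Zero E] (δ : ℝ) (f : SpaceTime → E) : SpaceTime → E :=
  indicator (Ici δ ×ˢ univ) f

lemma cut_of_le {E : Type*} [Zero E] {δ : ℝ} {f : SpaceTime → E} {z : SpaceTime} (h : δ ≤ z.1) :
    cut δ f z = f z := indicator_of_mem (s := Ici δ ×ˢ univ) ⟨h, mem_univ _⟩ f

lemma isClosed_late (δ : ℝ) : IsClosed (Ici δ ×ˢ (univ : Set Space)) := isClosed_Ici.prod isClosed_univ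

/-- Local integrability is known only on the open half space and may fail at `t = 0`; discarding the
times before `δ > 0` makes it global, as convolution requires. -/
lemma locallyIntegrable_cut {E : Type*} [NormedAddCommGroup E] {f : SpaceTime → E}
    (hf : LocallyIntegrableOn f upper) {δ : ℝ} (hδ : 0 < δ) : LocallyIntegrable (cut δ f) := by
  rw [locallyIntegrable_iff]
  intro k hk
  have hS := (isClosed_late δ).measurableSet
  rw [IntegrableOn, cut, integrable_indicator_iff hS, IntegrableOn,
    Measure.restrict_restrict hS, inter_comm]
  refine hf.integrableOn_compact_subset (fun z hz => ?_) (hk.inter_right (isClosed_late δ))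
  exact ⟨lt_of_lt_of_le hδ hz.2.1, mem_univ _⟩

/-- The convolution of a function with the kernel `ρ`. -/
noncomputable def moll {E : Type*} [NormedAddCommGroup E] [NormedSpace ℝ E] (ρ : SpaceTime → ℝ)
    (f : SpaceTime → E) (z : SpaceTime) : E := ∫ ζ, ρ (z - ζ) • f ζ

lemma moll_eq_convolution (ρ f : SpaceTime → ℝ) :
    moll ρ f = convolution f ρ (ContinuousLinearMap.mul ℝ ℝ) volume := by
  ext z
  simp [moll, convolution, mul_comm]

variable {ρ f : SpaceTime → ℝ}

lemma contDiff_moll (hρ : ContDiff ℝ ∞ ρ) (hc : HasCompactSupport ρ) (hf : LocallyIntegrable f) :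
    ContDiff ℝ ∞ (moll ρ f) := by
  rw [moll_eq_convolution]
  exact hc.contDiff_convolution_right (n := ⊤) _ hf hρ

lemma hasCompactSupport_pderiv (hc : HasCompactSupport ρ) (k : Fin 4) :
    HasCompactSupport (pderiv k ρ) := hc.fderiv_apply (𝕜 := ℝ) _

lemma pderiv_moll (hρ : ContDiff ℝ ∞ ρ) (hc : HasCompactSupport ρ) (hf : LocallyIntegrable f)
    (k : Fin 4) : pderiv k (moll ρ f) = moll (pderiv k ρ) f := by
  ext z
  have hρ1 : ContDiff ℝ 1 ρ := hρ.of_le (by simp)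
  have h := hc.hasFDerivAt_convolution_right (ContinuousLinearMap.mul ℝ ℝ) hf hρ1 z
  rw [moll_eq_convolution, moll_eq_convolution, pderiv, h.fderiv,
    convolution_precompR_apply _ hf (hc.fderiv ℝ) (hρ1.continuous_fderiv (by simp))]
  rfl

lemma integrable_moll_integrand {E : Type*} [NormedAddCommGroup E] [NormedSpace ℝ E]
    {f : SpaceTime → E} (hρ : Continuous ρ) (hc : HasCompactSupport ρ) (hf : LocallyIntegrable f)
    (z : SpaceTime) : Integrable fun ζ => ρ (z - ζ) • f ζ := by
  refine hf.integrable_smul_left_of_hasCompactSupport (g := fun ζ => ρ (z - ζ)) (by fun_prop) ?_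
  exact hc.comp_homeomorph (Homeomorph.subLeft z)

lemma box_moll (hρ : ContDiff ℝ ∞ ρ) (hc : HasCompactSupport ρ) (hf : LocallyIntegrable f) :
    box (moll ρ f) = moll (box ρ) f := by
  ext z
  have h2 : ∀ k, pderiv k (pderiv k (moll ρ f)) z = moll (pderiv k (pderiv k ρ)) f z := fun k => by
    rw [pderiv_moll hρ hc hf, pderiv_moll (contDiff_pderiv hρ k) (hasCompactSupport_pderiv hc k) hf]
  have hi : ∀ k, Integrable fun ζ => pderiv k (pderiv k ρ) (z - ζ) • f ζ := fun k =>
    integrable_moll_integrand (contDiff_pderiv (contDiff_pderiv hρ k) k).continuous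
      (hasCompactSupport_pderiv (hasCompactSupport_pderiv hc k) k) hf z
  rw [box]
  simp only [h2]
  simp only [moll, box, sub_smul, Finset.sum_smul]
  rw [integral_sub (hi 0) (integrable_finsetSum _ fun i _ => hi i.succ),
    integral_finsetSum _ fun i _ => hi i.succ]

lemma pderiv_reflect (hρ : Differentiable ℝ ρ) (k : Fin 4) (z ζ : SpaceTime) :
    pderiv k (fun ζ => ρ (z - ζ)) ζ = - pderiv k ρ (z - ζ) := by
  have h : HasFDerivAt (fun ζ => ρ (z - ζ)) ((fderiv ℝ ρ (z - ζ)).comp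
      (-ContinuousLinearMap.id ℝ SpaceTime)) ζ :=
    (hρ (z - ζ)).hasFDerivAt.comp ζ ((hasFDerivAt_id ζ).const_sub z)
  rw [pderiv, h.fderiv]
  simp [pderiv]

lemma box_reflect (hρ : ContDiff ℝ ∞ ρ) (z ζ : SpaceTime) :
    box (fun ζ => ρ (z - ζ)) ζ = box ρ (z - ζ) := by
  have h2 : ∀ k, pderiv k (pderiv k (fun ζ => ρ (z - ζ))) ζ = pderiv k (pderiv k ρ) (z - ζ) := by
    intro k
    have e : pderiv k (fun ζ => ρ (z - ζ)) = fun ζ => - pderiv k ρ (z - ζ) := by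
      ext y; exact pderiv_reflect (smooth_differentiable hρ) k z y
    rw [e, pderiv_neg, pderiv_reflect (smooth_differentiable (contDiff_pderiv hρ k)), neg_neg]
  rw [box, box]
  simp only [h2]

variable {ε δ : ℝ} {z : SpaceTime}

/-- The convolution at `z` is a pairing with `ζ ↦ ρ(z - ζ)`. Once `z` is later than `δ + ε` this is
an admissible test function, so the weak equations apply to it. -/
lemma isTest_reflect (hρ : ContDiff ℝ ∞ ρ) (hs : ∀ ζ, ε < ‖ζ‖ → ρ ζ = 0) (hδ : 0 ≤ δ)
    (hz : δ + ε < z.1) : IsTest fun ζ => ρ (z - ζ) := by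
  have hsub : Function.support (fun ζ => ρ (z - ζ)) ⊆ Metric.closedBall z ε := by
    intro ζ hζ
    by_contra hcon
    refine hζ (hs _ ?_)
    rw [Metric.mem_closedBall, not_le, dist_comm, dist_eq_norm] at hcon
    exact hcon
  refine ⟨hρ.comp (contDiff_const.sub contDiff_id),
    HasCompactSupport.of_support_subset_isCompact (isCompact_closedBall z ε) hsub, ?_⟩
  refine (closure_minimal hsub Metric.isClosed_closedBall).trans fun ζ hζ => ⟨?_, mem_univ _⟩
  rw [Metric.mem_closedBall, dist_eq_norm] at hζ
  have h1 : |(ζ - z).1| ≤ ε := (norm_fst_le (ζ - z)).trans hζ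
  have h2 := (abs_le.1 h1).1
  simp only [Prod.fst_sub] at h2
  simp only [mem_Ioi]
  linarith

lemma late_of_near (hz : δ + ε < z.1) {ζ : SpaceTime} (h : ‖z - ζ‖ ≤ ε) : δ ≤ ζ.1 := by
  have h1 : |(z - ζ).1| ≤ ε := (norm_fst_le (z - ζ)).trans h
  have h2 := (abs_le.1 h1).2
  simp only [Prod.fst_sub] at h2
  linarith

/-- A kernel of radius `ε` at times beyond `δ + ε` does not see the truncation. -/
lemma moll_cut_eq {E : Type*} [NormedAddCommGroup E] [NormedSpace ℝ E] {f : SpaceTime → E}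
    (hs : ∀ ζ, ε < ‖ζ‖ → ρ ζ = 0) (hz : δ + ε < z.1) :
    moll ρ (cut δ f) z = ∫ ζ, ρ (z - ζ) • f ζ := by
  refine integral_congr_ae (Eventually.of_forall fun ζ => ?_)
  by_cases h : ‖z - ζ‖ ≤ ε
  · simp only [cut_of_le (late_of_near hz h)]
  · simp [hs _ (not_le.1 h)]

lemma pderiv_eq_zero_of_far (hs : ∀ ζ, ε < ‖ζ‖ → ρ ζ = 0) (k : Fin 4) (ζ : SpaceTime)
    (h : ε < ‖ζ‖) : pderiv k ρ ζ = 0 := by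
  refine pderiv_eq_zero_of_eventually ?_
  filter_upwards [(isOpen_lt continuous_const continuous_norm).mem_nhds h] with y hy using hs y hy

lemma hasCompactSupport_of_far (hs : ∀ ζ, ε < ‖ζ‖ → ρ ζ = 0) : HasCompactSupport ρ :=
  HasCompactSupport.intro (isCompact_closedBall (0 : SpaceTime) ε) fun ζ hζ =>
    hs ζ (by simpa using hζ)

/-- Mollification turns the weak gradient into the classical one. -/
lemma pderiv_moll_cut {v : SpaceTime → ℝ} {w : SpaceTime → Grad} (h : IsWeakGrad v w)
    (hρ : ContDiff ℝ ∞ ρ) (hs : ∀ ζ, ε < ‖ζ‖ → ρ ζ = 0) (hδ : 0 < δ) (hz : δ + ε < z.1)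
    (k : Fin 4) : pderiv k (moll ρ (cut δ v)) z = moll ρ (cut δ w) z k := by
  have hc := hasCompactSupport_of_far hs
  rw [pderiv_moll hρ hc (locallyIntegrable_cut h.locInt hδ),
    moll_cut_eq (pderiv_eq_zero_of_far hs k) hz]
  have key := h.eq k _ (isTest_reflect hρ hs hδ.le hz)
  simp only [pderiv_reflect (smooth_differentiable hρ)] at key
  -- The sign from reflecting the kernel cancels the sign in the definition of the weak gradient.
  have e1 : ∫ ζ, pderiv k ρ (z - ζ) • v ζ = ∫ ζ, w ζ k * ρ (z - ζ) := by
    have : ∫ ζ, v ζ * -pderiv k ρ (z - ζ) = -∫ ζ, pderiv k ρ (z - ζ) • v ζ := by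
      rw [← integral_neg]
      exact integral_congr_ae (Eventually.of_forall fun ζ => by simp [mul_comm])
    linarith
  have e2 : moll ρ (cut δ w) z k = ∫ ζ, (ρ (z - ζ) • cut δ w ζ) k :=
    ((EuclideanSpace.proj k : Grad →L[ℝ] ℝ).integral_comp_comm
      (integrable_moll_integrand hρ.continuous hc (locallyIntegrable_cut h.locInt_grad hδ) z)).symm
  rw [e1, e2]
  refine integral_congr_ae (Eventually.of_forall fun ζ => ?_)
  by_cases hn : ‖z - ζ‖ ≤ ε
  · simp [cut_of_le (late_of_near hz hn), mul_comm]
  · simp [hs _ (not_le.1 hn)]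

/-- Mollification turns the weak wave equation into the classical one. -/
lemma box_moll_cut {v G : SpaceTime → ℝ} (h : IsWeakWave v G)
    (hρ : ContDiff ℝ ∞ ρ) (hs : ∀ ζ, ε < ‖ζ‖ → ρ ζ = 0) (hδ : 0 < δ) (hz : δ + ε < z.1) :
    box (moll ρ (cut δ v)) z = moll ρ (cut δ G) z := by
  have hc := hasCompactSupport_of_far hs
  have hbs : ∀ ζ, ε < ‖ζ‖ → box ρ ζ = 0 := fun ζ hζ => by
    simp [box, pderiv_eq_zero_of_far (pderiv_eq_zero_of_far hs _) _ ζ hζ]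
  rw [box_moll hρ hc (locallyIntegrable_cut h.locInt hδ), moll_cut_eq hbs hz, moll_cut_eq hs hz]
  have key := h.eq _ (isTest_reflect hρ hs hδ.le hz)
  simp only [box_reflect hρ] at key
  simpa only [smul_eq_mul, mul_comm] using key

end Mollification

/-! ### `L²` norms with values in `[0, ∞]` and Minkowski's inequality. -/

section Minkowski

variable {X Y : Type*} [MeasurableSpace X] [MeasurableSpace Y]

/-- The `L²` norm of a nonnegative function. -/
noncomputable def l2 (μ : Measure X) (f : X → ℝ≥0∞) : ℝ≥0∞ := (∫⁻ x, f x ^ 2 ∂μ) ^ (1 / 2 : ℝ)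

lemma l2_sq (μ : Measure X) (f : X → ℝ≥0∞) : l2 μ f ^ 2 = ∫⁻ x, f x ^ 2 ∂μ := by
  rw [l2, ← ENNReal.rpow_natCast, ← ENNReal.rpow_mul]; norm_num

lemma l2_mono {μ : Measure X} {f g : X → ℝ≥0∞} (h : ∀ x, f x ≤ g x) : l2 μ f ≤ l2 μ g := by
  unfold l2; gcongr with x; exact h x

lemma l2_congr_ae {μ : Measure X} {f g : X → ℝ≥0∞} (h : f =ᵐ[μ] g) : l2 μ f = l2 μ g := by
  unfold l2
  rw [lintegral_congr_ae (g := fun x => g x ^ 2) (h.mono fun x hx => by simp only [hx])]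

lemma eLpNorm_two_eq_l2 {E : Type*} [NormedAddCommGroup E] (μ : Measure X) (f : X → E) :
    eLpNorm f 2 μ = l2 μ fun x => ‖f x‖ₑ := by
  rw [eLpNorm_eq_lintegral_rpow_enorm_toReal (by norm_num) (by norm_num), l2]
  norm_num

lemma lintegral_mul_le_l2 {μ : Measure X} {f g : X → ℝ≥0∞} (hf : AEMeasurable f μ)
    (hg : AEMeasurable g μ) : ∫⁻ x, f x * g x ∂μ ≤ l2 μ f * l2 μ g := by
  have := ENNReal.lintegral_mul_le_Lp_mul_Lq μ Real.HolderConjugate.two_two hf hg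
  simpa [l2] using this

/-- Minkowski's integral inequality in `L²`. -/
lemma l2_le_lintegral_l2 {μ : Measure X} {ν : Measure Y} [SFinite μ] [SFinite ν]
    {F : X → ℝ≥0∞} (hF : Measurable F) (hfin : l2 μ F ≠ ⊤) {κ : X → Y → ℝ≥0∞}
    (hκ : Measurable (Function.uncurry κ)) (hle : ∀ x, F x ≤ ∫⁻ y, κ x y ∂ν) :
    l2 μ F ≤ ∫⁻ y, l2 μ (fun x => κ x y) ∂ν := by
  rcases eq_or_ne (l2 μ F) 0 with h0 | h0
  · rw [h0]; exact zero_le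
  -- Duality, with `F` tested against itself; finiteness and nonvanishing of `l2 μ F` allow the
  -- final cancellation.
  have h1 : l2 μ F * l2 μ F ≤ l2 μ F * ∫⁻ y, l2 μ (fun x => κ x y) ∂ν := by
    calc l2 μ F * l2 μ F = ∫⁻ x, F x * F x ∂μ := by
          rw [← pow_two, l2_sq]; simp only [pow_two]
      _ ≤ ∫⁻ x, ∫⁻ y, F x * κ x y ∂ν ∂μ := by
          refine lintegral_mono fun x => ?_
          have hx : Measurable (κ x) := hκ.of_uncurry_left
          rw [lintegral_const_mul _ hx]
          gcongr
          exact hle x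
      _ = ∫⁻ y, ∫⁻ x, F x * κ x y ∂μ ∂ν :=
          lintegral_lintegral_swap ((hF.comp measurable_fst).mul hκ).aemeasurable
      _ ≤ ∫⁻ y, l2 μ F * l2 μ (fun x => κ x y) ∂ν :=
          lintegral_mono fun y => lintegral_mul_le_l2 hF.aemeasurable
            (hκ.comp measurable_prodMk_right).aemeasurable
      _ = _ := lintegral_const_mul' _ _ hfin
  exact (ENNReal.mul_le_mul_iff_right h0 hfin).1 h1

end Minkowski

/-! ### Norms of mollified functions on time slices. -/

section SliceBounds

/-- Lebesgue measure on the closed ball of radius `M` about the origin. -/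
noncomputable abbrev ballMeasure (M : ℝ) : Measure Space := volume.restrict (Metric.closedBall 0 M)

variable {ρ : SpaceTime → ℝ} {ε : ℝ} {E : Type*} [NormedAddCommGroup E] [NormedSpace ℝ E]

/-- `φ` is a Borel representative of `|f|`: the function `f` is measurable only almost everywhere,
while Fubini on slices needs a measurable integrand. -/
lemma enorm_moll_le {f : SpaceTime → E} {φ : SpaceTime → ℝ≥0∞}
    (hφ : φ =ᵐ[volume] fun z => ‖f z‖ₑ) (hρ0 : ∀ ζ, 0 ≤ ρ ζ) (z : SpaceTime) :
    ‖moll ρ f z‖ₑ ≤ ∫⁻ ζ, ENNReal.ofReal (ρ ζ) * φ (z - ζ) := by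
  calc ‖moll ρ f z‖ₑ ≤ ∫⁻ ζ, ‖ρ (z - ζ) • f ζ‖ₑ := enorm_integral_le_lintegral_enorm _
    _ = ∫⁻ ζ, ENNReal.ofReal (ρ (z - ζ)) * φ ζ := by
        refine lintegral_congr_ae (hφ.mono fun ζ hζ => ?_)
        simp only [enorm_smul, hζ, Real.enorm_of_nonneg (hρ0 _)]
    _ = ∫⁻ ζ, ENNReal.ofReal (ρ (z - (z - ζ))) * φ (z - ζ) :=
        (lintegral_sub_left_eq_self (fun ζ => ENNReal.ofReal (ρ (z - ζ)) * φ ζ) z).symm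
    _ = _ := by simp

lemma measurable_slice_l2 {φ : SpaceTime → ℝ≥0∞} (hφ : Measurable φ) (M : ℝ) :
    Measurable fun σ : ℝ => l2 (ballMeasure M) fun x => φ (σ, x) :=
  ((hφ.pow_const 2).lintegral_prod_right' (ν := ballMeasure M)).pow_const _

lemma l2_const_mul {X : Type*} [MeasurableSpace X] (μ : Measure X) {c : ℝ≥0∞} (hc : c ≠ ⊤)
    (f : X → ℝ≥0∞) : l2 μ (fun x => c * f x) = c * l2 μ f := by
  unfold l2
  simp only [mul_pow]
  rw [lintegral_const_mul' _ _ (by finiteness), ENNReal.mul_rpow_of_nonneg _ _ (by norm_num),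
    ← ENNReal.rpow_natCast, ← ENNReal.rpow_mul]
  norm_num

lemma l2_translate_le {φ : Space → ℝ≥0∞} {y : Space} (hy : ‖y‖ ≤ 1) (M : ℝ) :
    l2 (ballMeasure M) (fun x => φ (x - y)) ≤ l2 (ballMeasure (M + 1)) φ := by
  unfold l2 ballMeasure
  refine ENNReal.rpow_le_rpow ?_ (by norm_num)
  rw [← lintegral_indicator measurableSet_closedBall, ← lintegral_indicator measurableSet_closedBall,
    ← lintegral_sub_right_eq_self ((Metric.closedBall (0 : Space) (M + 1)).indicator _) y]
  refine lintegral_mono fun x => ?_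
  by_cases hx : x ∈ Metric.closedBall (0 : Space) M
  · have hxy : x - y ∈ Metric.closedBall (0 : Space) (M + 1) := by
      rw [mem_closedBall_zero_iff] at hx ⊢
      exact (norm_sub_le x y).trans (by linarith)
    rw [indicator_of_mem hx, indicator_of_mem hxy]
  · rw [indicator_of_notMem hx]; exact zero_le

/-- The `L²` norm on a time slice of a mollified function. -/
lemma l2_slice_le {f : SpaceTime → E} {φ : SpaceTime → ℝ≥0∞} (hφm : Measurable φ)
    (hφ : φ =ᵐ[volume] fun z => ‖f z‖ₑ) (hρc : Continuous ρ) (hρ0 : ∀ ζ, 0 ≤ ρ ζ)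
    (hs : ∀ ζ, ε < ‖ζ‖ → ρ ζ = 0) (hε : ε ≤ 1) {M s : ℝ} {F : Space → ℝ≥0∞} (hF : Measurable F)
    (hfin : l2 (ballMeasure M) F ≠ ⊤) (hle : ∀ x, F x ≤ ‖moll ρ f (s, x)‖ₑ) :
    l2 (ballMeasure M) F ≤
      ∫⁻ ζ, ENNReal.ofReal (ρ ζ) * l2 (ballMeasure (M + 1)) fun x => φ (s - ζ.1, x) := by
  have hκ : Measurable (Function.uncurry fun (x : Space) (ζ : SpaceTime) =>
      ENNReal.ofReal (ρ ζ) * φ ((s, x) - ζ)) := by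
    refine Measurable.mul ?_ (hφm.comp (Continuous.measurable (by fun_prop)))
    exact ENNReal.measurable_ofReal.comp (hρc.measurable.comp measurable_snd)
  refine (l2_le_lintegral_l2 (ν := volume) hF hfin hκ
    fun x => (hle x).trans (enorm_moll_le hφ hρ0 _)).trans (lintegral_mono fun ζ => ?_)
  rw [l2_const_mul _ ENNReal.ofReal_ne_top]
  by_cases hζ : ε < ‖ζ‖
  · simp [hs ζ hζ]
  · gcongr
    exact l2_translate_le (φ := fun x => φ (s - ζ.1, x))
      ((norm_snd_le ζ).trans ((not_lt.1 hζ).trans hε)) M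

lemma lintegral_ofReal_kernel (hρi : Integrable ρ) (hρ0 : ∀ ζ, 0 ≤ ρ ζ) (h1 : ∫ ζ, ρ ζ = 1) :
    ∫⁻ ζ, ENNReal.ofReal (ρ ζ) = 1 := by
  rw [← ofReal_integral_eq_lintegral_ofReal hρi (Eventually.of_forall hρ0), h1, ENNReal.ofReal_one]

/-- An average with a kernel of mass one does not exceed an almost sure bound on the window of times
it sees. -/
lemma lintegral_kernel_mul_le (hρi : Integrable ρ) (hρ0 : ∀ ζ, 0 ≤ ρ ζ) (h1 : ∫ ζ, ρ ζ = 1)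
    (hs : ∀ ζ, ε < ‖ζ‖ → ρ ζ = 0) {Φ : ℝ → ℝ≥0∞} {S : ℝ≥0∞} {s : ℝ}
    (hΦ : ∀ᵐ σ, |s - σ| ≤ ε → Φ σ ≤ S) :
    ∫⁻ ζ, ENNReal.ofReal (ρ ζ) * Φ (s - ζ.1) ≤ S := by
  -- Transfers null sets of times `σ` to null sets of space-time points `ζ`.
  have hq : Measure.QuasiMeasurePreserving (fun ζ : SpaceTime => s - ζ.1) volume volume :=
    (Measure.measurePreserving_sub_left volume s).quasiMeasurePreserving.comp
      Measure.quasiMeasurePreserving_fst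
  calc _ ≤ ∫⁻ ζ, ENNReal.ofReal (ρ ζ) * S := by
        refine lintegral_mono_ae ((hq.ae hΦ).mono fun ζ hζ => ?_)
        by_cases h : ε < ‖ζ‖
        · simp [hs ζ h]
        · gcongr
          refine hζ ?_
          rw [sub_sub_cancel]
          exact (norm_fst_le ζ).trans (not_lt.1 h)
    _ = S := by
        rw [lintegral_mul_const'' _ hρi.aemeasurable.ennreal_ofReal,
          lintegral_ofReal_kernel hρi hρ0 h1, one_mul]

/-- For fixed `ζ` the time shift moves `[a, b]` by at most `ε`; the kernel then integrates to one.
-/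
lemma lintegral_lintegral_kernel_le (hρc : Continuous ρ) (hρi : Integrable ρ)
    (hρ0 : ∀ ζ, 0 ≤ ρ ζ) (h1 : ∫ ζ, ρ ζ = 1)
    (hs : ∀ ζ, ε < ‖ζ‖ → ρ ζ = 0) {Φ : ℝ → ℝ≥0∞} (hΦ : Measurable Φ) (a b : ℝ) :
    ∫⁻ s in Icc a b, ∫⁻ ζ, ENNReal.ofReal (ρ ζ) * Φ (s - ζ.1) ≤
      ∫⁻ σ in Icc (a - ε) (b + ε), Φ σ := by
  have hm : Measurable fun p : ℝ × SpaceTime => ENNReal.ofReal (ρ p.2) * Φ (p.1 - p.2.1) := by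
    refine Measurable.mul ?_ (hΦ.comp (Continuous.measurable (by fun_prop)))
    exact ENNReal.measurable_ofReal.comp (hρc.measurable.comp measurable_snd)
  rw [lintegral_lintegral_swap hm.aemeasurable]
  calc _ ≤ ∫⁻ ζ, ENNReal.ofReal (ρ ζ) * ∫⁻ σ in Icc (a - ε) (b + ε), Φ σ := by
        refine lintegral_mono fun ζ => ?_
        rw [lintegral_const_mul' _ _ ENNReal.ofReal_ne_top]
        by_cases h : ε < ‖ζ‖
        · simp [hs ζ h]
        · refine mul_le_mul' le_rfl ?_
          have hζ := abs_le.1 ((norm_fst_le ζ).trans (not_lt.1 h) : |ζ.1| ≤ ε)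
          rw [← lintegral_indicator measurableSet_Icc, ← lintegral_indicator measurableSet_Icc,
            ← lintegral_sub_right_eq_self ((Icc (a - ε) (b + ε)).indicator Φ) ζ.1]
          refine lintegral_mono fun s => ?_
          by_cases hsm : s ∈ Icc a b
          · have h2 : s - ζ.1 ∈ Icc (a - ε) (b + ε) :=
              ⟨by linarith [hsm.1, hζ.2], by linarith [hsm.2, hζ.1]⟩
            rw [indicator_of_mem hsm, indicator_of_mem h2]
          · rw [indicator_of_notMem hsm]; exact zero_le
    _ = _ := by
        rw [lintegral_mul_const'' _ hρi.aemeasurable.ennreal_ofReal,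
          lintegral_ofReal_kernel hρi hρ0 h1, one_mul]

end SliceBounds

/-! ### Transfer of the smooth estimate to `[0, ∞]`. -/

section ClassicalENNReal

lemma l2_ball_sqrt {h : Space → ℝ} (hh : Continuous h) (h0 : ∀ x, 0 ≤ h x) (M : ℝ) :
    l2 (ballMeasure M) (fun x => ENNReal.ofReal (√(h x))) =
      ENNReal.ofReal (√(∫ x in Metric.closedBall (0 : Space) M, h x)) := by
  have e : ∀ x, ENNReal.ofReal (√(h x)) ^ 2 = ENNReal.ofReal (h x) := fun x => by
    rw [← ENNReal.ofReal_pow (Real.sqrt_nonneg _), Real.sq_sqrt (h0 x)]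
  rw [l2]
  simp only [e]
  rw [lintegral_ofReal_ball hh h0, ENNReal.ofReal_rpow_of_nonneg (integral_nonneg h0) (by norm_num),
    Real.sqrt_eq_rpow]

lemma enorm_eq_ofReal_sqrt (y : ℝ) : ‖y‖ₑ = ENNReal.ofReal (√(y ^ 2)) := by
  rw [Real.sqrt_sq_eq_abs, Real.enorm_eq_ofReal_abs]

variable {v : SpaceTime → ℝ} {a b : ℝ}

lemma ofReal_dataSize (hv : ContDiff ℝ ∞ v) (hab : a ≤ b) (M : ℝ) :
    ENNReal.ofReal (dataSize v a b M) =
      l2 (ballMeasure M) (fun x => ENNReal.ofReal (√(gradSq v (a, x)))) +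
        ∫⁻ s in Icc a b, l2 (ballMeasure M) fun x => ‖box v (s, x)‖ₑ := by
  have cg := (contDiff_gradSq hv).continuous
  have cb := (contDiff_box hv).continuous
  have e : ∀ s, l2 (ballMeasure M) (fun x => ‖box v (s, x)‖ₑ) =
      ENNReal.ofReal (√(∫ x in Metric.closedBall (0 : Space) M, box v (s, x) ^ 2)) := fun s => by
    simp only [enorm_eq_ofReal_sqrt]
    exact l2_ball_sqrt (by fun_prop) (fun x => sq_nonneg _) M
  simp only [e]
  rw [dataSize, ENNReal.ofReal_add (Real.sqrt_nonneg _)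
    (intervalIntegral.integral_nonneg hab fun _ _ => Real.sqrt_nonneg _),
    l2_ball_sqrt (continuous_slice cg a) (fun x => gradSq_nonneg _ _),
    intervalIntegral.integral_of_le hab, ← integral_Icc_eq_integral_Ioc,
    ofReal_integral_eq_lintegral_ofReal]
  · exact (continuous_box_norm hv M).continuousOn.integrableOn_compact isCompact_Icc
  · exact Eventually.of_forall fun _ => Real.sqrt_nonneg _

lemma lintegral_slab_ofReal {h : SpaceTime → ℝ} (hh : Continuous h) (h0 : ∀ z, 0 ≤ h z)
    (hab : a ≤ b) (M : ℝ) :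
    ∫⁻ z in Icc a b ×ˢ Metric.closedBall (0 : Space) M, ENNReal.ofReal (h z) =
      ENNReal.ofReal (∫ s in a..b, ∫ x in Metric.closedBall (0 : Space) M, h (s, x)) := by
  have hm : Measurable fun z => ENNReal.ofReal (h z) := ENNReal.measurable_ofReal.comp hh.measurable
  rw [show (volume : Measure SpaceTime) = (volume : Measure ℝ).prod (volume : Measure Space) from rfl,
    ← Measure.prod_restrict, lintegral_prod _ hm.aemeasurable]
  simp only [lintegral_ofReal_ball (continuous_slice hh _) (fun x => h0 _)]
  rw [intervalIntegral.integral_of_le hab, ← integral_Icc_eq_integral_Ioc,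
    ofReal_integral_eq_lintegral_ofReal]
  · exact (continuous_ball_integral hh M).continuousOn.integrableOn_compact isCompact_Icc
  · exact Eventually.of_forall fun s => integral_nonneg fun x => h0 _

end ClassicalENNReal

/-! ### Passage from smooth to weak solutions and to the initial time. -/

section Limit

/-- The weighted space-time estimate away from the initial time, for weak solutions. -/
theorem exists_weak_estimate : ∃ C : ℝ, 0 < C ∧
    ∀ {v : SpaceTime → ℝ} {w : SpaceTime → Grad} {G : SpaceTime → ℝ} {a b T N : ℝ} {S : ℝ≥0∞},
    IsWeakGrad v w → IsWeakWave v G → 0 < a → a ≤ b → b - a ≤ T → 2 + T ≤ N →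
    (∀ σ ∈ Icc 0 (2 * a), l2 (ballMeasure (4 * N + 1)) (fun x => ‖w (σ, x)‖ₑ) ≤ S) →
    ∫⁻ z in Icc a b ×ˢ Metric.closedBall (0 : Space) N,
        ENNReal.ofReal (1 + ‖z.2‖)⁻¹ * ‖w z‖ₑ ^ 2 ≤
      ENNReal.ofReal (C * Real.log (2 + T)) *
        (S + ∫⁻ σ in Icc 0 (b + a), l2 (ballMeasure (4 * N + 1)) fun x => ‖G (σ, x)‖ₑ) ^ 2 := by
  obtain ⟨C, hC, hcl⟩ := exists_classical_estimate
  refine ⟨C, hC, ?_⟩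
  intro v w G a b T N S hgrad hwave ha hab hT hN hS
  have hT0 : 0 ≤ T := by linarith
  -- Kernels of radius below `c = min (a/2) 1` see only times after `δ` from any time `≥ a`, see
  -- only times in `[0, 2a]` from time `a`, and enlarge balls by at most `1`.
  set δ := a / 2 with hδ_def
  have hδ : 0 < δ := by positivity
  set c := min δ 1 with hc_def
  have hc : 0 < c := lt_min hδ one_pos
  have hcδ : c ≤ δ := min_le_left _ _
  have hc1 : c ≤ 1 := min_le_right _ _
  -- The inner radius is half the outer one: Lebesgue differentiation needs a bounded ratio.
  let φ : ℕ → ContDiffBump (0 : SpaceTime) := fun n =>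
    ⟨c / (n + 2) / 2, c / (n + 2), by positivity, half_lt_self (by positivity)⟩
  set ρ : ℕ → SpaceTime → ℝ := fun n => (φ n).normed volume with hρ_def
  set ε : ℕ → ℝ := fun n => c / (n + 2) with hε_def
  have hε : ∀ n, ε n < c := fun n => by
    refine div_lt_self hc ?_
    have : (0 : ℝ) ≤ n := n.cast_nonneg
    linarith
  have hρ : ∀ n, ContDiff ℝ ∞ (ρ n) := fun n => (φ n).contDiff_normed
  have hρ0 : ∀ n ζ, 0 ≤ ρ n ζ := fun n ζ => (φ n).nonneg_normed ζ
  have hρi : ∀ n, Integrable (ρ n) := fun n => (φ n).integrable_normed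
  have hρ1 : ∀ n, ∫ ζ, ρ n ζ = 1 := fun n => (φ n).integral_normed
  have hs : ∀ n ζ, ε n < ‖ζ‖ → ρ n ζ = 0 := by
    intro n ζ hζ
    rw [← Function.notMem_support, hρ_def]
    simp only [(φ n).support_normed_eq]
    simpa using hζ.le
  set V : ℕ → SpaceTime → ℝ := fun n => moll (ρ n) (cut δ v)
  have hV : ∀ n, ContDiff ℝ ∞ (V n) := fun n =>
    contDiff_moll (hρ n) (hasCompactSupport_of_far (hs n)) (locallyIntegrable_cut hgrad.locInt hδ)
  have hlate : ∀ n (z : SpaceTime), a ≤ z.1 → δ + ε n < z.1 := fun n z hz => by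
    linarith [hε n]
  have hVgrad : ∀ n (z : SpaceTime), a ≤ z.1 → gradSq (V n) z = ‖moll (ρ n) (cut δ w) z‖ ^ 2 := by
    intro n z hz
    rw [EuclideanSpace.norm_sq_eq, gradSq]
    refine Finset.sum_congr rfl fun k _ => ?_
    rw [pderiv_moll_cut hgrad (hρ n) (hs n) hδ (hlate n z hz), Real.norm_eq_abs, sq_abs]
  have hVbox : ∀ n (z : SpaceTime), a ≤ z.1 → box (V n) z = moll (ρ n) (cut δ G) z :=
    fun n z hz => box_moll_cut hwave (hρ n) (hs n) hδ (hlate n z hz)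
  have hwli := locallyIntegrable_cut hgrad.locInt_grad hδ
  have hGli := locallyIntegrable_cut hwave.locInt_source hδ
  set M := 4 * N with hM
  have hwm := hwli.aestronglyMeasurable.enorm
  have hGm := hGli.aestronglyMeasurable.enorm
  obtain ⟨φw, hφwm, hφw⟩ := hwm
  obtain ⟨φG, hφGm, hφG⟩ := hGm
  have hslice : ∀ {f φ : SpaceTime → ℝ≥0∞}, f =ᵐ[volume] φ → ∀ᵐ σ : ℝ,
      l2 (ballMeasure (M + 1)) (fun x => φ (σ, x)) =
        l2 (ballMeasure (M + 1)) (fun x => f (σ, x)) := by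
    intro f φ h
    have h' : ∀ᵐ z ∂(volume : Measure ℝ).prod (volume : Measure Space), f z = φ z := h
    filter_upwards [Measure.ae_ae_of_ae_prod h'] with σ hσ
    exact (l2_congr_ae (ae_restrict_of_ae hσ)).symm
  have hcut : ∀ {E : Type} [NormedAddCommGroup E] (f : SpaceTime → E) (z : SpaceTime),
      ‖cut δ f z‖ₑ ≤ ‖f z‖ₑ := by
    intro E _ f z
    exact enorm_indicator_le_enorm_self f z
  set Γ := ∫⁻ σ in Icc 0 (b + a), l2 (ballMeasure (M + 1)) fun x => ‖G (σ, x)‖ₑ with hΓ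
  -- A bound uniform in `n` is enough here; convergence of the data and of the source is never used.
  have hdata : ∀ n, ENNReal.ofReal (dataSize (V n) a b M) ≤ S + Γ := by
    intro n
    have cg := (contDiff_gradSq (hV n)).continuous
    have cb := (contDiff_box (hV n)).continuous
    have hε1 : ε n ≤ 1 := (hε n).le.trans hc1
    have hρc := (hρ n).continuous
    rw [ofReal_dataSize (hV n) hab]
    gcongr
    · refine (l2_slice_le hφwm hφw.symm hρc (hρ0 n) (hs n) hε1 (s := a)
        (F := fun x => ENNReal.ofReal (√(gradSq (V n) (a, x))))
        (ENNReal.continuous_ofReal.comp (by fun_prop)).measurable ?_ fun x => ?_).trans ?_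
      · rw [l2_ball_sqrt (by fun_prop) (fun x => gradSq_nonneg _ _)]
        exact ENNReal.ofReal_ne_top
      · rw [hVgrad n (a, x) le_rfl, Real.sqrt_sq (norm_nonneg _), ofReal_norm]
      · refine lintegral_kernel_mul_le (Φ := fun σ => l2 (ballMeasure (M + 1)) fun x => φw (σ, x))
          (hρi n) (hρ0 n) (hρ1 n) (hs n) ?_
        filter_upwards [hslice hφw] with σ hσ hσε
        rw [hσ]
        have h3 := abs_le.1 hσε
        refine (l2_mono fun x => hcut w (σ, x)).trans (hS σ ⟨?_, ?_⟩) <;>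
          linarith [hε n, h3.1, h3.2]
    · calc _ ≤ ∫⁻ s in Icc a b, ∫⁻ ζ, ENNReal.ofReal (ρ n ζ) *
            l2 (ballMeasure (M + 1)) fun x => φG (s - ζ.1, x) := by
            refine setLIntegral_mono' measurableSet_Icc fun s hsab => ?_
            refine l2_slice_le hφGm hφG.symm hρc (hρ0 n) (hs n) hε1 (s := s)
              (Continuous.measurable (by fun_prop)) ?_ fun x => ?_
            · simp only [enorm_eq_ofReal_sqrt]
              rw [l2_ball_sqrt (by fun_prop) (fun x => sq_nonneg _)]
              exact ENNReal.ofReal_ne_top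
            · rw [hVbox n (s, x) hsab.1]
        _ ≤ ∫⁻ σ in Icc (a - ε n) (b + ε n), l2 (ballMeasure (M + 1)) fun x => φG (σ, x) :=
            lintegral_lintegral_kernel_le hρc (hρi n) (hρ0 n) (hρ1 n) (hs n)
              (measurable_slice_l2 hφGm _) a b
        _ = ∫⁻ σ in Icc (a - ε n) (b + ε n), l2 (ballMeasure (M + 1)) fun x => ‖cut δ G (σ, x)‖ₑ :=
            lintegral_congr_ae (ae_restrict_of_ae (hslice hφG))
        _ ≤ ∫⁻ σ in Icc (a - ε n) (b + ε n), l2 (ballMeasure (M + 1)) fun x => ‖G (σ, x)‖ₑ :=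
            lintegral_mono fun σ => l2_mono fun x => hcut G (σ, x)
        _ ≤ Γ := by
            refine lintegral_mono_set (Icc_subset_Icc ?_ ?_) <;> linarith [hε n]
  have hw0 : Continuous fun z : SpaceTime => (1 + ‖z.2‖)⁻¹ :=
    (by fun_prop : Continuous fun z : SpaceTime => 1 + ‖z.2‖).inv₀ fun z => by positivity
  have hbound : ∀ n, ∫⁻ z in Icc a b ×ˢ Metric.closedBall (0 : Space) N,
      ENNReal.ofReal ((1 + ‖z.2‖)⁻¹ * gradSq (V n) z) ≤
        ENNReal.ofReal (C * Real.log (2 + T)) * (S + Γ) ^ 2 := by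
    intro n
    have hL : 0 ≤ C * Real.log (2 + T) := mul_nonneg hC.le (Real.log_nonneg (by linarith))
    rw [lintegral_slab_ofReal (h := fun z => (1 + ‖z.2‖)⁻¹ * gradSq (V n) z)
      (hw0.mul (contDiff_gradSq (hV n)).continuous)
      (fun z => mul_nonneg (by positivity) (gradSq_nonneg _ _)) hab]
    refine (ENNReal.ofReal_le_ofReal (hcl (hV n) hab hT hN)).trans ?_
    rw [ENNReal.ofReal_mul hL, ENNReal.ofReal_pow (dataSize_nonneg hab _)]
    gcongr
    exact hdata n
  have hconv : ∀ᵐ z : SpaceTime, Tendsto (fun n => moll (ρ n) (cut δ w) z) atTop (𝓝 (cut δ w z)) := by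
    have hlim : Tendsto (fun n => (φ n).rOut) atTop (𝓝 0) := by
      have h1 : Tendsto (fun n : ℕ => (n : ℝ) + 2) atTop atTop :=
        tendsto_atTop_add_const_right _ _ tendsto_natCast_atTop_atTop
      exact h1.const_div_atTop c
    have hK : ∀ᶠ n in atTop, (φ n).rOut ≤ 2 * (φ n).rIn := Eventually.of_forall fun n => by
      change c / (n + 2) ≤ 2 * (c / (n + 2) / 2)
      linarith
    filter_upwards [ContDiffBump.ae_convolution_tendsto_right_of_locallyIntegrable hlim hK hwli]
      with z hz
    simp only [convolution_eq_swap] at hz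
    exact hz
  have hmS : MeasurableSet (Icc a b ×ˢ Metric.closedBall (0 : Space) N) :=
    measurableSet_Icc.prod measurableSet_closedBall
  -- Fatou's lemma, using the almost everywhere convergence of the mollified gradients.
  calc _ ≤ ∫⁻ z in Icc a b ×ˢ Metric.closedBall (0 : Space) N,
        liminf (fun n => ENNReal.ofReal ((1 + ‖z.2‖)⁻¹ * gradSq (V n) z)) atTop := by
        refine lintegral_mono_ae ?_
        filter_upwards [ae_restrict_of_ae hconv, ae_restrict_mem hmS] with z hz hzm
        have haz : a ≤ z.1 := hzm.1.1
        rw [cut_of_le (by linarith)] at hz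
        have hlim : Tendsto (fun n => ENNReal.ofReal ((1 + ‖z.2‖)⁻¹ * gradSq (V n) z)) atTop
            (𝓝 (ENNReal.ofReal ((1 + ‖z.2‖)⁻¹ * ‖w z‖ ^ 2))) := by
          simp only [hVgrad _ z haz]
          exact ENNReal.tendsto_ofReal ((hz.norm.pow 2).const_mul _)
        rw [hlim.liminf_eq, ENNReal.ofReal_mul (by positivity), ENNReal.ofReal_pow (norm_nonneg _),
          ofReal_norm]
    _ ≤ liminf (fun n => ∫⁻ z in Icc a b ×ˢ Metric.closedBall (0 : Space) N,
        ENNReal.ofReal ((1 + ‖z.2‖)⁻¹ * gradSq (V n) z)) atTop :=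
        lintegral_liminf_le fun n => (ENNReal.measurable_ofReal.comp
          (hw0.mul (contDiff_gradSq (hV n)).continuous).measurable)
    _ ≤ _ := (liminf_le_liminf (Eventually.of_forall hbound)).trans (liminf_const _).le

/-- Supplies the slice bound near time zero. Continuity holds only in `L²_loc`, so the later slices
are measured on a ball, while the initial one is bounded by its norm on the whole space. -/
lemma exists_small_time {w : SpaceTime → Grad} (hw : IsContL2Loc w) (M : ℝ) {η : ℝ≥0∞}
    (hη : 0 < η) : ∃ a₀ : ℝ, 0 < a₀ ∧ ∀ σ ∈ Icc 0 a₀,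
      l2 (ballMeasure M) (fun x => ‖w (σ, x)‖ₑ) ≤ l2 volume (fun x => ‖w (0, x)‖ₑ) + η := by
  have hK := isCompact_closedBall (0 : Space) M
  have hev := (hw.cont 0 le_rfl _ hK).eventually (Iic_mem_nhds hη)
  obtain ⟨a₁, ha₁, hsub⟩ := (Metric.nhdsWithin_basis_ball (s := Ici (0 : ℝ)) (x := 0)).mem_iff.1 hev
  refine ⟨a₁ / 2, by positivity, fun σ hσ => ?_⟩
  have hσ1 : eLpNorm (fun x => w (σ, x) - w (0, x)) 2 (ballMeasure M) ≤ η := by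
    refine hsub ⟨?_, hσ.1⟩
    rw [Metric.mem_ball, Real.dist_eq, sub_zero, abs_of_nonneg hσ.1]
    linarith [hσ.2]
  have h1 := (hw.memLp σ hσ.1 _ hK).1
  have h0 := (hw.memLp 0 le_rfl _ hK).1
  have h2 := eLpNorm_add_le h0 (h1.sub h0) (p := 2) (by norm_num)
  have e : (fun x => w (0, x)) + ((fun x => w (σ, x)) - fun x => w (0, x)) =
      fun x => w (σ, x) := by ext1 x; simp
  rw [e] at h2
  rw [← eLpNorm_two_eq_l2, ← eLpNorm_two_eq_l2]
  refine h2.trans (add_le_add (eLpNorm_mono_measure _ Measure.restrict_le_self) hσ1)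

/-- The weighted space-time estimate on a ball, up to the initial time. -/
theorem exists_estimate_ball : ∃ C : ℝ, 0 < C ∧
    ∀ {v : SpaceTime → ℝ} {w : SpaceTime → Grad} {G : SpaceTime → ℝ} {t N : ℝ},
    IsWaveSolution v w G → 0 ≤ t → 2 + t ≤ N →
    ∫⁻ z in Ioo 0 t ×ˢ Metric.closedBall (0 : Space) N,
        ENNReal.ofReal (1 + ‖z.2‖)⁻¹ * ‖w z‖ₑ ^ 2 ≤
      ENNReal.ofReal (C * Real.log (2 + t)) * (l2 volume (fun x => ‖w (0, x)‖ₑ) +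
        ∫⁻ σ in Icc 0 t, l2 volume fun x => ‖G (σ, x)‖ₑ) ^ 2 := by
  obtain ⟨C, hC, hest⟩ := exists_weak_estimate
  refine ⟨C, hC, ?_⟩
  intro v w G t N h ht hN
  set X := l2 volume fun x => ‖w (0, x)‖ₑ
  set Y := ∫⁻ σ in Icc 0 t, l2 volume fun x => ‖G (σ, x)‖ₑ
  have hη : ∀ η : ℝ≥0∞, 0 < η → ∫⁻ z in Ioo 0 t ×ˢ Metric.closedBall (0 : Space) N,
      ENNReal.ofReal (1 + ‖z.2‖)⁻¹ * ‖w z‖ₑ ^ 2 ≤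
        ENNReal.ofReal (C * Real.log (2 + t)) * (X + η + Y) ^ 2 := by
    intro η hη
    obtain ⟨a₀, ha₀, hsmall⟩ := exists_small_time h.cont (4 * N + 1) hη
    -- With `a = α n` and `b = t - α n`, one has `2a ≤ a₀` and `b + a = t`. The source therefore
    -- never enters at times beyond `t`, where nothing bounds it.
    set α : ℕ → ℝ := fun n => a₀ / 2 / (n + 1) with hα_def
    have hα : ∀ n, 0 < α n := fun n => by positivity
    have hα0 : ∀ n, α n ≤ a₀ / 2 := fun n =>
      div_le_self (by positivity) (by have : (0 : ℝ) ≤ n := n.cast_nonneg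
                                      linarith)
    have hanti : Antitone α := fun m n hmn => by
      simp only [hα_def]; gcongr
    have hlim : Tendsto α atTop (𝓝 0) := by
      have h1 : Tendsto (fun n : ℕ => (n : ℝ) + 1) atTop atTop :=
        tendsto_atTop_add_const_right _ _ tendsto_natCast_atTop_atTop
      exact h1.const_div_atTop _
    set s : ℕ → Set SpaceTime := fun n =>
      Icc (α n) (t - α n) ×ˢ Metric.closedBall (0 : Space) N with hs
    have hmono : Monotone s := fun m n hmn => prod_mono
      (Icc_subset_Icc (hanti hmn) (by linarith [hanti hmn])) subset_rfl
    have hcover : Ioo 0 t ×ˢ Metric.closedBall (0 : Space) N ⊆ ⋃ n, s n := by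
      rintro ⟨τ, x⟩ ⟨hτ, hx⟩
      have h1 := hlim.eventually (Iio_mem_nhds (lt_min hτ.1 (sub_pos.2 hτ.2)))
      obtain ⟨n, hn⟩ := h1.exists
      have h2 : α n < τ := lt_of_lt_of_le hn (min_le_left _ _)
      have h3 : α n < t - τ := lt_of_lt_of_le hn (min_le_right _ _)
      exact mem_iUnion.2 ⟨n, ⟨⟨h2.le, by linarith⟩, hx⟩⟩
    refine (lintegral_mono_set hcover).trans ?_
    rw [setLIntegral_iUnion_of_directed _ hmono.directed_le]
    refine iSup_le fun n => ?_
    by_cases hle : α n ≤ t - α n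
    · refine (hest (T := t) (S := X + η) h.grad h.wave (hα n) hle (by linarith [hα n]) hN
        fun σ hσ => hsmall σ ⟨hσ.1, by linarith [hσ.2, hα0 n]⟩).trans ?_
      rw [sub_add_cancel]
      gcongr
      refine lintegral_mono fun σ => ?_
      rw [← eLpNorm_two_eq_l2, ← eLpNorm_two_eq_l2]
      exact eLpNorm_mono_measure _ Measure.restrict_le_self
    · simp [hs, Icc_eq_empty hle]
  -- Let `η = 1/n → 0`; the value `η = ∞` at `n = 0` is harmless.
  have hlim : Tendsto (fun n : ℕ => ENNReal.ofReal (C * Real.log (2 + t)) *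
      (X + (n : ℝ≥0∞)⁻¹ + Y) ^ 2) atTop
      (𝓝 (ENNReal.ofReal (C * Real.log (2 + t)) * (X + 0 + Y) ^ 2)) := by
    have h1 : Tendsto (fun n : ℕ => X + (n : ℝ≥0∞)⁻¹ + Y) atTop (𝓝 (X + 0 + Y)) :=
      (tendsto_const_nhds.add ENNReal.tendsto_inv_nat_nhds_zero).add tendsto_const_nhds
    exact ENNReal.Tendsto.const_mul (((ENNReal.continuous_pow 2).tendsto _).comp h1)
      (Or.inr ENNReal.ofReal_ne_top)
  rw [add_zero] at hlim
  exact ge_of_tendsto' hlim fun n => hη _ (ENNReal.inv_pos.2 (ENNReal.natCast_ne_top n))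

end Limit

end WaveKSS

/-! ### The estimate on the whole slab. -/

theorem proposition2p1 :
    ∃ C : ℝ, 0 < C ∧
      ∀ (v : WaveKSS.SpaceTime → ℝ) (w : WaveKSS.SpaceTime → WaveKSS.Grad)
        (G : WaveKSS.SpaceTime → ℝ), WaveKSS.IsWaveSolution v w G →
      ∀ t : ℝ, 0 ≤ t →
        ENNReal.ofReal (Real.log (2 + t) ^ (-(1 / 2) : ℝ)) *
            eLpNorm (fun z : WaveKSS.SpaceTime => (1 + ‖z.2‖) ^ (-(1 / 2) : ℝ) • w z) 2
              (volume.restrict (Icc 0 t ×ˢ (univ : Set WaveKSS.Space)))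
          ≤ ENNReal.ofReal C * eLpNorm (fun x : WaveKSS.Space => w (0, x)) 2 volume +
            ENNReal.ofReal C *
              ∫⁻ s in Icc 0 t, eLpNorm (fun x : WaveKSS.Space => G (s, x)) 2 volume := by
  obtain ⟨C, hC, hest⟩ := WaveKSS.exists_estimate_ball
  refine ⟨√C, Real.sqrt_pos.2 hC, ?_⟩
  intro v w G h t ht
  simp only [WaveKSS.eLpNorm_two_eq_l2]
  set X := WaveKSS.l2 volume fun x => ‖w (0, x)‖ₑ
  set Y := ∫⁻ σ in Icc 0 t, WaveKSS.l2 volume fun x => ‖G (σ, x)‖ₑ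
  have hL : 0 < Real.log (2 + t) := Real.log_pos (by linarith)
  have hpt : ∀ z : WaveKSS.SpaceTime, ‖(1 + ‖z.2‖) ^ (-(1 / 2) : ℝ) • w z‖ₑ ^ 2 =
      ENNReal.ofReal (1 + ‖z.2‖)⁻¹ * ‖w z‖ₑ ^ 2 := by
    intro z
    have h0 : 0 < 1 + ‖z.2‖ := by positivity
    rw [enorm_smul, mul_pow, Real.enorm_of_nonneg (by positivity), ← ENNReal.ofReal_pow (by positivity),
      ← Real.rpow_natCast, ← Real.rpow_mul h0.le, ← Real.rpow_neg_one]
    norm_num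
  have hslab : ∫⁻ z in Icc 0 t ×ˢ (univ : Set WaveKSS.Space),
      ENNReal.ofReal (1 + ‖z.2‖)⁻¹ * ‖w z‖ₑ ^ 2 ≤
        ENNReal.ofReal (C * Real.log (2 + t)) * (X + Y) ^ 2 := by
    have hae : (Icc 0 t ×ˢ (univ : Set WaveKSS.Space) : Set WaveKSS.SpaceTime) =ᵐ[volume]
        (Ioo 0 t ×ˢ (univ : Set WaveKSS.Space) : Set WaveKSS.SpaceTime) :=
      Measure.set_prod_ae_eq Ioo_ae_eq_Icc.symm (ae_eq_refl _)
    rw [setLIntegral_congr hae]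
    -- The constant on balls does not depend on `N`, so monotone convergence over growing balls
    -- reaches the whole slab.
    have hcover : (Ioo 0 t ×ˢ (univ : Set WaveKSS.Space) : Set WaveKSS.SpaceTime) ⊆
        ⋃ n : ℕ, Ioo 0 t ×ˢ Metric.closedBall (0 : WaveKSS.Space) (2 + t + n) := by
      rintro ⟨τ, x⟩ ⟨hτ, -⟩
      obtain ⟨n, hn⟩ := exists_nat_ge ‖x‖
      refine mem_iUnion.2 ⟨n, hτ, ?_⟩
      rw [mem_closedBall_zero_iff]
      linarith
    refine (lintegral_mono_set hcover).trans ?_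
    rw [setLIntegral_iUnion_of_directed]
    · exact iSup_le fun n => hest h ht (by have : (0 : ℝ) ≤ n := n.cast_nonneg
                                           linarith)
    · refine Monotone.directed_le fun m n hmn => prod_mono subset_rfl
        (Metric.closedBall_subset_closedBall ?_)
      have : (m : ℝ) ≤ n := by exact_mod_cast hmn
      linarith
  have hl2 : WaveKSS.l2 (volume.restrict (Icc 0 t ×ˢ (univ : Set WaveKSS.Space)))
      (fun z : WaveKSS.SpaceTime => ‖(1 + ‖z.2‖) ^ (-(1 / 2) : ℝ) • w z‖ₑ) ≤
      ENNReal.ofReal (√(C * Real.log (2 + t))) * (X + Y) := by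
    rw [WaveKSS.l2]
    simp only [hpt]
    refine (ENNReal.rpow_le_rpow hslab (by norm_num)).trans ?_
    rw [ENNReal.mul_rpow_of_nonneg _ _ (by norm_num),
      ENNReal.ofReal_rpow_of_nonneg (by positivity) (by norm_num), ← Real.sqrt_eq_rpow,
      ← ENNReal.rpow_natCast, ← ENNReal.rpow_mul]
    norm_num
  calc _ ≤ ENNReal.ofReal (Real.log (2 + t) ^ (-(1 / 2) : ℝ)) *
        (ENNReal.ofReal (√(C * Real.log (2 + t))) * (X + Y)) := by gcongr
    _ = ENNReal.ofReal (√C) * (X + Y) := by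
        -- The logarithmic prefactor cancels the square root of the logarithm exactly, leaving `√C`.
        rw [← mul_assoc, ← ENNReal.ofReal_mul (by positivity), Real.sqrt_mul hC.le,
          Real.rpow_neg hL.le, ← Real.sqrt_eq_rpow]
        congr 2
        have := Real.sqrt_pos.2 hL
        field_simp
    _ ≤ _ := by rw [mul_add]
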